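/- Let $\Pi_\infty$ be a partially exchangeable random partition of $\mathbb{N}=\{1,2,\dots\}$: there is a function $p$ of finite sequences of positive integers such that, for every $n$ and every partition of $\{1,\dots,n\}$ with clusters $C_1,\dots,C_k$ in order of appearance (increasing order of their least elements), the restriction $\Pi_n$ of $\Pi_\infty$ to $\{1,\dots,n\}$ satisfies $\mathbb{P}(\Pi_n=\{C_1,\dots,C_k\})=p(\#C_1,\dots,\#C_k)$. It is called exchangeable if, for every $n$, the law of $\Pi_n$ is invariant under permutations of $\{1,\dots,n\}$. For $n\ge 0$ let $\Pi_\infty^{(n)}$ be the partition of $\mathbb{N}$ obtained by restricting $\Pi_\infty$ to $\{n+1,n+2,\dots\}$ and subtracting $n$ from every element, and let $P^{(n)}_{\bullet}=(P^{(n)}_1,P^{(n)}_2,\dots)$ be the sequence of limiting relative frequencies of the clusters of $\Pi_\infty^{(n)}$ in order of appearance, with $P^{(n)}_j=0$ if there are fewer than $j$ clusters. Almost surely all these limits exist, and $P^{(n)}_{\bullet}$ is a sub-probability distribution on $\mathbb{N}$, that is, $P^{(n)}_j\ge 0$ and $\sum_j P^{(n)}_j\le 1$. Moreover: (1) The sequence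 $(P^{(n)}_{\bullet},\ n=0,1,\dots)$ is a Markov chain with stationary transition probabilities on the space of sub-probability distributions on $\mathbb{N}$. For $n\ge 1$ the transition from $P^{(n-1)}_{\bullet}$ to $P^{(n)}_{\bullet}$ is by a top to random move: given $P^{(n-1)}_{\bullet}=(P_j)$, the value of $P^{(n)}_{\bullet}$ is $(P_2,P_3,\dots)$ if $P_1=0$, and is $(P_2,\dots,P_X,P_1,P_{X+1},P_{X+2},\dots)$ if $P_1>0$, for a random position $X\in\mathbb{N}$ with the proper conditional distribution $$\mathbb{P}[X>j\mid P^{(n-1)}_{\bullet}=(P_i)]=\mathbb{P}[X>j\mid P^{(0)}_{\bullet},\dots,P^{(n-2)}_{\bullet},\,P^{(n-1)}_{\bullet}=(P_i)]=\prod_{i=1}^{j}\Bigl(1-\frac{P_1}{1-P_2-P_3-\dots-P_i}\Bigr),\qquad j=1,2,\dots,$$ where the denominator for $i=1$ is $1$. (2) $\Pi_\infty$ is exchangeable if and only if this Markov chain is stationary, meaning that $P^{(n)}_{\bullet}$ has the same law as $P^{(0)}_{\bullet}$ for $n=1$, and hence for all $n\ge 1$. (3) If $\Pi_\infty$ is exchangeable,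 then the time-reversed sequence is Markov, and its transition from $P^{(n)}_{\bullet}$ to $P^{(n-1)}_{\bullet}$, $n\ge 1$, is by a random to top move: conditionally on $P^{(n)}_{\bullet},P^{(n+1)}_{\bullet},\dots$, with probability $1-\sum_j P^{(n)}_j$ the frequency $0$ is prepended to the sequence $P^{(n)}_{\bullet}$, and otherwise, with probability $P^{(n)}_j$ for each $j$, the entry $P^{(n)}_j$ is removed and put in place $1$. -/

import Mathlib

open MeasureTheory ProbabilityTheory Filter Topology

namespace PEP

/-! Positive integers and positions in lists are indexed from `0`: the natural number `i` stands for
the element `i + 1` of `{1, 2, …}`, and `p j` stands for `P_{j+1}`. A partition is given by its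
equivalence relation. -/

/-! ### Partitions, order of appearance, frequencies -/

/-- `i` is the least element of its cluster. -/
def IsLeader (s : Setoid ℕ) (i : ℕ) : Prop := ∀ k < i, ¬ s.r k i

/-- The least element of the cluster that contains `m`. -/
noncomputable def leader (s : Setoid ℕ) (m : ℕ) : ℕ := sInf {k | s.r k m}

open Classical in
/-- The allocation sequence: `alloc s m = j` iff `m` belongs to the cluster number `j` (from `0`),
where clusters are listed in increasing order of their least elements. -/
noncomputable def alloc (s : Setoid ℕ) (m : ℕ) : ℕ :=
  ((Finset.range (leader s m)).filter (fun i => IsLeader s i)).card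

/-- The fraction of the first `m` elements that lie in the cluster number `j`
(which is empty if there are fewer clusters). -/
noncomputable def relFreq (s : Setoid ℕ) (j m : ℕ) : ℝ :=
  (((Finset.range m).filter (fun i => alloc s i = j)).card : ℝ) / m

/-- The limiting relative frequency of the cluster number `j`. -/
noncomputable def freq (s : Setoid ℕ) (j : ℕ) : ℝ := limUnder atTop (relFreq s j)

/-- The condition of being a sub-probability distribution. -/
def IsSubProb (p : ℕ → ℝ) : Prop := (∀ j, 0 ≤ p j) ∧ Summable p ∧ ∑' j, p j ≤ 1

/-- The space of sub-probability distributions on the positive integers, with the σ-algebra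
generated by the coordinates. -/
abbrev SubProb : Type := {p : ℕ → ℝ // IsSubProb p}

theorem isSubProb_zero : IsSubProb (fun _ => 0) :=
  ⟨fun _ => le_rfl, summable_zero, by simp⟩

open Classical in
/-- The cluster frequencies in order of appearance, as a sub-probability distribution
(a default value is used if the frequencies fail to form one). -/
noncomputable def freqs (s : Setoid ℕ) : SubProb :=
  if h : IsSubProb (freq s) then ⟨freq s, h⟩ else ⟨fun _ => 0, isSubProb_zero⟩

/-- The shift: restrict to the elements after the first `n` ones, and relabel them
by subtracting `n`. -/
def shift (n : ℕ) (s : Setoid ℕ) : Setoid ℕ := s.comap (fun i => n + i)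

/-- The restriction to the first `n` elements. -/
def restrict (n : ℕ) (s : Setoid ℕ) : Setoid (Fin n) := s.comap (fun i : Fin n => (i : ℕ))

open Classical in
/-- The cluster sizes of a partition of a finite initial segment, in order of appearance. -/
noncomputable def blockSizes {n : ℕ} (s : Setoid (Fin n)) : List ℕ :=
  ((List.finRange n).filter (fun i => decide (∀ k < i, ¬ s.r k i))).map
    (fun i => (Finset.univ.filter (fun k => s.r k i)).card)

section RandomPartitions

variable {Ω : Type*} [MeasurableSpace Ω]

/-- A random partition of the positive integers. -/
def IsRandomPartition (Pt : Ω → Setoid ℕ) : Prop :=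
  ∀ i j, MeasurableSet {ω | (Pt ω).r i j}

/-- Partial exchangeability: the probability that the restriction to the first `n` elements is a
given partition is a function of its cluster sizes in order of appearance. -/
def IsPartiallyExchangeable (μ : Measure Ω) (Pt : Ω → Setoid ℕ) : Prop :=
  ∃ p : List ℕ → ℝ, ∀ (n : ℕ) (s : Setoid (Fin n)),
    μ.real {ω | restrict n (Pt ω) = s} = p (blockSizes s)

/-- Exchangeability: the law of the restriction to the first `n` elements is invariant under
permutations of these elements. -/
def IsExchangeable (μ : Measure Ω) (Pt : Ω → Setoid ℕ) : Prop :=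
  ∀ (n : ℕ) (σ : Equiv.Perm (Fin n)) (s : Setoid (Fin n)),
    μ.real {ω | restrict n (Pt ω) = s.comap σ} = μ.real {ω | restrict n (Pt ω) = s}

end RandomPartitions

/-! ### Moves on sub-probability distributions -/

theorem IsSubProb.comp {p : ℕ → ℝ} (hp : IsSubProb p) {f : ℕ → ℕ} (hf : Function.Injective f) :
    IsSubProb (fun k => p (f k)) :=
  ⟨fun _ => hp.1 _, hp.2.1.comp_injective hf,
    (tsum_comp_le_tsum_of_inj hp.2.1 hp.1 hf).trans hp.2.2⟩

/-- `(P₂, P₃, …)`. -/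
def dropTop (p : SubProb) : SubProb :=
  ⟨fun k => p.1 (k + 1), p.2.comp (add_left_injective 1)⟩

/-- `(P₂, …, P_x, P₁, P_{x+1}, P_{x+2}, …)`, for `x ≥ 1`: the first entry is moved to place `x`. -/
def moveTopTo (x : ℕ) (p : SubProb) : SubProb :=
  ⟨fun k => p.1 (if k + 1 < x then k + 1 else if k + 1 = x then 0 else k),
    p.2.comp (f := fun k => if k + 1 < x then k + 1 else if k + 1 = x then 0 else k) (by
      intro a b h
      dsimp only at h
      split_ifs at h <;> omega)⟩

/-- `(0, P₁, P₂, …)`. -/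
def consZero (p : SubProb) : SubProb :=
  ⟨fun k => Nat.casesOn k 0 p.1, by
    have hs : Summable (fun k : ℕ => (Nat.casesOn k 0 p.1 : ℝ)) :=
      (summable_nat_add_iff 1).1 p.2.2.1
    refine ⟨fun k => ?_, hs, ?_⟩
    · cases k
      · exact le_rfl
      · exact p.2.1 _
    · rw [hs.tsum_eq_zero_add]
      simpa using p.2.2.2⟩

/-- The entry in place `j` (counted from `0`) is removed and put in front. -/
def moveToFront (j : ℕ) (p : SubProb) : SubProb :=
  ⟨fun k => p.1 (if k = 0 then j else if k ≤ j then k - 1 else k),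
    p.2.comp (f := fun k => if k = 0 then j else if k ≤ j then k - 1 else k) (by
      intro a b h
      dsimp only at h
      split_ifs at h <;> omega)⟩

/-! ### The two transition kernels -/

/-- The product `∏_{i=1}^j (1 - P₁ / (1 - P₂ - ⋯ - P_i))`, the probability that the random
position exceeds `j`. -/
noncomputable def posTail (p : SubProb) (j : ℕ) : ℝ :=
  ∏ i ∈ Finset.range j, (1 - p.1 0 / (1 - ∑ l ∈ Finset.range i, p.1 (l + 1)))

theorem measurable_coord (j : ℕ) : Measurable (fun p : SubProb => p.1 j) :=
  (measurable_pi_apply j).comp measurable_subtype_coe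

theorem measurable_posTail (j : ℕ) : Measurable (fun p : SubProb => posTail p j) := by
  unfold posTail
  refine Finset.measurable_prod _ fun i _ => ?_
  exact measurable_const.sub ((measurable_coord 0).div
    (measurable_const.sub (Finset.measurable_sum _ fun l _ => measurable_coord (l + 1))))

theorem measurable_dropTop : Measurable dropTop :=
  Measurable.subtype_mk (measurable_pi_lambda _ fun k => measurable_coord (k + 1))

theorem measurable_moveTopTo (x : ℕ) : Measurable (moveTopTo x) :=
  Measurable.subtype_mk (measurable_pi_lambda _ fun _ => measurable_coord _)

theorem measurable_moveToFront (j : ℕ) : Measurable (moveToFront j) :=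
  Measurable.subtype_mk (measurable_pi_lambda _ fun _ => measurable_coord _)

theorem measurable_consZero : Measurable consZero := by
  refine Measurable.subtype_mk (measurable_pi_lambda _ fun k => ?_)
  cases k
  · exact measurable_const
  · exact measurable_coord _

theorem measurable_total : Measurable (fun p : SubProb => ∑' j, p.1 j) := by
  refine measurable_of_tendsto_metrizable
    (f := fun n (p : SubProb) => ∑ j ∈ Finset.range n, p.1 j)
    (fun n => Finset.measurable_sum _ fun j _ => measurable_coord j) ?_
  exact tendsto_pi_nhds.2 fun p => p.2.2.1.hasSum.tendsto_sum_nat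

/-- The mixture `∑_j w_j(p) δ_{f_j(p)}` as a kernel. -/
noncomputable def mixture (w : ℕ → SubProb → ℝ) (hw : ∀ j, Measurable (w j))
    (f : ℕ → SubProb → SubProb) (hf : ∀ j, Measurable (f j)) : Kernel SubProb SubProb where
  toFun p := Measure.sum fun j => ENNReal.ofReal (w j p) • Measure.dirac (f j p)
  measurable' := by
    refine Measure.measurable_of_measurable_coe _ fun B hB => ?_
    simp only [Measure.sum_apply _ hB, Measure.smul_apply, smul_eq_mul,
      Measure.dirac_apply' _ hB]
    refine Measurable.tsum fun j => ?_
    exact (hw j).ennreal_ofReal.mul ((measurable_one.indicator hB).comp (hf j))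

open Classical in
/-- The top to random move. If `P₁ = 0`, then `P₁` is dropped. If `P₁ > 0`, then `P₁` is moved to
the random place `X`, where `ℙ(X > j) = posTail p j`, that is, `X = j + 1` has probability
`posTail p j - posTail p (j + 1)`. -/
noncomputable def topToRandom : Kernel SubProb SubProb :=
  Kernel.piecewise (s := {p : SubProb | p.1 0 = 0})
    (measurable_coord 0 (measurableSet_singleton 0))
    (Kernel.deterministic dropTop measurable_dropTop)
    (mixture (fun j p => posTail p j - posTail p (j + 1))
      (fun j => (measurable_posTail j).sub (measurable_posTail (j + 1)))
      (fun j => moveTopTo (j + 1)) (fun j => measurable_moveTopTo (j + 1)))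

/-- The random to top move (heaps process, move-to-front rule). With probability `1 - ∑_j P_j` the
frequency `0` is prepended, and with probability `P_j` the frequency `P_j` is removed and put in
front. The first term of the mixture stands for the former, the term `j + 1` for the latter. -/
noncomputable def randomToTop : Kernel SubProb SubProb :=
  mixture (fun i p => Nat.casesOn i (1 - ∑' j, p.1 j) (fun j => p.1 j))
    (fun i => by
      cases i
      · exact measurable_const.sub measurable_total
      · exact measurable_coord _)
    (fun i => Nat.casesOn i consZero (fun j => moveToFront j))
    (fun i => by
      cases i
      · exact measurable_consZero
      · exact measurable_moveToFront _)

/-! ### Markov chains -/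

section MarkovChains

variable {Ω : Type*} [MeasurableSpace Ω] {S : Type*} [MeasurableSpace S]

/-- The σ-algebra generated by `Y 0, …, Y n`. -/
abbrev past (Y : ℕ → Ω → S) (n : ℕ) : MeasurableSpace Ω :=
  ⨆ k : ℕ, ⨆ _ : k ≤ n, MeasurableSpace.comap (Y k) inferInstance

/-- The σ-algebra generated by `Y n, Y (n + 1), …`. -/
abbrev future (Y : ℕ → Ω → S) (n : ℕ) : MeasurableSpace Ω :=
  ⨆ k : ℕ, ⨆ _ : n ≤ k, MeasurableSpace.comap (Y k) inferInstance

/-- `Y` is a Markov chain with stationary transition probabilities, given by the kernel `κ`. -/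
def IsMarkovChain (μ : Measure Ω) (Y : ℕ → Ω → S) (κ : Kernel S S) : Prop :=
  IsMarkovKernel κ ∧ (∀ n, Measurable (Y n)) ∧
    ∀ (n : ℕ) (B : Set S), MeasurableSet B →
      μ⟦Y (n + 1) ⁻¹' B | past Y n⟧ =ᵐ[μ] fun ω => (κ (Y n ω)).real B

/-- The time reversal of `Y` has the Markov property with transition kernel `κ` from
`Y (n + 1)` to `Y n`, for each `n`. -/
def IsReversedMarkovChain (μ : Measure Ω) (Y : ℕ → Ω → S) (κ : Kernel S S) : Prop :=
  IsMarkovKernel κ ∧ (∀ n, Measurable (Y n)) ∧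
    ∀ (n : ℕ) (B : Set S), MeasurableSet B →
      μ⟦Y n ⁻¹' B | future Y (n + 1)⟧ =ᵐ[μ] fun ω => (κ (Y (n + 1) ω)).real B

end MarkovChains

/-- The frequencies of the shifted partitions in order of appearance, for `n = 0, 1, 2, …`. -/
noncomputable def freqProcess {Ω : Type*} (Pt : Ω → Setoid ℕ) (n : ℕ) (ω : Ω) : SubProb :=
  freqs (shift n (Pt ω))

end PEP

namespace PEP

/-! ### Allocation sequences -/

/-! Everything rests on exchanging two neighbours `i`, `i + 1`. Unless both are least elements of
their clusters (`TwoLeaders`), the exchange merely permutes the allocation sequence, so it keeps the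
cluster sizes in order of appearance and the frequencies. Partial exchangeability therefore makes
the law invariant under such exchanges (`SwapInvariant`). This invariance survives shifting by `n`
and conditioning on any event of the frequencies up to time `n` (`swapInvariant_map_shift`), which
is the source of the Markov property; one-step statements are proved for arbitrary finite
swap-invariant measures.

Once cluster `j` has appeared, the events that later elements join it have constant single and pair
probabilities. A second moment law of large numbers gives the frequencies, and averaging gives the
prediction rule (`SwapInvariant.measure_inter_alloc`): given the frequencies and the first `m`
elements, the next one joins an existing cluster `j` with probability `P_j` and opens a new one with
the remaining probability. Hence the law of the partition is determined by that of its frequencies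
(`SwapInvariant.eq_of_map_freqs_eq`). Removing the first element moves its cluster behind those that
appear before its second element. Each time a cluster is about to be added, the competition between
a return to the first cluster and a new cluster yields one factor of `posTail`
(`SwapInvariant.lintegral_posTail`).

Exchangeability is invariance under all neighbour exchanges; it implies shift invariance, because a
cyclic rotation agrees with the shift on a long initial segment. Conversely, equal laws of the
frequencies at times 0 and 1 give equal laws of the partitions, that is, shift invariance. After a
large shift `M`, two neighbouring first elements are very likely singletons within a fixed window,
so their exchange changes nothing there (`SwapInvariant.exchangeable_of_stationary`).

For the reversal, rotation turns the removed first element into the next element after a long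
initial segment of the shifted partition. The prediction rule then gives its cluster, conditionally
on the whole shifted partition (`measure_freqs_inter_shift_one`). -/

open Classical in
/-- The number of clusters that meet the first `m` elements. -/
noncomputable def numClusters (s : Setoid ℕ) (m : ℕ) : ℕ :=
  ((Finset.range m).filter (fun i => IsLeader s i)).card

section Alloc

variable {s t : Setoid ℕ} {i j k l m : ℕ}

theorem leader_rel (s : Setoid ℕ) (m : ℕ) : s.r (leader s m) m :=
  Nat.sInf_mem (s := {k | s.r k m}) ⟨m, s.refl m⟩

theorem leader_le (h : s.r k m) : leader s m ≤ k := Nat.sInf_le h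

theorem leader_le_self (s : Setoid ℕ) (m : ℕ) : leader s m ≤ m := leader_le (s.refl m)

theorem isLeader_leader (s : Setoid ℕ) (m : ℕ) : IsLeader s (leader s m) := fun _ hk h =>
  absurd (leader_le (s.trans h (leader_rel s m))) (not_le.2 hk)

theorem IsLeader.leader_eq (h : IsLeader s m) : leader s m = m :=
  le_antisymm (leader_le_self s m) (not_lt.1 fun hlt => h _ hlt (leader_rel s m))

theorem alloc_eq_numClusters (s : Setoid ℕ) (m : ℕ) :
    alloc s m = numClusters s (leader s m) := rfl

theorem IsLeader.alloc_eq (h : IsLeader s m) : alloc s m = numClusters s m := by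
  rw [alloc_eq_numClusters, h.leader_eq]

theorem numClusters_zero (s : Setoid ℕ) : numClusters s 0 = 0 := by simp [numClusters]

theorem IsLeader.numClusters_succ (h : IsLeader s m) :
    numClusters s (m + 1) = numClusters s m + 1 := by
  classical
  simp [numClusters, Finset.range_add_one, Finset.filter_insert, h]

theorem numClusters_succ_of_not (h : ¬ IsLeader s m) :
    numClusters s (m + 1) = numClusters s m := by
  classical
  simp [numClusters, Finset.range_add_one, Finset.filter_insert, h]

theorem numClusters_mono (s : Setoid ℕ) : Monotone (numClusters s) := by
  classical
  exact fun a b h => Finset.card_le_card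
    (Finset.filter_subset_filter _ (Finset.range_mono h))

theorem alloc_eq_of_rel (h : s.r i k) : alloc s i = alloc s k := by
  have : leader s i = leader s k := le_antisymm
    (leader_le (s.trans (leader_rel s k) (s.symm h))) (leader_le (s.trans (leader_rel s i) h))
  rw [alloc_eq_numClusters, alloc_eq_numClusters, this]

theorem numClusters_leader_lt (h : leader s i < leader s k) : alloc s i < alloc s k := by
  have := numClusters_mono s (Nat.succ_le_of_lt h)
  rw [Nat.succ_eq_add_one, (isLeader_leader s i).numClusters_succ] at this
  exact this

theorem alloc_eq_iff : alloc s i = alloc s k ↔ s.r i k := by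
  refine ⟨fun h => ?_, alloc_eq_of_rel⟩
  rcases lt_trichotomy (leader s i) (leader s k) with h1 | h1 | h1
  · exact absurd h (numClusters_leader_lt h1).ne
  · exact s.trans (s.symm (leader_rel s i)) (h1 ▸ leader_rel s k)
  · exact absurd h (numClusters_leader_lt h1).ne'

theorem isLeader_iff_alloc : IsLeader s i ↔ ∀ k < i, alloc s k ≠ alloc s i := by
  simp only [IsLeader, ne_eq, alloc_eq_iff]

theorem exists_alloc_eq_iff : (∃ l < m, alloc s l = j) ↔ j < numClusters s m := by
  induction m with
  | zero => simp [numClusters_zero]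
  | succ m ih =>
    by_cases hm : IsLeader s m
    · rw [hm.numClusters_succ, Nat.lt_succ_iff_lt_or_eq, ← ih]
      refine ⟨?_, ?_⟩
      · rintro ⟨l, hl, rfl⟩
        rcases Nat.lt_succ_iff_lt_or_eq.1 hl with h | rfl
        · exact Or.inl ⟨l, h, rfl⟩
        · exact Or.inr hm.alloc_eq
      · rintro (⟨l, hl, h⟩ | rfl)
        · exact ⟨l, hl.trans (Nat.lt_succ_self m), h⟩
        · exact ⟨m, Nat.lt_succ_self m, hm.alloc_eq⟩
    · rw [numClusters_succ_of_not hm, ← ih]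
      refine ⟨?_, fun ⟨l, hl, h⟩ => ⟨l, hl.trans (Nat.lt_succ_self m), h⟩⟩
      rintro ⟨l, hl, rfl⟩
      rcases Nat.lt_succ_iff_lt_or_eq.1 hl with h | rfl
      · exact ⟨l, h, rfl⟩
      · rw [isLeader_iff_alloc] at hm
        push Not at hm
        exact hm

theorem alloc_le_numClusters (s : Setoid ℕ) (m : ℕ) : alloc s m ≤ numClusters s m :=
  numClusters_mono s (leader_le_self s m)

theorem not_isLeader_of_alloc_lt (h : alloc s m < numClusters s m) : ¬ IsLeader s m :=
  fun hm => h.ne hm.alloc_eq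

theorem exists_alloc_eq_of_lt (h : l < alloc s i) : ∃ k < i, alloc s k = l :=
  exists_alloc_eq_iff.2 (h.trans_le (alloc_le_numClusters s i))

@[simp] theorem alloc_zero (s : Setoid ℕ) : alloc s 0 = 0 :=
  Nat.le_zero.1 ((alloc_le_numClusters s 0).trans_eq (numClusters_zero s))

/-- Restricted growth: each value is preceded by all smaller ones. -/
def RestrictedGrowth (a : ℕ → ℕ) : Prop := ∀ i, ∀ l < a i, ∃ k < i, a k = l

theorem restrictedGrowth_alloc (s : Setoid ℕ) : RestrictedGrowth (alloc s) :=
  fun _ _ h => exists_alloc_eq_of_lt h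

/-- At a first disagreement, say `a i < b i`, growth of `b` provides an earlier `k` with `b k = a
i`; there `a k = b k`, so `a` identifies `k` and `i` while `b` does not. A restricted growth
sequence is thus the only such labelling of its clusters, and allocation sequences of modified
partitions can be found by guessing them. -/
theorem RestrictedGrowth.eq_of_ker_eq {a b : ℕ → ℕ} (ha : RestrictedGrowth a)
    (hb : RestrictedGrowth b) {n : ℕ}
    (h : ∀ i < n, ∀ k < n, a i = a k ↔ b i = b k) : ∀ i < n, a i = b i := by
  intro i
  induction i using Nat.strong_induction_on with
  | _ i ih =>
  intro hi
  rcases lt_trichotomy (a i) (b i) with hlt | heq | hlt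
  · obtain ⟨k, hk, hkb⟩ := hb i _ hlt
    have h1 := ih k hk (hk.trans hi)
    have h2 : a k = a i := h1.trans hkb
    rw [h k (hk.trans hi) i hi] at h2
    omega
  · exact heq
  · obtain ⟨k, hk, hkb⟩ := ha i _ hlt
    have h1 := ih k hk (hk.trans hi)
    have h2 : b k = b i := h1.symm.trans hkb
    rw [← h k (hk.trans hi) i hi] at h2
    omega

theorem alloc_eq_of_restrictedGrowth {a : ℕ → ℕ} (ha : RestrictedGrowth a)
    (h : ∀ i k, a i = a k ↔ s.r i k) : alloc s = a :=
  funext fun i => (restrictedGrowth_alloc s).eq_of_ker_eq ha (n := i + 1)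
    (fun i _ k _ => by rw [alloc_eq_iff, h]) i (Nat.lt_succ_self i)

theorem restrict_eq_iff {n : ℕ} :
    restrict n s = restrict n t ↔ ∀ i < n, ∀ k < n, (s.r i k ↔ t.r i k) := by
  constructor
  · intro h i hi k hk
    have : (restrict n s).r ⟨i, hi⟩ ⟨k, hk⟩ ↔ (restrict n t).r ⟨i, hi⟩ ⟨k, hk⟩ := by rw [h]
    exact this
  · intro h
    ext i k
    exact h i i.2 k k.2

theorem restrict_eq_iff_alloc {n : ℕ} :
    restrict n s = restrict n t ↔ ∀ i < n, alloc s i = alloc t i := by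
  rw [restrict_eq_iff]
  constructor
  · intro h
    exact (restrictedGrowth_alloc s).eq_of_ker_eq (restrictedGrowth_alloc t)
      (by simpa only [alloc_eq_iff] using h)
  · intro h i hi k hk
    rw [← alloc_eq_iff, ← alloc_eq_iff, h i hi, h k hk]

theorem numClusters_congr (h : ∀ i < m, alloc s i = alloc t i) :
    numClusters s m = numClusters t m := by
  have : ∀ j, j < numClusters s m ↔ j < numClusters t m := fun j => by
    rw [← exists_alloc_eq_iff, ← exists_alloc_eq_iff]
    exact exists_congr fun l => and_congr_right fun hl => by rw [h l hl]
  have h1 := this (numClusters s m)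
  have h2 := this (numClusters t m)
  omega

theorem exists_restrict_eq {n : ℕ} (t : Setoid (Fin n)) : ∃ s : Setoid ℕ, restrict n s = t := by
  rcases n with _ | n
  · exact ⟨⊤, by ext i; exact i.elim0⟩
  · refine ⟨t.comap (Fin.ofNat (n + 1)), ?_⟩
    ext i k
    change t.r (Fin.ofNat (n + 1) i) (Fin.ofNat (n + 1) k) ↔ t.r i k
    simp only [Fin.ofNat_val_eq_self]

end Alloc

/-! ### Exchanging two neighbours -/

section SwapAt

variable {s t : Setoid ℕ} {i j k l m : ℕ}

/-- The elements `i` and `i + 1` are exchanged. -/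
def swapAt (i : ℕ) (s : Setoid ℕ) : Setoid ℕ := s.comap (Equiv.swap i (i + 1))

/-- Both `i` and `i + 1` are the first elements of their clusters. -/
def TwoLeaders (i : ℕ) (s : Setoid ℕ) : Prop := IsLeader s i ∧ IsLeader s (i + 1)

theorem swapAt_rel : (swapAt i s).r k l ↔ s.r (Equiv.swap i (i + 1) k) (Equiv.swap i (i + 1) l) :=
  Iff.rfl

@[simp] theorem swapAt_swapAt (i : ℕ) (s : Setoid ℕ) : swapAt i (swapAt i s) = s := by
  ext k l
  simp only [swapAt_rel, Equiv.swap_apply_self]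

theorem swap_of_lt (h : k < i) : Equiv.swap i (i + 1) k = k :=
  Equiv.swap_apply_of_ne_of_ne (by omega) (by omega)

theorem swap_of_gt (h : i + 1 < k) : Equiv.swap i (i + 1) k = k :=
  Equiv.swap_apply_of_ne_of_ne (by omega) (by omega)

theorem swap_lt_iff (h : m ≤ i ∨ i + 2 ≤ m) : Equiv.swap i (i + 1) k < m ↔ k < m := by
  rw [Equiv.swap_apply_def]
  split_ifs <;> omega

/-- Only two new labels at `i` and `i + 1` could come in the wrong order after the exchange. -/
theorem restrictedGrowth_swap (h : ¬ TwoLeaders i s) :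
    RestrictedGrowth (fun k => alloc s (Equiv.swap i (i + 1) k)) := by
  intro m l hl
  dsimp only at hl ⊢
  rcases lt_trichotomy m i with hm | rfl | hm
  · rw [swap_of_lt hm] at hl
    obtain ⟨k, hk, rfl⟩ := exists_alloc_eq_of_lt hl
    exact ⟨k, hk, by rw [swap_of_lt (hk.trans hm)]⟩
  · rw [Equiv.swap_apply_left] at hl
    have key : ∃ k < m, alloc s k = l := by
      obtain ⟨k, hk, rfl⟩ := exists_alloc_eq_of_lt hl
      rcases Nat.lt_succ_iff_lt_or_eq.1 hk with hk | rfl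
      · exact ⟨k, hk, rfl⟩
      -- The needed label is that of `i` itself. If `i` is not a first element, the label occurs
      -- earlier. Otherwise the label of `i + 1` already occurs at some `k' ≤ i`, and all smaller
      -- labels occur before `k'`.
      · rw [TwoLeaders, not_and_or, isLeader_iff_alloc, isLeader_iff_alloc] at h
        push Not at h
        rcases h with h | ⟨k', hk', h⟩
        · exact h
        · rw [← h] at hl
          obtain ⟨k'', hk'', h''⟩ := exists_alloc_eq_of_lt hl
          exact ⟨k'', by omega, h''⟩
    obtain ⟨k, hk, rfl⟩ := key
    exact ⟨k, hk, by rw [swap_of_lt hk]⟩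
  · rcases Nat.lt_or_ge (i + 1) m with hm' | hm'
    · rw [swap_of_gt hm'] at hl
      obtain ⟨k, hk, rfl⟩ := exists_alloc_eq_of_lt hl
      exact ⟨Equiv.swap i (i + 1) k, (swap_lt_iff (by omega)).2 hk,
        by rw [Equiv.swap_apply_self]⟩
    · obtain rfl : m = i + 1 := by omega
      rw [Equiv.swap_apply_right] at hl
      obtain ⟨k, hk, rfl⟩ := exists_alloc_eq_of_lt hl
      exact ⟨k, by omega, by rw [swap_of_lt hk]⟩

theorem alloc_swapAt (h : ¬ TwoLeaders i s) (k : ℕ) :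
    alloc (swapAt i s) k = alloc s (Equiv.swap i (i + 1) k) :=
  congrFun (alloc_eq_of_restrictedGrowth (restrictedGrowth_swap h)
    fun k l => by rw [swapAt_rel, alloc_eq_iff]) k

theorem isLeader_swapAt (h : k < i ∨ i + 2 ≤ k) : IsLeader (swapAt i s) k ↔ IsLeader s k := by
  simp only [IsLeader, swapAt_rel]
  rw [show Equiv.swap i (i + 1) k = k from
    Equiv.swap_apply_of_ne_of_ne (by omega) (by omega)]
  refine (Equiv.swap i (i + 1)).forall_congr fun {l} => ?_
  rw [swap_lt_iff (by omega)]

theorem TwoLeaders.swapAt (h : TwoLeaders i s) : TwoLeaders i (swapAt i s) := by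
  obtain ⟨h1, h2⟩ := h
  constructor
  · intro k hk hr
    rw [swapAt_rel, swap_of_lt hk, Equiv.swap_apply_left] at hr
    exact h2 k (by omega) hr
  · intro k hk hr
    rw [swapAt_rel, Equiv.swap_apply_right] at hr
    rcases Nat.lt_succ_iff_lt_or_eq.1 hk with hk | rfl
    · rw [swap_of_lt hk] at hr
      exact h1 k hk hr
    · rw [Equiv.swap_apply_left] at hr
      exact h2 k (by omega) (s.symm hr)

@[simp] theorem twoLeaders_swapAt : TwoLeaders i (PEP.swapAt i s) ↔ TwoLeaders i s :=
  ⟨fun h => by simpa using h.swapAt, fun h => h.swapAt⟩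

theorem twoLeaders_congr {n : ℕ} (hn : i + 2 ≤ n) (h : restrict n s = restrict n t) :
    TwoLeaders i s ↔ TwoLeaders i t := by
  rw [restrict_eq_iff_alloc] at h
  have aux : ∀ m < n, IsLeader s m ↔ IsLeader t m := fun m hm => by
    rw [isLeader_iff_alloc, isLeader_iff_alloc]
    refine forall₂_congr fun k hk => ?_
    rw [h k (hk.trans hm), h m hm]
  exact and_congr (aux _ (by omega)) (aux _ (by omega))

theorem restrict_swapAt_congr {n : ℕ} (hn : n ≤ i ∨ i + 2 ≤ n)
    (h : restrict n s = restrict n t) : restrict n (swapAt i s) = restrict n (swapAt i t) := by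
  rw [restrict_eq_iff] at h ⊢
  intro k hk l hl
  exact h _ ((swap_lt_iff hn).2 hk) _ ((swap_lt_iff hn).2 hl)

theorem restrict_swapAt_of_le {n : ℕ} (hn : n ≤ i) :
    restrict n (swapAt i s) = restrict n s := by
  rw [restrict_eq_iff]
  intro k hk l hl
  rw [swapAt_rel, swap_of_lt (by omega), swap_of_lt (by omega)]

theorem card_filter_alloc_swapAt (h : ¬ TwoLeaders i s) (hm : m ≤ i ∨ i + 2 ≤ m) (j : ℕ) :
    ((Finset.range m).filter (fun k => alloc (swapAt i s) k = j)).card =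
      ((Finset.range m).filter (fun k => alloc s k = j)).card := by
  refine Finset.card_equiv (Equiv.swap i (i + 1)) fun k => ?_
  simp only [Finset.mem_filter, Finset.mem_range, alloc_swapAt h, swap_lt_iff hm]

theorem relFreq_swapAt (h : ¬ TwoLeaders i s) (hm : i + 2 ≤ m) (j : ℕ) :
    relFreq (swapAt i s) j m = relFreq s j m := by
  rw [relFreq, relFreq, card_filter_alloc_swapAt h (Or.inr hm)]

theorem freq_swapAt (h : ¬ TwoLeaders i s) : freq (swapAt i s) = freq s := by
  funext j
  have : relFreq (swapAt i s) j =ᶠ[atTop] relFreq s j :=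
    eventually_atTop.2 ⟨i + 2, fun m hm => relFreq_swapAt h hm j⟩
  rw [freq, freq, limUnder, limUnder, Filter.map_congr this]

theorem freqs_swapAt (h : ¬ TwoLeaders i s) : freqs (swapAt i s) = freqs s := by
  classical
  exact congrArg (fun p => if h : IsSubProb p then (⟨p, h⟩ : SubProb)
    else ⟨fun _ => 0, isSubProb_zero⟩) (freq_swapAt h)

theorem shift_swapAt (n i : ℕ) (s : Setoid ℕ) :
    shift n (swapAt (n + i) s) = swapAt i (shift n s) := by
  ext k l
  change s.r _ _ ↔ s.r _ _
  have : ∀ k, Equiv.swap (n + i) (n + i + 1) (n + k) = n + Equiv.swap i (i + 1) k := fun k => by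
    simp only [Equiv.swap_apply_def]
    split_ifs <;> omega
  rw [this, this]

theorem IsLeader.shift {n : ℕ} (h : IsLeader s (n + i)) : IsLeader (shift n s) i :=
  fun k hk => h (n + k) (by omega)

theorem TwoLeaders.shift {n : ℕ} (h : TwoLeaders (n + i) s) : TwoLeaders i (shift n s) :=
  ⟨h.1.shift, IsLeader.shift (n := n) (i := i + 1) h.2⟩

theorem shift_zero (s : Setoid ℕ) : shift 0 s = s := by
  ext i k
  change s.r (0 + i) (0 + k) ↔ s.r i k
  rw [zero_add, zero_add]

theorem shift_shift (n k : ℕ) (s : Setoid ℕ) : shift n (shift k s) = shift (k + n) s := by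
  ext a b
  change s.r (k + (n + a)) (k + (n + b)) ↔ s.r (k + n + a) (k + n + b)
  rw [add_assoc, add_assoc]

end SwapAt

/-! ### Cluster sizes -/

section BlockSizes

open Classical in
theorem map_alloc_filter_isLeader (n : ℕ) (s : Setoid ℕ) :
    ((List.range n).filter (fun i => decide (IsLeader s i))).map (alloc s) =
      List.range (numClusters s n) := by
  induction n with
  | zero => simp [numClusters_zero]
  | succ n ih =>
    rw [List.range_succ, List.filter_append, List.map_append, ih]
    by_cases h : IsLeader s n
    · rw [h.numClusters_succ, List.range_succ]
      simp [h, h.alloc_eq]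
    · rw [numClusters_succ_of_not h]
      simp [h]

/-- The first elements, in increasing order, carry the labels 0, 1, 2, …, so the sizes in order of
appearance are the numbers of occurrences of these labels. -/
theorem blockSizes_restrict (n : ℕ) (s : Setoid ℕ) :
    blockSizes (restrict n s) = (List.range (numClusters s n)).map
      (fun j => ((Finset.range n).filter (fun k => alloc s k = j)).card) := by
  classical
  have h1 : ∀ i : Fin n, (∀ k < i, ¬ (restrict n s).r k i) ↔ IsLeader s i := fun i =>
    ⟨fun h k hk => h ⟨k, hk.trans i.2⟩ hk, fun h k hk => h k hk⟩
  have h2 : ∀ i : Fin n, (Finset.univ.filter (fun k => (restrict n s).r k i)).card =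
      ((Finset.range n).filter (fun k => alloc s k = alloc s i)).card := fun i => by
    refine Finset.card_bij (fun k _ => (k : ℕ)) ?_ ?_ ?_
    · intro k hk
      simp only [Finset.mem_filter, Finset.mem_univ, true_and] at hk
      simp only [Finset.mem_filter, Finset.mem_range, alloc_eq_iff]
      exact ⟨k.2, hk⟩
    · exact fun _ _ _ _ h => Fin.ext h
    · intro k hk
      simp only [Finset.mem_filter, Finset.mem_range, alloc_eq_iff] at hk
      refine ⟨⟨k, hk.1⟩, ?_, rfl⟩
      simp only [Finset.mem_filter, Finset.mem_univ, true_and]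
      exact hk.2
  rw [← map_alloc_filter_isLeader, List.map_map, ← List.map_coe_finRange_eq_range,
    List.filter_map, List.map_map, blockSizes]
  simp only [h1, h2]
  rfl

theorem blockSizes_restrict_congr {n : ℕ} {s t : Setoid ℕ}
    (h : ∀ j, ((Finset.range n).filter (fun k => alloc s k = j)).card =
      ((Finset.range n).filter (fun k => alloc t k = j)).card) :
    blockSizes (restrict n s) = blockSizes (restrict n t) := by
  have hk : numClusters s n = numClusters t n := by
    have : ∀ u : Setoid ℕ, ∀ j, j < numClusters u n ↔
        0 < ((Finset.range n).filter (fun k => alloc u k = j)).card := fun u j => by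
      rw [← exists_alloc_eq_iff, Finset.card_pos]
      simp [Finset.Nonempty]
    have h1 := this s (numClusters s n)
    have h2 := this s (numClusters t n)
    have h3 := this t (numClusters s n)
    have h4 := this t (numClusters t n)
    rw [h] at h1 h2
    omega
  rw [blockSizes_restrict, blockSizes_restrict, hk]
  simp only [h]

theorem blockSizes_restrict_swapAt {n i : ℕ} {s : Setoid ℕ} (h : ¬ TwoLeaders i s)
    (hn : i + 2 ≤ n) :
    blockSizes (restrict n (swapAt i s)) = blockSizes (restrict n s) :=
  blockSizes_restrict_congr (card_filter_alloc_swapAt h (Or.inr hn))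

end BlockSizes

/-! ### The measurable space of partitions -/

/-- The σ-algebra generated by the allocation sequence. -/
noncomputable instance instMeasurableSpaceSetoid : MeasurableSpace (Setoid ℕ) :=
  MeasurableSpace.comap alloc inferInstance

theorem finite_setoid_fin (n : ℕ) : Finite (Setoid (Fin n)) :=
  Finite.of_injective (fun (s : Setoid (Fin n)) (i k : Fin n) => s.r i k) fun s t h => by
    ext i k
    exact iff_of_eq (congrFun (congrFun h i) k)

section Measurability

variable {Ω : Type*} [MeasurableSpace Ω]

theorem measurable_alloc (m : ℕ) : Measurable (fun s => alloc s m) :=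
  (measurable_pi_apply m).comp (comap_measurable alloc)

theorem measurable_setoid_iff_alloc {f : Ω → Setoid ℕ} :
    Measurable f ↔ ∀ i, Measurable (fun ω => alloc (f ω) i) := by
  rw [measurable_comap_iff, measurable_pi_iff]
  rfl

theorem measurableSet_rel (i k : ℕ) : MeasurableSet {s : Setoid ℕ | s.r i k} := by
  simp only [← alloc_eq_iff]
  exact measurableSet_eq_fun (measurable_alloc i) (measurable_alloc k)

theorem measurableSet_restrict_eq {f : Ω → Setoid ℕ}
    (hf : ∀ i k, MeasurableSet {ω | (f ω).r i k}) {n : ℕ} (t : Setoid (Fin n)) :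
    MeasurableSet {ω | restrict n (f ω) = t} := by
  have : {ω | restrict n (f ω) = t} =
      ⋂ i : Fin n, ⋂ k : Fin n, {ω | (f ω).r i k ↔ t.r i k} := by
    ext ω
    simp only [Set.mem_ofPred_eq, Set.mem_iInter]
    exact ⟨fun h i k => by rw [← h]; rfl, fun h => by ext i k; exact h i k⟩
  rw [this]
  refine MeasurableSet.iInter fun i => MeasurableSet.iInter fun k => ?_
  by_cases h : t.r i k
  · simpa only [h, iff_true] using hf i k
  · have := (hf i k).compl
    simp only [h, iff_false]
    exact this

theorem measurableSet_preimage_of_restrict {f : Ω → Setoid ℕ}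
    (hf : ∀ i k, MeasurableSet {ω | (f ω).r i k}) (n : ℕ) {E : Set (Setoid ℕ)}
    (hE : ∀ s t, restrict n s = restrict n t → s ∈ E → t ∈ E) : MeasurableSet (f ⁻¹' E) := by
  have := finite_setoid_fin n
  have : f ⁻¹' E = ⋃ t ∈ restrict n '' E, {ω | restrict n (f ω) = t} := by
    ext ω
    simp only [Set.mem_preimage, Set.mem_iUnion, Set.mem_image, exists_prop, Set.mem_ofPred_eq]
    constructor
    · exact fun h => ⟨_, ⟨_, h, rfl⟩, rfl⟩
    · rintro ⟨_, ⟨s, hs, rfl⟩, h⟩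
      exact hE s _ h.symm hs
  rw [this]
  exact (Set.toFinite _).measurableSet_biUnion fun t _ => measurableSet_restrict_eq hf t

theorem measurable_of_rel {f : Ω → Setoid ℕ} (hf : ∀ i k, MeasurableSet {ω | (f ω).r i k}) :
    Measurable f := by
  refine measurable_setoid_iff_alloc.2 fun m => measurable_to_countable' fun j => ?_
  refine measurableSet_preimage_of_restrict hf (m + 1) (E := {s | alloc s m = j}) ?_
  intro s t h hs
  rw [restrict_eq_iff_alloc] at h
  exact (h m (Nat.lt_succ_self m)).symm.trans hs

theorem measurableSet_of_restrict (n : ℕ) {E : Set (Setoid ℕ)}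
    (hE : ∀ s t, restrict n s = restrict n t → s ∈ E → t ∈ E) : MeasurableSet E :=
  measurableSet_preimage_of_restrict measurableSet_rel n hE

theorem measurable_of_restrict {β : Type*} [MeasurableSpace β] (n : ℕ) {f : Setoid ℕ → β}
    (hf : ∀ s t, restrict n s = restrict n t → f s = f t) : Measurable f := fun B _ =>
  measurableSet_of_restrict n fun s t h hs => by
    rwa [Set.mem_preimage, ← hf s t h]

theorem measurable_swapAt (i : ℕ) : Measurable (swapAt i) :=
  measurable_of_rel fun _ _ => measurableSet_rel _ _

theorem measurable_shift (n : ℕ) : Measurable (shift n) :=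
  measurable_of_rel fun _ _ => measurableSet_rel _ _

theorem measurableSet_isLeader (m : ℕ) : MeasurableSet {s | IsLeader s m} := by
  simp only [IsLeader, Set.ofPred_forall]
  exact MeasurableSet.iInter fun k => MeasurableSet.iInter fun _ => (measurableSet_rel k m).compl

theorem measurableSet_twoLeaders (i : ℕ) : MeasurableSet {s | TwoLeaders i s} :=
  (measurableSet_isLeader i).inter (measurableSet_isLeader (i + 1))

theorem measurable_numClusters (m : ℕ) : Measurable (fun s => numClusters s m) :=
  measurable_of_restrict m fun _ _ h => numClusters_congr (restrict_eq_iff_alloc.1 h)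

theorem measurable_relFreq (j m : ℕ) : Measurable (fun s => relFreq s j m) :=
  measurable_of_restrict m fun s t h => by
    rw [restrict_eq_iff_alloc] at h
    have : (Finset.range m).filter (fun i => alloc s i = j) =
        (Finset.range m).filter (fun i => alloc t i = j) :=
      Finset.filter_congr fun i hi => by rw [h i (Finset.mem_range.1 hi)]
    rw [relFreq, relFreq, this]

theorem measurable_freq (j : ℕ) : Measurable (fun s => freq s j) :=
  (StronglyMeasurable.limUnder fun m => (measurable_relFreq j m).stronglyMeasurable).measurable

theorem measurableSet_isSubProb : MeasurableSet {p : ℕ → ℝ | IsSubProb p} := by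
  have : {p : ℕ → ℝ | IsSubProb p} =
      (⋂ j, {p | 0 ≤ p j}) ∩ ⋂ n, {p | ∑ j ∈ Finset.range n, p j ≤ 1} := by
    ext p
    simp only [Set.mem_ofPred_eq, Set.mem_inter_iff, Set.mem_iInter]
    constructor
    · exact fun h => ⟨h.1, fun n => (h.2.1.sum_le_tsum _ fun j _ => h.1 j).trans h.2.2⟩
    · intro h
      have hs : Summable p := summable_of_sum_range_le h.1 h.2
      exact ⟨h.1, hs, hs.tsum_le_of_sum_range_le h.2⟩
  rw [this]
  refine (MeasurableSet.iInter fun j => ?_).inter (MeasurableSet.iInter fun n => ?_)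
  · exact measurableSet_le measurable_const (measurable_pi_apply j)
  · exact measurableSet_le (Finset.measurable_sum _ fun j _ => measurable_pi_apply j)
      measurable_const

theorem measurable_freqs : Measurable freqs := by
  refine Measurable.subtype_mk (f := fun s => (freqs s).1) ?_
  classical
  have h : (fun s => (freqs s).1) = fun s =>
      Set.piecewise {s | IsSubProb (freq s)} freq (fun _ _ => 0) s := by
    funext s
    by_cases h : IsSubProb (freq s) <;> simp [freqs, h, Set.piecewise]
  rw [h]
  have hf : Measurable freq := measurable_pi_lambda _ measurable_freq
  exact Measurable.piecewise (hf measurableSet_isSubProb) hf measurable_const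

end Measurability

/-! ### Cylinders determine finite measures on partitions -/

theorem measurableSet_cylinder {n : ℕ} (t : Setoid (Fin n)) :
    MeasurableSet {s : Setoid ℕ | restrict n s = t} :=
  measurableSet_restrict_eq (f := id) measurableSet_rel t

theorem measure_restrict_preimage_congr {ν ν' : Measure (Setoid ℕ)} {n : ℕ}
    (h : ∀ t : Setoid (Fin n), ν {s | restrict n s = t} = ν' {s | restrict n s = t})
    (D : Set (Setoid (Fin n))) : ν (restrict n ⁻¹' D) = ν' (restrict n ⁻¹' D) := by
  have := finite_setoid_fin n
  have key : ∀ ρ : Measure (Setoid ℕ), ρ (restrict n ⁻¹' D) =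
      ∑ t ∈ (Set.toFinite D).toFinset, ρ {s | restrict n s = t} := fun ρ => by
    rw [← measure_biUnion_finset]
    · congr 1
      ext s
      simp
    · intro t _ t' _ htt'
      exact Set.disjoint_left.2 fun s hs hs' => htt' (hs.symm.trans hs')
    · exact fun t _ => measurableSet_cylinder t
  rw [key, key]
  exact Finset.sum_congr rfl fun t _ => h t

/-- Finite measures on partitions are determined by the restrictions to initial segments. -/
theorem ext_of_cylinders {ν ν' : Measure (Setoid ℕ)} [IsFiniteMeasure ν] (n₀ : ℕ)
    (h : ∀ n, n₀ ≤ n → ∀ s₀ : Setoid ℕ,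
      ν {s | restrict n s = restrict n s₀} = ν' {s | restrict n s = restrict n s₀}) : ν = ν' := by
  have h' : ∀ n, n₀ ≤ n → ∀ D : Set (Setoid (Fin n)),
      ν (restrict n ⁻¹' D) = ν' (restrict n ⁻¹' D) := fun n hn D =>
    measure_restrict_preimage_congr (fun t => by
      obtain ⟨s₀, rfl⟩ := exists_restrict_eq t
      exact h n hn s₀) D
  let C : Set (Set (Setoid ℕ)) := {E | ∃ n, n₀ ≤ n ∧ ∀ s t, restrict n s = restrict n t →
    s ∈ E → t ∈ E}
  have hC : ∀ E ∈ C, ν E = ν' E := by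
    rintro E ⟨n, hn, hE⟩
    have : E = restrict n ⁻¹' (restrict n '' E) := by
      ext s
      exact ⟨fun hs => ⟨s, hs, rfl⟩, fun ⟨t, ht, hts⟩ => hE t s hts ht⟩
    rw [this]
    exact h' n hn _
  have mono : ∀ {m n : ℕ}, m ≤ n → ∀ s t : Setoid ℕ, restrict n s = restrict n t →
      restrict m s = restrict m t := fun hmn s t hst => by
    rw [restrict_eq_iff] at hst ⊢
    exact fun i hi k hk => hst i (by omega) k (by omega)
  refine ext_of_generate_finite C ?_ ?_ hC (hC _ ⟨n₀, le_rfl, fun _ _ _ _ => trivial⟩)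
  · apply le_antisymm
    · rintro _ ⟨B, hB, rfl⟩
      have : @Measurable _ _ (MeasurableSpace.generateFrom C) _ alloc := by
        refine @measurable_pi_lambda _ _ _ (MeasurableSpace.generateFrom C) _ _ fun m => ?_
        refine @measurable_to_countable' _ _ _ _ (MeasurableSpace.generateFrom C) _ fun j => ?_
        refine MeasurableSpace.measurableSet_generateFrom
          ⟨max n₀ (m + 1), le_max_left _ _, fun s t hst hs => ?_⟩
        rw [restrict_eq_iff_alloc] at hst
        exact (hst m (by omega)).symm.trans hs
      exact this hB
    · refine MeasurableSpace.generateFrom_le ?_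
      rintro E ⟨n, -, hE⟩
      exact measurableSet_of_restrict n hE
  · rintro E ⟨n, hn, hE⟩ F ⟨m, hm, hF⟩ -
    refine ⟨max n m, hn.trans (le_max_left _ _), fun s t hst hs => ⟨?_, ?_⟩⟩
    · exact hE s t (mono (le_max_left _ _) _ _ hst) hs.1
    · exact hF s t (mono (le_max_right _ _) _ _ hst) hs.2

/-! ### Invariance under exchanges -/

/-- The measure of an event is preserved when `i` and `i + 1` are exchanged, provided that on this
event they are not both first elements of their clusters. -/
def SwapInvariant (ν : Measure (Setoid ℕ)) : Prop :=
  ∀ i E, MeasurableSet E → (∀ s ∈ E, ¬ TwoLeaders i s) → ν (swapAt i ⁻¹' E) = ν E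

/-- For `n ≥ i + 2` the restriction to the first `n` elements decides `TwoLeaders i`. On cylinders
outside this event the exchange preserves the block sizes, hence the probability. -/
theorem IsPartiallyExchangeable.swapInvariant {Ω : Type*} [MeasurableSpace Ω] {μ : Measure Ω}
    [IsProbabilityMeasure μ] {Pt : Ω → Setoid ℕ} (hPt : Measurable Pt)
    (h : IsPartiallyExchangeable μ Pt) : SwapInvariant (μ.map Pt) := by
  obtain ⟨p, hp⟩ := h
  have : IsProbabilityMeasure (μ.map Pt) := Measure.isProbabilityMeasure_map hPt.aemeasurable
  set ν := μ.map Pt with hν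
  have hp' : ∀ n (t : Setoid (Fin n)), ν {s | restrict n s = t} =
      ENNReal.ofReal (p (blockSizes t)) := fun n t => by
    rw [← hp, Measure.real, ENNReal.ofReal_toReal (measure_ne_top _ _), hν,
      Measure.map_apply hPt (measurableSet_cylinder t)]
    rfl
  intro i E hE hEi
  -- The claim for all `E` at once: the part of `ν` outside `TwoLeaders i` is invariant, which can
  -- be tested on cylinders.
  have key : (ν.restrict {s | ¬ TwoLeaders i s}).map (swapAt i) =
      ν.restrict {s | ¬ TwoLeaders i s} := by
    refine ext_of_cylinders (i + 2) fun n hn s₀ => ?_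
    rw [Measure.map_apply (measurable_swapAt i) (measurableSet_cylinder _),
      Measure.restrict_apply (measurable_swapAt i (measurableSet_cylinder _)),
      Measure.restrict_apply (measurableSet_cylinder _)]
    by_cases hs₀ : TwoLeaders i s₀
    · have h1 : {s | restrict n s = restrict n s₀} ∩ {s | ¬ TwoLeaders i s} = ∅ := by
        ext s
        simp only [Set.mem_inter_iff, Set.mem_ofPred_eq, Set.mem_empty_iff_false, iff_false,
          not_and, not_not]
        exact fun hs => (twoLeaders_congr hn hs).2 hs₀
      have h2 : swapAt i ⁻¹' {s | restrict n s = restrict n s₀} ∩ {s | ¬ TwoLeaders i s} = ∅ := by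
        ext s
        simp only [Set.mem_inter_iff, Set.mem_preimage, Set.mem_ofPred_eq,
          Set.mem_empty_iff_false, iff_false, not_and, not_not]
        exact fun hs => twoLeaders_swapAt.1 ((twoLeaders_congr hn hs).2 hs₀)
      rw [h1, h2]
    · have h1 : {s | restrict n s = restrict n s₀} ∩ {s | ¬ TwoLeaders i s} =
          {s | restrict n s = restrict n s₀} := Set.inter_eq_left.2 fun s hs =>
        fun hs' => hs₀ ((twoLeaders_congr hn hs).1 hs')
      have h2 : swapAt i ⁻¹' {s | restrict n s = restrict n s₀} ∩ {s | ¬ TwoLeaders i s} =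
          {s | restrict n s = restrict n (swapAt i s₀)} := by
        ext s
        simp only [Set.mem_inter_iff, Set.mem_preimage, Set.mem_ofPred_eq]
        constructor
        · rintro ⟨hs, -⟩
          rw [← swapAt_swapAt i s]
          exact restrict_swapAt_congr (Or.inr hn) hs
        · intro hs
          refine ⟨?_, fun hs' => hs₀ ?_⟩
          · rw [← swapAt_swapAt i s₀]
            exact restrict_swapAt_congr (Or.inr hn) hs
          · exact twoLeaders_swapAt.1 ((twoLeaders_congr hn hs).1 hs')
      rw [h1, h2, hp', hp', blockSizes_restrict_swapAt hs₀ hn]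
  have h1 := congrArg (fun ρ => ρ E) key
  rw [Measure.map_apply (measurable_swapAt i) hE,
    Measure.restrict_apply (measurable_swapAt i hE), Measure.restrict_apply hE,
    Set.inter_eq_left.2 (show E ⊆ {s | ¬ TwoLeaders i s} from hEi),
    Set.inter_eq_left.2 (show swapAt i ⁻¹' E ⊆ {s | ¬ TwoLeaders i s} from
      fun s hs hs' => hEi _ hs hs'.swapAt)] at h1
  exact h1

/-- Conditioning the shifted partition on an event that is not affected by exchanges. -/
theorem SwapInvariant.map_shift {ν : Measure (Setoid ℕ)} (hν : SwapInvariant ν) (n : ℕ)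
    {A : Set (Setoid ℕ)} (hA : MeasurableSet A)
    (hinv : ∀ i s, ¬ TwoLeaders i (shift n s) → (swapAt (n + i) s ∈ A ↔ s ∈ A)) :
    SwapInvariant ((ν.restrict A).map (shift n)) := by
  intro i E hE hEi
  rw [Measure.map_apply (measurable_shift n) hE,
    Measure.map_apply (measurable_shift n) (measurable_swapAt i hE),
    Measure.restrict_apply (measurable_shift n hE),
    Measure.restrict_apply (measurable_shift n (measurable_swapAt i hE)),
    ← hν (n + i) _ ((measurable_shift n hE).inter hA) fun s hs hs' => hEi _ hs.1 hs'.shift]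
  congr 1
  ext s
  simp only [Set.mem_inter_iff, Set.mem_preimage, shift_swapAt]
  refine and_congr_right fun hs => (hinv i s fun h => hEi _ hs h.swapAt).symm

/-! ### A law of large numbers for events with constant pair probabilities -/

section LLN

variable {Ω : Type*}

/-- The number of the events `Z 0, …, Z (n - 1)` that occur. -/
noncomputable def countEvents (Z : ℕ → Set Ω) (n : ℕ) (ω : Ω) : ℝ :=
  ∑ i ∈ Finset.range n, (Z i).indicator 1 ω

theorem countEvents_nonneg (Z : ℕ → Set Ω) (n : ℕ) (ω : Ω) : 0 ≤ countEvents Z n ω :=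
  Finset.sum_nonneg fun _ _ => Set.indicator_nonneg (fun _ _ => zero_le_one) _

theorem countEvents_le (Z : ℕ → Set Ω) (n : ℕ) (ω : Ω) : countEvents Z n ω ≤ n := by
  refine (Finset.sum_le_card_nsmul _ _ 1 fun i _ => ?_).trans_eq (by simp)
  exact Set.indicator_le_self' (fun _ _ => zero_le_one) ω

theorem countEvents_mono (Z : ℕ → Set Ω) (ω : Ω) : Monotone (fun n => countEvents Z n ω) :=
  monotone_nat_of_le_succ fun n => by
    rw [countEvents, countEvents, Finset.sum_range_succ]
    exact le_add_of_nonneg_right (Set.indicator_nonneg (fun _ _ => zero_le_one) _)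

variable [MeasurableSpace Ω] {μ : Measure Ω} [IsFiniteMeasure μ]

/-- Among the `m * n` pairs of indices, exactly the `m` diagonal ones contribute `c₁` instead of
`c₂`. -/
theorem integral_countEvents_mul {Z : ℕ → Set Ω} (hZ : ∀ i, MeasurableSet (Z i)) {c₁ c₂ : ℝ}
    (h₁ : ∀ i, μ.real (Z i) = c₁) (h₂ : ∀ i k, i < k → μ.real (Z i ∩ Z k) = c₂) {m n : ℕ}
    (hmn : m ≤ n) :
    ∫ ω, countEvents Z m ω * countEvents Z n ω ∂μ = m * n * c₂ + m * (c₁ - c₂) := by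
  have hint : ∀ i k, Integrable (fun ω => (Z i).indicator (1 : Ω → ℝ) ω *
      (Z k).indicator (1 : Ω → ℝ) ω) μ := fun i k => by
    simp only [← Set.inter_indicator_mul, mul_one, Pi.one_apply]
    exact (integrable_const (1 : ℝ)).indicator ((hZ i).inter (hZ k))
  have hval : ∀ i k, ∫ ω, (Z i).indicator (1 : Ω → ℝ) ω * (Z k).indicator (1 : Ω → ℝ) ω ∂μ =
      c₂ + if i = k then c₁ - c₂ else 0 := fun i k => by
    simp only [← Set.inter_indicator_mul, mul_one, Pi.one_apply]
    rw [integral_indicator_const _ ((hZ i).inter (hZ k)), smul_eq_mul, mul_one]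
    rcases lt_trichotomy i k with h | rfl | h
    · rw [h₂ i k h, if_neg h.ne, add_zero]
    · rw [Set.inter_self, h₁, if_pos rfl]; ring
    · rw [Set.inter_comm, h₂ k i h, if_neg h.ne', add_zero]
  simp only [countEvents, Finset.sum_mul_sum]
  rw [integral_finsetSum _ fun i _ => integrable_finsetSum _ fun k _ => hint i k]
  simp_rw [integral_finsetSum _ fun k _ => hint _ k, hval, Finset.sum_add_distrib,
    Finset.sum_ite_eq]
  rw [Finset.sum_congr rfl fun i hi => if_pos (Finset.mem_range.2
    ((Finset.mem_range.1 hi).trans_le hmn))]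
  simp
  ring

theorem measurable_countEvents {Z : ℕ → Set Ω} (hZ : ∀ i, MeasurableSet (Z i)) (n : ℕ) :
    Measurable (countEvents Z n) :=
  Finset.measurable_sum _ fun i _ => measurable_one.indicator (hZ i)

/-- Expanding the square gives exactly `(c₁ - c₂) * (1 / m - 1 / n)`. -/
theorem lintegral_sq_average_sub {Z : ℕ → Set Ω} (hZ : ∀ i, MeasurableSet (Z i)) {c₁ c₂ : ℝ}
    (h₁ : ∀ i, μ.real (Z i) = c₁) (h₂ : ∀ i k, i < k → μ.real (Z i ∩ Z k) = c₂) {m n : ℕ}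
    (hm : 0 < m) (hmn : m ≤ n) :
    ∫⁻ ω, ENNReal.ofReal ((countEvents Z n ω / n - countEvents Z m ω / m) ^ 2) ∂μ ≤
      ENNReal.ofReal (c₁ / m) := by
  have hint : ∀ a b, Integrable (fun ω => countEvents Z a ω * countEvents Z b ω) μ := fun a b => by
    refine Integrable.of_bound
      ((measurable_countEvents hZ a).mul (measurable_countEvents hZ b)).aestronglyMeasurable
      (a * b) (ae_of_all _ fun ω => ?_)
    rw [Real.norm_of_nonneg (mul_nonneg (countEvents_nonneg _ _ _) (countEvents_nonneg _ _ _))]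
    exact mul_le_mul (countEvents_le _ _ _) (countEvents_le _ _ _) (countEvents_nonneg _ _ _)
      (Nat.cast_nonneg _)
  have hm' : (0 : ℝ) < m := Nat.cast_pos.2 hm
  have hn' : (0 : ℝ) < n := hm'.trans_le (Nat.cast_le.2 hmn)
  have hexp : ∀ ω, (countEvents Z n ω / n - countEvents Z m ω / m) ^ 2 =
      (1 / n ^ 2) * (countEvents Z n ω * countEvents Z n ω) -
      (2 / (m * n)) * (countEvents Z m ω * countEvents Z n ω) +
      (1 / m ^ 2) * (countEvents Z m ω * countEvents Z m ω) := fun ω => by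
    field_simp
    ring
  have hI : Integrable (fun ω => (countEvents Z n ω / n - countEvents Z m ω / m) ^ 2) μ := by
    simp only [hexp]
    exact (((hint n n).const_mul _).sub ((hint m n).const_mul _)).add ((hint m m).const_mul _)
  rw [← ofReal_integral_eq_lintegral_ofReal hI (ae_of_all _ fun ω => sq_nonneg _)]
  refine ENNReal.ofReal_le_ofReal ?_
  simp only [hexp]
  have hadd := integral_add
    (((hint n n).const_mul (1 / (n : ℝ) ^ 2)).sub ((hint m n).const_mul (2 / ((m : ℝ) * n))))
    ((hint m m).const_mul (1 / (m : ℝ) ^ 2))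
  simp only [Pi.sub_apply] at hadd
  rw [hadd, integral_sub ((hint n n).const_mul _) ((hint m n).const_mul _), integral_const_mul,
    integral_const_mul, integral_const_mul, integral_countEvents_mul hZ h₁ h₂ le_rfl,
    integral_countEvents_mul hZ h₁ h₂ hmn, integral_countEvents_mul hZ h₁ h₂ le_rfl]
  have hc₂ : 0 ≤ c₂ := by rw [← h₂ 0 1 one_pos]; exact measureReal_nonneg
  have hc : c₂ ≤ c₁ := by
    rw [← h₂ 0 1 one_pos, ← h₁ 0]
    exact measureReal_mono Set.inter_subset_left
  have : 1 / (n : ℝ) ^ 2 * (n * n * c₂ + n * (c₁ - c₂)) -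
      2 / (m * n) * (m * n * c₂ + m * (c₁ - c₂)) +
      1 / (m : ℝ) ^ 2 * (m * m * c₂ + m * (c₁ - c₂)) = (c₁ - c₂) * (1 / m - 1 / n) := by
    field_simp
    ring
  rw [this, div_eq_mul_one_div c₁]
  refine mul_le_mul (by linarith) ?_ ?_ (hc₂.trans hc)
  · linarith [one_div_pos.2 hn']
  · exact sub_nonneg.2 (one_div_le_one_div_of_le hm' (Nat.cast_le.2 hmn))

/-- The second moment bound makes the averages Cauchy almost surely along a sparse sequence of
times; monotonicity of the counts fills the gaps, since the ratio of consecutive times tends to 1.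
-/
theorem ae_exists_tendsto_average {Z : ℕ → Set Ω} (hZ : ∀ i, MeasurableSet (Z i)) {c₁ c₂ : ℝ}
    (h₁ : ∀ i, μ.real (Z i) = c₁) (h₂ : ∀ i k, i < k → μ.real (Z i ∩ Z k) = c₂) :
    ∀ᵐ ω ∂μ, ∃ c, Tendsto (fun n : ℕ => countEvents Z n ω / n) atTop (𝓝 c) := by
  have hc₁ : 0 ≤ c₁ := by rw [← h₁ 0]; exact measureReal_nonneg
  -- The second moment of the `n`-th increment is at most `c₁ / (n + 1) ^ 4`. After multiplication
  -- by the weight `(n + 1) ^ 2` it is still summable, and the weight makes the increments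
  -- themselves summable.
  let a : ℕ → ℕ := fun n => (n + 1) ^ 4
  let d : ℕ → Ω → ℝ := fun n ω =>
    countEvents Z (a (n + 1)) ω / a (n + 1) - countEvents Z (a n) ω / a n
  have hd : ∀ n, Measurable (d n) := fun n =>
    ((measurable_countEvents hZ _).div_const _).sub ((measurable_countEvents hZ _).div_const _)
  have hsum : Summable (fun n : ℕ => 1 / ((n : ℝ) + 1) ^ 2) := by
    have := (summable_nat_add_iff 1).2 (Real.summable_one_div_nat_pow.2 (one_lt_two))
    simpa using this
  have hbound : ∀ n : ℕ, ∫⁻ ω, ENNReal.ofReal (((n : ℝ) + 1) ^ 2 * d n ω ^ 2) ∂μ ≤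
      ENNReal.ofReal (c₁ * (1 / ((n : ℝ) + 1) ^ 2)) := fun n => by
    have hmono : a n ≤ a (n + 1) := Nat.pow_le_pow_left (by omega) 4
    have h := lintegral_sq_average_sub (μ := μ) hZ h₁ h₂ (m := a n) (n := a (n + 1))
      (by positivity) hmono
    simp only [ENNReal.ofReal_mul (sq_nonneg ((n : ℝ) + 1))]
    rw [lintegral_const_mul _ ((hd n).pow_const 2).ennreal_ofReal]
    refine (mul_le_mul_right h _).trans_eq ?_
    rw [← ENNReal.ofReal_mul (sq_nonneg _)]
    congr 1
    simp only [a]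
    push_cast
    field_simp
  have hfin : ∫⁻ ω, ∑' n : ℕ, ENNReal.ofReal (((n : ℝ) + 1) ^ 2 * d n ω ^ 2) ∂μ ≠ ⊤ := by
    rw [lintegral_tsum fun n =>
      (((hd n).pow_const 2).const_mul _).ennreal_ofReal.aemeasurable]
    refine ne_top_of_le_ne_top ?_ (ENNReal.tsum_le_tsum hbound)
    rw [← ENNReal.ofReal_tsum_of_nonneg (fun n => by positivity) (hsum.mul_left c₁)]
    exact ENNReal.ofReal_ne_top
  filter_upwards [ae_lt_top' (AEMeasurable.tsum fun n =>
    (((hd n).pow_const 2).const_mul _).ennreal_ofReal.aemeasurable) hfin] with ω hω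
  have hs : Summable (fun n : ℕ => ((n : ℝ) + 1) ^ 2 * d n ω ^ 2) := by
    have := ENNReal.summable_toReal hω.ne
    refine this.congr fun n => ENNReal.toReal_ofReal (by positivity)
  have hcauchy : CauchySeq (fun n => countEvents Z (a n) ω / a n) := by
    refine cauchySeq_of_summable_dist
      (Summable.of_nonneg_of_le (fun _ => dist_nonneg) (fun n => ?_) (hs.add hsum))
    rw [dist_comm, Real.dist_eq]
    change |d n ω| ≤ _
    have hn : (0 : ℝ) < (n : ℝ) + 1 := by positivity
    -- The product of `(n + 1) * |d n ω|` and `1 / (n + 1)` is at most the sum of their squares.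
    have h1 : |d n ω| = (((n : ℝ) + 1) * |d n ω|) * (1 / ((n : ℝ) + 1)) := by field_simp
    have h2 : ((n : ℝ) + 1) ^ 2 * d n ω ^ 2 = (((n : ℝ) + 1) * |d n ω|) ^ 2 := by
      rw [mul_pow, sq_abs]
    have h3 : 1 / ((n : ℝ) + 1) ^ 2 = (1 / ((n : ℝ) + 1)) ^ 2 := by rw [div_pow, one_pow]
    rw [h1, h2, h3]
    nlinarith [sq_nonneg (((n : ℝ) + 1) * |d n ω| - 1 / ((n : ℝ) + 1)),
      sq_nonneg (((n : ℝ) + 1) * |d n ω|), sq_nonneg (1 / ((n : ℝ) + 1))]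
  obtain ⟨c, hc⟩ := cauchySeq_tendsto_of_complete hcauchy
  refine ⟨c, tendsto_div_of_monotone_of_exists_subseq_tendsto_div _ _ (countEvents_mono Z ω)
    fun b hb => ⟨a, ?_, ?_, hc⟩⟩
  · have hlim : Tendsto (fun n : ℕ => (1 + 1 / ((n : ℝ) + 1)) ^ 4) atTop (𝓝 ((1 + 0) ^ 4)) :=
      (tendsto_one_div_add_atTop_nhds_zero_nat.const_add 1).pow 4
    filter_upwards [hlim.eventually_le_const (by simpa using hb)] with n hn
    have : ((a (n + 1) : ℕ) : ℝ) = (1 + 1 / ((n : ℝ) + 1)) ^ 4 * a n := by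
      simp only [a]
      push_cast
      field_simp
    rw [this]
    exact mul_le_mul_of_nonneg_right hn (Nat.cast_nonneg _)
  · exact tendsto_atTop_mono (fun n => by
      simp only [a]
      calc n ≤ n + 1 := by omega
        _ ≤ (n + 1) ^ 4 := Nat.le_self_pow (by norm_num) _) tendsto_id

end LLN

/-! ### Conditional law of the allocations given the frequencies -/

/-- The event is not affected by exchanges of neighbours from the place `m` on that are not both
first elements of their clusters. -/
def SymmetricFrom (m : ℕ) (D : Set (Setoid ℕ)) : Prop :=
  ∀ i, m ≤ i → ∀ s, ¬ TwoLeaders i s → (swapAt i s ∈ D ↔ s ∈ D)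

section Symmetric

variable {m n : ℕ} {D E : Set (Setoid ℕ)}

theorem SymmetricFrom.inter (hD : SymmetricFrom m D) (hE : SymmetricFrom m E) :
    SymmetricFrom m (D ∩ E) := fun i hi s hs => and_congr (hD i hi s hs) (hE i hi s hs)

theorem SymmetricFrom.mono (hD : SymmetricFrom m D) (h : m ≤ n) : SymmetricFrom n D :=
  fun i hi => hD i (h.trans hi)

theorem symmetricFrom_of_restrict
    (hD : ∀ s t, restrict m s = restrict m t → s ∈ D → t ∈ D) : SymmetricFrom m D :=
  fun _ hi _ _ => ⟨hD _ _ (restrict_swapAt_of_le hi), hD _ _ (restrict_swapAt_of_le hi).symm⟩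

theorem symmetricFrom_freqs (B : Set SubProb) : SymmetricFrom 0 (freqs ⁻¹' B) :=
  fun _ _ s hs => by rw [Set.mem_preimage, freqs_swapAt hs, Set.mem_preimage]

theorem symmetricFrom_alloc (i j : ℕ) : SymmetricFrom (i + 1) {s | alloc s i = j} :=
  symmetricFrom_of_restrict fun _ _ h hs =>
    ((restrict_eq_iff_alloc.1 h) i (Nat.lt_succ_self i)).symm.trans hs

theorem symmetricFrom_numClusters (p : ℕ → Prop) (m : ℕ) :
    SymmetricFrom m {s | p (numClusters s m)} :=
  symmetricFrom_of_restrict fun s t h hs => by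
    have := numClusters_congr (restrict_eq_iff_alloc.1 h)
    simpa only [Set.mem_ofPred_eq, this] using hs

theorem measurableSet_alloc (i j : ℕ) : MeasurableSet {s | alloc s i = j} :=
  measurable_alloc i (measurableSet_singleton j)

/-- As cluster `j` has appeared before `i`, an element `i` or `i + 1` that joins it is not a first
element, so the exchange of the two is allowed and carries one event to the other. -/
theorem SwapInvariant.measure_alloc_succ {ν : Measure (Setoid ℕ)} (hν : SwapInvariant ν)
    {G : Set (Setoid ℕ)} (hG : MeasurableSet G) {i j : ℕ}
    (hinv : ∀ s, ¬ TwoLeaders i s → (swapAt i s ∈ G ↔ s ∈ G))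
    (hj : ∀ s ∈ G, j < numClusters s i) :
    ν (G ∩ {s | alloc s (i + 1) = j}) = ν (G ∩ {s | alloc s i = j}) := by
  have h1 : ∀ s ∈ G ∩ {s | alloc s i = j}, ¬ TwoLeaders i s := fun s hs h =>
    not_isLeader_of_alloc_lt (by rw [hs.2]; exact hj s hs.1) h.1
  rw [← hν i _ (hG.inter (measurableSet_alloc i j)) h1]
  congr 1
  ext s
  constructor
  · rintro ⟨hs, hsj⟩
    have h2 : ¬ TwoLeaders i s := fun h => not_isLeader_of_alloc_lt (by
      rw [show alloc s (i + 1) = j from hsj]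
      exact (hj s hs).trans_le (numClusters_mono s (Nat.le_succ i))) h.2
    refine ⟨(hinv s h2).2 hs, ?_⟩
    rw [Set.mem_ofPred_eq, alloc_swapAt h2, Equiv.swap_apply_left]
    exact hsj
  · intro hs
    have h2 : ¬ TwoLeaders i s := fun h => h1 _ hs h.swapAt
    obtain ⟨hs, hsj⟩ := hs
    rw [Set.mem_ofPred_eq, alloc_swapAt h2, Equiv.swap_apply_left] at hsj
    exact ⟨(hinv s h2).1 hs, hsj⟩

theorem SwapInvariant.measure_alloc_eq {ν : Measure (Setoid ℕ)} (hν : SwapInvariant ν)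
    (hD : MeasurableSet D) (hsym : SymmetricFrom m D) {j : ℕ} (hj : ∀ s ∈ D, j < numClusters s m)
    (i : ℕ) : ν (D ∩ {s | alloc s (m + i) = j}) = ν (D ∩ {s | alloc s m = j}) := by
  induction i with
  | zero => rfl
  | succ i ih =>
    rw [← ih, ← add_assoc]
    exact hν.measure_alloc_succ hD (hsym _ (by omega))
      fun s hs => (hj s hs).trans_le (numClusters_mono s (by omega))

/-- The later index moves by the single-event lemma, with the earlier allocation included in the
conditioning event; then the pair of adjacent indices is moved as a whole. -/
theorem SwapInvariant.measure_alloc_pair_eq {ν : Measure (Setoid ℕ)} (hν : SwapInvariant ν)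
    (hD : MeasurableSet D) (hsym : SymmetricFrom m D) {j : ℕ} (hj : ∀ s ∈ D, j < numClusters s m)
    {i k : ℕ} (hik : i < k) :
    ν (D ∩ ({s | alloc s (m + i) = j} ∩ {s | alloc s (m + k) = j})) =
      ν (D ∩ ({s | alloc s m = j} ∩ {s | alloc s (m + 1) = j})) := by
  have h1 : ∀ i d, ν (D ∩ ({s | alloc s (m + i) = j} ∩ {s | alloc s (m + (i + 1 + d)) = j})) =
      ν (D ∩ ({s | alloc s (m + i) = j} ∩ {s | alloc s (m + (i + 1)) = j})) := fun i d => by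
    rw [← Set.inter_assoc, ← Set.inter_assoc]
    have := hν.measure_alloc_eq (D := D ∩ {s | alloc s (m + i) = j}) (m := m + (i + 1)) (j := j)
      (hD.inter (measurableSet_alloc _ _))
      ((hsym.mono (by omega)).inter ((symmetricFrom_alloc (m + i) j).mono (by omega)))
      (fun s hs => (hj s hs.1).trans_le (numClusters_mono s (by omega))) d
    rw [← this, add_assoc m]
  have h2 : ∀ i, ν (D ∩ ({s | alloc s (m + i) = j} ∩ {s | alloc s (m + (i + 1)) = j})) =
      ν (D ∩ ({s | alloc s m = j} ∩ {s | alloc s (m + 1) = j})) := by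
    intro i
    induction i with
    | zero => rfl
    | succ i ih =>
      -- The later index is first put at `m + (i + 2)`, which leaves room to exchange `m + i` and `m
      -- + (i + 1)`.
      rw [← ih, ← h1 i 1]
      have hinv : ∀ s, ¬ TwoLeaders (m + i) s →
          (swapAt (m + i) s ∈ D ∩ {s | alloc s (m + (i + 1 + 1)) = j} ↔
            s ∈ D ∩ {s | alloc s (m + (i + 1 + 1)) = j}) := fun s hs => by
        refine and_congr (hsym _ (by omega) s hs) ?_
        rw [Set.mem_ofPred_eq, alloc_swapAt hs, swap_of_gt (by omega), Set.mem_ofPred_eq]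
      have := hν.measure_alloc_succ (i := m + i) (j := j)
        (hD.inter (measurableSet_alloc (m + (i + 1 + 1)) j)) hinv
        (fun s hs => (hj s hs.1).trans_le (numClusters_mono s (by omega)))
      rw [Set.inter_right_comm, Set.inter_right_comm _ _ {s | alloc s (m + i) = j}] at this
      rw [← Set.inter_assoc, ← Set.inter_assoc]
      exact this
  obtain ⟨d, rfl⟩ := Nat.exists_eq_add_of_lt hik
  rw [← h2 i, ← h1 i d]
  congr 5
  ext s
  rw [show i + d + 1 = i + 1 + d by omega]

end Symmetric

/-! ### Relative frequencies as averages of allocation events -/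

theorem relFreq_eq_countEvents (s : Setoid ℕ) (j m : ℕ) :
    relFreq s j m = countEvents (fun i => {s | alloc s i = j}) m s / m := by
  classical
  rw [relFreq, countEvents, Finset.card_filter]
  push_cast
  congr 1
  exact Finset.sum_congr rfl fun i _ => by simp [Set.indicator_apply]

theorem relFreq_add_eq_countEvents (s : Setoid ℕ) (j m n : ℕ) :
    relFreq s j (m + n) = (countEvents (fun i => {s | alloc s i = j}) m s +
      countEvents (fun i => {s | alloc s (m + i) = j}) n s) / (m + n) := by
  rw [relFreq_eq_countEvents]
  push_cast
  congr 1
  exact Finset.sum_range_add _ _ _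

theorem tendsto_relFreq_iff (s : Setoid ℕ) (j m : ℕ) (c : ℝ) :
    Tendsto (relFreq s j) atTop (𝓝 c) ↔
      Tendsto (fun n : ℕ => countEvents (fun i => {s | alloc s (m + i) = j}) n s / n) atTop
        (𝓝 c) := by
  set A := countEvents (fun i => {s | alloc s i = j}) m s
  have hA : ∀ a : ℝ, Tendsto (fun n : ℕ => a / n) atTop (𝓝 0) :=
    fun a => tendsto_const_div_atTop_nhds_zero_nat a
  rw [← tendsto_add_atTop_iff_nat m]
  constructor
  · intro h
    have h2 : Tendsto (fun n : ℕ => relFreq s j (n + m) * (m / n + 1) - A / n) atTop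
        (𝓝 (c * (0 + 1) - 0)) := (h.mul ((hA m).add_const 1)).sub (hA A)
    rw [zero_add, mul_one, sub_zero] at h2
    refine h2.congr' ?_
    filter_upwards [eventually_gt_atTop 0] with n hn
    have hn' : (0 : ℝ) < n := Nat.cast_pos.2 hn
    rw [add_comm n m, relFreq_add_eq_countEvents]
    field_simp
    ring
  · intro h
    have h2 : Tendsto (fun n : ℕ => (A / n +
        countEvents (fun i => {s | alloc s (m + i) = j}) n s / n) / (m / n + 1)) atTop
        (𝓝 ((0 + c) / (0 + 1))) :=
      ((hA A).add h).div ((hA m).add_const 1) (by norm_num)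
    rw [zero_add, zero_add, div_one] at h2
    refine h2.congr' ?_
    filter_upwards [eventually_gt_atTop 0] with n hn
    have hn' : (0 : ℝ) < n := Nat.cast_pos.2 hn
    rw [add_comm n m, relFreq_add_eq_countEvents]
    field_simp
    rfl

/-- The relative frequencies converge to `freqs s`. -/
def HasFreqs (s : Setoid ℕ) : Prop := ∀ j, Tendsto (relFreq s j) atTop (𝓝 ((freqs s).1 j))

theorem relFreq_nonneg (s : Setoid ℕ) (j m : ℕ) : 0 ≤ relFreq s j m := by
  rw [relFreq]; positivity

theorem sum_relFreq_le_one (s : Setoid ℕ) (n m : ℕ) :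
    ∑ j ∈ Finset.range n, relFreq s j m ≤ 1 := by
  simp only [relFreq]
  rw [← Finset.sum_div, ← Nat.cast_sum]
  refine div_le_one_of_le₀ (Nat.cast_le.2 ?_) (Nat.cast_nonneg _)
  rw [← Finset.card_biUnion]
  · refine (Finset.card_le_card (t := Finset.range m) ?_).trans_eq (Finset.card_range m)
    exact Finset.biUnion_subset.2 fun j _ => Finset.filter_subset _ _
  · intro a _ b _ hab
    refine Finset.disjoint_left.2 fun i hi hi' => hab ?_
    rw [← (Finset.mem_filter.1 hi).2, ← (Finset.mem_filter.1 hi').2]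

theorem isSubProb_of_tendsto {s : Setoid ℕ} {p : ℕ → ℝ}
    (h : ∀ j, Tendsto (relFreq s j) atTop (𝓝 (p j))) : IsSubProb p := by
  have h0 : ∀ j, 0 ≤ p j := fun j => ge_of_tendsto' (h j) fun m => relFreq_nonneg s j m
  have h1 : ∀ n, ∑ j ∈ Finset.range n, p j ≤ 1 := fun n =>
    le_of_tendsto' (tendsto_finsetSum _ fun j _ => h j) fun m => sum_relFreq_le_one s n m
  have hs := summable_of_sum_range_le h0 h1
  exact ⟨h0, hs, hs.tsum_le_of_sum_range_le h1⟩

theorem freqs_eq_of_tendsto {s : Setoid ℕ} {p : SubProb}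
    (h : ∀ j, Tendsto (relFreq s j) atTop (𝓝 (p.1 j))) : freqs s = p := by
  have : freq s = p.1 := funext fun j => (h j).limUnder_eq
  have hp : IsSubProb (freq s) := this ▸ p.2
  rw [freqs, dif_pos hp]
  exact Subtype.ext this

theorem hasFreqs_of_exists_tendsto {s : Setoid ℕ}
    (h : ∀ j, ∃ c, Tendsto (relFreq s j) atTop (𝓝 c)) : HasFreqs s := by
  choose p hp using h
  have := freqs_eq_of_tendsto (p := ⟨p, isSubProb_of_tendsto hp⟩) hp
  intro j
  rw [this]
  exact hp j

section Frequencies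

variable {ν : Measure (Setoid ℕ)} [IsFiniteMeasure ν]

/-- The law of large numbers is applied on each event that cluster `j` has appeared among the first
`m` elements. A cluster that never appears has frequency 0. -/
theorem SwapInvariant.ae_hasFreqs (hν : SwapInvariant ν) : ∀ᵐ s ∂ν, HasFreqs s := by
  have h : ∀ j m, ∀ᵐ s ∂ν, j < numClusters s m → ∃ c, Tendsto (relFreq s j) atTop (𝓝 c) := by
    intro j m
    have hD : MeasurableSet {s | j < numClusters s m} :=
      measurable_numClusters m (measurableSet_Ioi (a := j))
    have hsym : SymmetricFrom m {s | j < numClusters s m} :=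
      symmetricFrom_numClusters (fun k => j < k) m
    refine (ae_restrict_iff' hD).1 ?_
    have key := ae_exists_tendsto_average (μ := ν.restrict {s | j < numClusters s m})
      (Z := fun i => {s | alloc s (m + i) = j}) (fun i => measurableSet_alloc _ _)
      (c₁ := (ν ({s | j < numClusters s m} ∩ {s | alloc s m = j})).toReal)
      (c₂ := (ν ({s | j < numClusters s m} ∩
        ({s | alloc s m = j} ∩ {s | alloc s (m + 1) = j}))).toReal) (fun i => ?_)
      (fun i k hik => ?_)
    · filter_upwards [key] with s ⟨c, hc⟩
      exact ⟨c, (tendsto_relFreq_iff s j m c).2 hc⟩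
    · rw [Measure.real, Measure.restrict_apply (measurableSet_alloc _ _), Set.inter_comm,
        hν.measure_alloc_eq hD hsym fun s hs => hs]
    · rw [Measure.real, Measure.restrict_apply
        ((measurableSet_alloc _ _).inter (measurableSet_alloc _ _)), Set.inter_comm,
        hν.measure_alloc_pair_eq hD hsym (fun s hs => hs) hik]
  filter_upwards [ae_all_iff.2 fun j => ae_all_iff.2 (h j)] with s hs
  refine hasFreqs_of_exists_tendsto fun j => ?_
  by_cases hj : ∃ m, j < numClusters s m
  · exact hj.elim fun m hm => hs j m hm
  · refine ⟨0, ?_⟩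
    have : relFreq s j = fun _ => 0 := funext fun m => by
      rw [relFreq, Finset.card_eq_zero.2, Nat.cast_zero, zero_div]
      refine Finset.filter_eq_empty_iff.2 fun i _ hi => hj ⟨i + 1, ?_⟩
      exact exists_alloc_eq_iff.1 ⟨i, Nat.lt_succ_self i, hi⟩
    rw [this]
    exact tendsto_const_nhds

theorem measurable_ofReal_freqs (l : ℕ) :
    Measurable (fun s => ENNReal.ofReal ((freqs s).1 l)) :=
  ((measurable_coord l).comp measurable_freqs).ennreal_ofReal

theorem coord_le_one (p : SubProb) (j : ℕ) : p.1 j ≤ 1 :=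
  (p.2.2.1.le_tsum j fun i _ => p.2.1 i).trans p.2.2.2

theorem sum_coord_le_one (p : SubProb) (k : ℕ) : ∑ l ∈ Finset.range k, p.1 l ≤ 1 :=
  (p.2.2.1.sum_le_tsum _ fun i _ => p.2.1 i).trans p.2.2.2

/-- On `D` all later elements join cluster `j` with the same probability, so the mean of their
average over `D` does not depend on their number; by dominated convergence it equals the mean of the
limit. As `D` may include conditions on the frequencies, this is a conditional probability given
them. -/
theorem SwapInvariant.measure_inter_alloc_of_lt (hν : SwapInvariant ν) {m j : ℕ}
    {D : Set (Setoid ℕ)} (hD : MeasurableSet D) (hsym : SymmetricFrom m D)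
    (hj : ∀ s ∈ D, j < numClusters s m) :
    ν (D ∩ {s | alloc s m = j}) = ∫⁻ s in D, ENNReal.ofReal ((freqs s).1 j) ∂ν := by
  set Z : ℕ → Set (Setoid ℕ) := fun i => {s | alloc s (m + i) = j}
  have hZ : ∀ i, MeasurableSet (Z i) := fun i => measurableSet_alloc _ _
  have hbd : ∀ n (s : Setoid ℕ), ‖countEvents Z n s / n‖ ≤ 1 := fun n s => by
    rw [Real.norm_of_nonneg (div_nonneg (countEvents_nonneg _ _ _) (Nat.cast_nonneg _))]
    exact div_le_one_of_le₀ (countEvents_le _ _ _) (Nat.cast_nonneg _)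
  have hconst : ∀ n : ℕ, 0 < n → ∫ s in D, countEvents Z n s / n ∂ν =
      (ν (D ∩ {s | alloc s m = j})).toReal := fun n hn => by
    have hn' : (n : ℝ) ≠ 0 := Nat.cast_ne_zero.2 hn.ne'
    rw [integral_div]
    simp only [countEvents]
    rw [integral_finsetSum (f := fun i => (Z i).indicator 1) _ fun i _ =>
      (integrable_const (1 : ℝ)).indicator (hZ i)]
    simp only [integral_indicator_one (hZ _), Measure.real, Measure.restrict_apply (hZ _)]
    have : ∀ i, ν (Z i ∩ D) = ν (D ∩ {s | alloc s m = j}) := fun i => by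
      rw [Set.inter_comm, hν.measure_alloc_eq hD hsym hj]
    simp only [this, Finset.sum_const, Finset.card_range, nsmul_eq_mul]
    field_simp
  have hlim : Tendsto (fun n : ℕ => ∫ s in D, countEvents Z n s / n ∂ν) atTop
      (𝓝 (∫ s in D, (freqs s).1 j ∂ν)) := by
    refine tendsto_integral_of_dominated_convergence (fun _ => 1) (fun n =>
      ((measurable_countEvents hZ n).div_const _).aestronglyMeasurable)
      (integrable_const 1) (fun n => ae_of_all _ (hbd n)) ?_
    filter_upwards [ae_restrict_of_ae hν.ae_hasFreqs] with s hs
    exact (tendsto_relFreq_iff s j m _).1 (hs j)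
  have heq := tendsto_nhds_unique (tendsto_const_nhds.congr'
    (eventually_atTop.2 ⟨1, fun n hn => (hconst n hn).symm⟩)) hlim
  rw [← ofReal_integral_eq_lintegral_ofReal, ← heq, ENNReal.ofReal_toReal (measure_ne_top _ _)]
  · refine Integrable.of_bound ((measurable_coord j).comp measurable_freqs).aestronglyMeasurable 1
      (ae_of_all _ fun s => ?_)
    change ‖(freqs s).1 j‖ ≤ 1
    rw [Real.norm_of_nonneg ((freqs s).2.1 j)]
    exact coord_le_one _ _
  · exact ae_of_all _ fun s => (freqs s).2.1 j

/-- The conditional probability, given the frequencies, that an element is allocated to the cluster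
number `j` if there are `k` clusters before it. -/
noncomputable def allocWeight (k j : ℕ) (p : SubProb) : ℝ :=
  if j < k then p.1 j else if j = k then 1 - ∑ l ∈ Finset.range k, p.1 l else 0

theorem measurable_allocWeight (k j : ℕ) : Measurable (allocWeight k j) := by
  unfold allocWeight
  split_ifs
  · exact measurable_coord j
  · exact measurable_const.sub (Finset.measurable_sum _ fun l _ => measurable_coord l)
  · exact measurable_const

theorem measurable_allocWeight_freqs (k j : ℕ) :
    Measurable (fun s => ENNReal.ofReal (allocWeight k j (freqs s))) :=
  ((measurable_allocWeight k j).comp measurable_freqs).ennreal_ofReal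

theorem SwapInvariant.measure_inter_alloc (hν : SwapInvariant ν) {m k : ℕ}
    {D : Set (Setoid ℕ)} (hD : MeasurableSet D) (hsym : SymmetricFrom m D)
    (hk : ∀ s ∈ D, numClusters s m = k) (j : ℕ) :
    ν (D ∩ {s | alloc s m = j}) = ∫⁻ s in D, ENNReal.ofReal (allocWeight k j (freqs s)) ∂ν := by
  have hlt : ∀ j < k, ν (D ∩ {s | alloc s m = j}) =
      ∫⁻ s in D, ENNReal.ofReal ((freqs s).1 j) ∂ν := fun j hj =>
    hν.measure_inter_alloc_of_lt hD hsym fun s hs => by rwa [hk s hs]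
  rcases lt_trichotomy j k with hj | rfl | hj
  · simp only [allocWeight, if_pos hj]
    exact hlt j hj
  · simp only [allocWeight, lt_irrefl, if_false, if_true]
    -- A new cluster is the complementary case: both decompositions of `ν D` contain the same finite
    -- sum over the existing clusters, which cancels.
    have h1 : ν D = ∑ l ∈ Finset.range j, ν (D ∩ {s | alloc s m = l}) +
        ν (D ∩ {s | alloc s m = j}) := by
      rw [← Finset.sum_range_succ, ← measure_biUnion_finset]
      · congr 1
        ext s
        simp only [Set.mem_iUnion, Finset.mem_range, Set.mem_inter_iff, Set.mem_ofPred_eq,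
          exists_prop]
        constructor
        · intro hs
          exact ⟨_, Nat.lt_succ_of_le ((alloc_le_numClusters s m).trans_eq (hk s hs)), hs, rfl⟩
        · rintro ⟨_, -, hs, -⟩
          exact hs
      · intro a _ b _ hab
        exact Set.disjoint_left.2 fun s hs hs' => hab (hs.2.symm.trans hs'.2)
      · exact fun l _ => hD.inter (measurableSet_alloc m l)
    have h2 : ν D = ∑ l ∈ Finset.range j, ν (D ∩ {s | alloc s m = l}) +
        ∫⁻ s in D, ENNReal.ofReal (1 - ∑ l ∈ Finset.range j, (freqs s).1 l) ∂ν := by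
      rw [Finset.sum_congr rfl fun l hl => hlt l (Finset.mem_range.1 hl),
        ← lintegral_finsetSum _ fun l _ => measurable_ofReal_freqs l,
        ← lintegral_add_left (Finset.measurable_sum _ fun l _ => measurable_ofReal_freqs l)]
      rw [← setLIntegral_one]
      refine lintegral_congr fun s => ?_
      rw [← ENNReal.ofReal_sum_of_nonneg fun l _ => (freqs s).2.1 l,
        ← ENNReal.ofReal_add (Finset.sum_nonneg fun l _ => (freqs s).2.1 l)
          (sub_nonneg.2 (sum_coord_le_one _ _))]
      simp
    rw [h1] at h2
    refine (ENNReal.add_right_inj ?_).1 h2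
    exact ENNReal.sum_ne_top.2 fun l _ => measure_ne_top _ _
  · simp only [allocWeight, if_neg hj.not_gt, if_neg hj.ne', ENNReal.ofReal_zero, lintegral_zero]
    have : D ∩ {s | alloc s m = j} = ∅ := Set.eq_empty_of_forall_notMem fun s hs => by
      have h1 := alloc_le_numClusters s m
      rw [hk s hs.1, show alloc s m = j from hs.2] at h1
      omega
    rw [this, measure_empty]

/-- Intersecting `D` with arbitrary events of the frequencies turns the prediction rule into an
equality of measures on `SubProb`, against which any `h` can be integrated. -/
theorem SwapInvariant.setLIntegral_alloc (hν : SwapInvariant ν) {m k : ℕ}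
    {D : Set (Setoid ℕ)} (hD : MeasurableSet D) (hsym : SymmetricFrom m D)
    (hk : ∀ s ∈ D, numClusters s m = k) (j : ℕ) {h : SubProb → ENNReal} (hh : Measurable h) :
    ∫⁻ s in D ∩ {s | alloc s m = j}, h (freqs s) ∂ν =
      ∫⁻ s in D, ENNReal.ofReal (allocWeight k j (freqs s)) * h (freqs s) ∂ν := by
  have hw := measurable_allocWeight_freqs k j
  have key : (ν.restrict (D ∩ {s | alloc s m = j})).map freqs =
      ((ν.restrict D).withDensity
        fun s => ENNReal.ofReal (allocWeight k j (freqs s))).map freqs := by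
    ext B hB
    have hB' := measurable_freqs hB
    rw [Measure.map_apply measurable_freqs hB, Measure.map_apply measurable_freqs hB,
      Measure.restrict_apply hB', withDensity_apply _ hB', Measure.restrict_restrict hB',
      ← Set.inter_assoc]
    exact hν.measure_inter_alloc (hB'.inter hD)
      (((symmetricFrom_freqs B).mono (Nat.zero_le m)).inter hsym) (fun s hs => hk s hs.2) j
  have h1 := congrArg (fun ρ => ∫⁻ p, h p ∂ρ) key
  rw [lintegral_map hh measurable_freqs, lintegral_map hh measurable_freqs] at h1
  exact h1.trans (lintegral_withDensity_eq_lintegral_mul _ hw (hh.comp measurable_freqs))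

end Frequencies

/-! ### Removing the first element -/

section RemoveFirst

variable {s : Setoid ℕ}

/-- The cluster of the first element has another element. -/
def FirstReturns (s : Setoid ℕ) : Prop := ∃ i, alloc s (i + 1) = 0

open Classical in
/-- The place, from `1`, to which the cluster of the first element moves when the first element is
removed (and `0` if this cluster is a singleton). -/
noncomputable def position (s : Setoid ℕ) : ℕ :=
  if h : FirstReturns s then numClusters s (Nat.find h + 1) else 0

theorem position_of_not (h : ¬ FirstReturns s) : position s = 0 := dif_neg h

theorem numClusters_pos (s : Setoid ℕ) (m : ℕ) : 0 < numClusters s (m + 1) :=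
  exists_alloc_eq_iff.1 ⟨0, Nat.succ_pos m, alloc_zero s⟩

theorem position_pos_iff : 0 < position s ↔ FirstReturns s := by
  by_cases h : FirstReturns s
  · rw [position, dif_pos h]
    exact ⟨fun _ => h, fun _ => numClusters_pos s _⟩
  · simp [position_of_not h, h]

theorem position_eq {m : ℕ} (hm : alloc s (m + 1) = 0)
    (hlt : ∀ i < m, alloc s (i + 1) ≠ 0) : position s = numClusters s (m + 1) := by
  classical
  have h : FirstReturns s := ⟨m, hm⟩
  rw [position, dif_pos h, (Nat.find_eq_iff h).2 ⟨hm, hlt⟩]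

theorem FirstReturns.exists_first (h : FirstReturns s) :
    ∃ m, alloc s (m + 1) = 0 ∧ ∀ i < m, alloc s (i + 1) ≠ 0 := by
  classical
  exact ⟨Nat.find h, Nat.find_spec h, fun i hi => Nat.find_min h hi⟩

theorem shift_one_rel (i k : ℕ) : (shift 1 s).r i k ↔ s.r (i + 1) (k + 1) := by
  rw [add_comm i, add_comm k]
  rfl

theorem alloc_succ_of_not_firstReturns (h : ¬ FirstReturns s) (i : ℕ) :
    alloc s (i + 1) = alloc (shift 1 s) i + 1 := by
  have h' : ∀ i, alloc s (i + 1) ≠ 0 := fun i hi => h ⟨i, hi⟩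
  have key : alloc (shift 1 s) = fun i => alloc s (i + 1) - 1 := by
    refine alloc_eq_of_restrictedGrowth (fun i l hl => ?_) fun i k => ?_
    · obtain ⟨k, hk, hkl⟩ := exists_alloc_eq_of_lt (s := s) (i := i + 1) (l := l + 1)
        (by omega)
      rcases k with _ | k
      · simp at hkl
      · exact ⟨k, by omega, by omega⟩
    · rw [shift_one_rel, ← alloc_eq_iff]
      have h1 := h' i
      have h2 := h' k
      omega
  rw [key]
  have := h' i
  dsimp only
  omega

/-- The places after the first entry is moved to the place `x`. -/
def moveIndex (x k : ℕ) : ℕ := if k + 1 < x then k + 1 else if k + 1 = x then 0 else k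

theorem moveIndex_injective (x : ℕ) : Function.Injective (moveIndex x) := fun a b h => by
  simp only [moveIndex] at h
  split_ifs at h <;> omega

/-- Without the first element, its cluster appears only at its second element. The `position s - 1`
other clusters seen by then come before it, and all later clusters keep their numbers. -/
theorem alloc_succ_of_firstReturns (h : FirstReturns s) (i : ℕ) :
    alloc s (i + 1) = moveIndex (position s) (alloc (shift 1 s) i) := by
  obtain ⟨m, hm, hlt⟩ := h.exists_first
  have hpos : 0 < position s := position_pos_iff.2 h
  have hx := position_eq hm hlt
  set x := position s with hxdef
  -- The guess for the allocation sequence of the shifted partition: `moveIndex x` is inverted on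
  -- the labels of `s`.
  let a : ℕ → ℕ := fun i =>
    if alloc s (i + 1) = 0 then x - 1 else if alloc s (i + 1) < x then alloc s (i + 1) - 1
      else alloc s (i + 1)
  have ha : ∀ i, moveIndex x (a i) = alloc s (i + 1) := fun i => by
    simp only [moveIndex, a]
    split_ifs <;> omega
  have hsmall : ∀ l, l + 1 < x → ∃ k < m, alloc s (k + 1) = l + 1 := fun l hl => by
    rw [hx, ← exists_alloc_eq_iff] at hl
    obtain ⟨k, hk, hkl⟩ := hl
    rcases k with _ | k
    · simp at hkl
    · exact ⟨k, by omega, hkl⟩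
  have key : alloc (shift 1 s) = a := by
    refine alloc_eq_of_restrictedGrowth (fun i l hl => ?_) fun i k => ?_
    · suffices ∃ k < i, alloc s (k + 1) = moveIndex x l by
        obtain ⟨k, hk, hkl⟩ := this
        exact ⟨k, hk, moveIndex_injective x ((ha k).trans hkl)⟩
      have hai := ha i
      have hbelow : ∀ v, 0 < v → v < alloc s (i + 1) → ∃ k < i, alloc s (k + 1) = v :=
        fun v hv hvi => by
          obtain ⟨k, hk, hkv⟩ := exists_alloc_eq_of_lt hvi
          rcases k with _ | k
          · rw [alloc_zero] at hkv; omega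
          · exact ⟨k, by omega, hkv⟩
      have hfirst : alloc s (i + 1) = 0 → m ≤ i := fun h0 =>
        not_lt.1 fun hi => hlt i hi h0
      -- Exactly `x` clusters have appeared when the first one returns, so larger labels occur only
      -- afterwards.
      have hlate : x ≤ alloc s (i + 1) → m < i := fun hxi => by
        by_contra hmi
        have h1 : alloc s (i + 1) ≤ numClusters s (i + 1) := alloc_le_numClusters s (i + 1)
        rcases (not_lt.1 hmi).eq_or_lt with rfl | hlt'
        · omega
        · have h2 : alloc s (i + 1) < numClusters s (m + 1) :=
            exists_alloc_eq_iff.1 ⟨i + 1, by omega, rfl⟩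
          omega
      rcases lt_trichotomy (l + 1) x with hl1 | hl1 | hl1
      · have hmv : moveIndex x l = l + 1 := by simp [moveIndex, hl1]
        rw [hmv]
        by_cases h0 : alloc s (i + 1) = 0
        · obtain ⟨k, hk, hkl⟩ := hsmall l hl1
          exact ⟨k, hk.trans_le (hfirst h0), hkl⟩
        · refine hbelow _ (Nat.succ_pos l) ?_
          simp only [a] at hl
          split_ifs at hl <;> omega
      · have hmv : moveIndex x l = 0 := by simp [moveIndex, hl1]
        rw [hmv]
        refine ⟨m, hlate ?_, hm⟩
        simp only [a] at hl
        split_ifs at hl <;> omega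
      · have hmv : moveIndex x l = l := by
          simp only [moveIndex]
          split_ifs <;> omega
        rw [hmv]
        refine hbelow l (by omega) ?_
        simp only [a] at hl
        split_ifs at hl <;> omega
    · rw [shift_one_rel, ← alloc_eq_iff, ← ha i, ← ha k, (moveIndex_injective x).eq_iff]
  rw [key, ha]

theorem tendsto_relFreq_shift_one (hs : HasFreqs s) {φ : ℕ → ℕ} (hφ : Function.Injective φ)
    (h : ∀ i, alloc s (i + 1) = φ (alloc (shift 1 s) i)) (k : ℕ) :
    Tendsto (relFreq (shift 1 s) k) atTop (𝓝 ((freqs s).1 (φ k))) := by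
  have h1 := (tendsto_relFreq_iff s (φ k) 1 _).1 (hs (φ k))
  refine h1.congr fun n => ?_
  rw [relFreq_eq_countEvents, countEvents, countEvents]
  congr 1
  refine Finset.sum_congr rfl fun i _ => ?_
  classical
  simp only [Set.indicator_apply, Set.mem_ofPred_eq, add_comm 1 i, h i, hφ.eq_iff]
  rfl

theorem HasFreqs.shift_one_of_not (hs : HasFreqs s) (h : ¬ FirstReturns s) :
    freqs (shift 1 s) = dropTop (freqs s) ∧ HasFreqs (shift 1 s) := by
  have key := tendsto_relFreq_shift_one (φ := fun k => k + 1) hs (add_left_injective 1)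
    (alloc_succ_of_not_firstReturns h)
  have heq : freqs (shift 1 s) = dropTop (freqs s) := freqs_eq_of_tendsto key
  exact ⟨heq, fun k => by rw [heq]; exact key k⟩

theorem HasFreqs.shift_one_of_firstReturns (hs : HasFreqs s) (h : FirstReturns s) :
    freqs (shift 1 s) = moveTopTo (position s) (freqs s) ∧ HasFreqs (shift 1 s) := by
  have key := tendsto_relFreq_shift_one hs (moveIndex_injective (position s))
    (alloc_succ_of_firstReturns h)
  have heq : freqs (shift 1 s) = moveTopTo (position s) (freqs s) := freqs_eq_of_tendsto key
  exact ⟨heq, fun k => by rw [heq]; exact key k⟩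

theorem HasFreqs.shift (hs : HasFreqs s) (n : ℕ) : HasFreqs (shift n s) := by
  induction n with
  | zero =>
    rwa [shift_zero]
  | succ n ih =>
    rw [← shift_shift 1 n]
    by_cases h : FirstReturns (PEP.shift n s)
    · exact (ih.shift_one_of_firstReturns h).2
    · exact (ih.shift_one_of_not h).2

theorem HasFreqs.freqs_zero_of_not (hs : HasFreqs s) (h : ¬ FirstReturns s) :
    (freqs s).1 0 = 0 := by
  refine tendsto_nhds_unique ((tendsto_relFreq_iff s 0 1 _).1 (hs 0)) ?_
  refine tendsto_const_nhds.congr fun n => ?_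
  rw [countEvents, Finset.sum_eq_zero, zero_div]
  intro i _
  exact Set.indicator_of_notMem (fun hi => h ⟨i, by rw [add_comm]; exact hi⟩) _

theorem measurableSet_firstReturns : MeasurableSet {s | FirstReturns s} := by
  simp only [FirstReturns, Set.ofPred_exists]
  exact MeasurableSet.iUnion fun i => measurableSet_alloc (i + 1) 0

/-- There are `k` clusters that meet the first `m ≥ 1` elements, and the first one is met once. -/
def waiting (k m : ℕ) : Set (Setoid ℕ) :=
  {s | (∀ i < m, alloc s (i + 1) ≠ 0) ∧ numClusters s (m + 1) = k}

theorem waiting_congr (k m : ℕ) (s t : Setoid ℕ) (h : restrict (m + 1) s = restrict (m + 1) t)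
    (hs : s ∈ waiting k m) : t ∈ waiting k m := by
  rw [restrict_eq_iff_alloc] at h
  refine ⟨fun i hi => ?_, ?_⟩
  · rw [← h (i + 1) (by omega)]
    exact hs.1 i hi
  · rw [← numClusters_congr h]
    exact hs.2

theorem symmetricFrom_waiting (k m : ℕ) : SymmetricFrom (m + 1) (waiting k m) :=
  symmetricFrom_of_restrict (waiting_congr k m)

theorem measurableSet_waiting (k m : ℕ) : MeasurableSet (waiting k m) :=
  measurableSet_of_restrict (m + 1) (waiting_congr k m)

/-- Here `m` is the time at which the first cluster returns, counted from 0 after the first element.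
-/
theorem setOf_position_eq (k : ℕ) : {s | position s = k + 1} =
    ⋃ m, waiting (k + 1) m ∩ {s | alloc s (m + 1) = 0} := by
  ext s
  simp only [Set.mem_iUnion]
  constructor
  · intro hs
    have hs : position s = k + 1 := hs
    obtain ⟨m, hm, hlt⟩ := (position_pos_iff.1 (by omega : 0 < position s)).exists_first
    exact ⟨m, ⟨hlt, (position_eq hm hlt).symm.trans hs⟩, hm⟩
  · rintro ⟨m, ⟨hlt, hk⟩, hm⟩
    exact (position_eq hm hlt).trans hk

/-- The position exceeds `k + 1` when cluster number `k + 1` is opened before the return. The return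
has to be required separately, since `position` is 0 without it. -/
theorem setOf_lt_position (k : ℕ) : {s | k + 1 < position s} =
    {s | FirstReturns s} ∩ ⋃ m, waiting (k + 1) m ∩ {s | alloc s (m + 1) = k + 1} := by
  ext s
  simp only [Set.mem_iUnion, Set.mem_inter_iff]
  constructor
  · intro hs
    have hs : k + 1 < position s := hs
    have hr := position_pos_iff.1 (by omega : 0 < position s)
    obtain ⟨m, hm, hlt⟩ := hr.exists_first
    rw [position_eq hm hlt, ← exists_alloc_eq_iff] at hs
    obtain ⟨l, hl, hlk⟩ := hs
    -- The least element of cluster `k + 1` is the place where the cluster is opened; this gives the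
    -- waiting time.
    have hll := leader_le_self s l
    have hla : alloc s (leader s l) = k + 1 := by rw [← hlk, alloc_eq_iff]; exact leader_rel s l
    obtain ⟨n, hn⟩ : ∃ n, leader s l = n + 1 := by
      refine Nat.exists_eq_succ_of_ne_zero fun h0 => ?_
      rw [h0, alloc_zero] at hla
      omega
    have hnum := (isLeader_leader s l).alloc_eq
    rw [hn] at hla hnum
    exact ⟨hr, n, ⟨fun i hi => hlt i (by omega), by omega⟩, hla⟩
  · rintro ⟨hr, n, ⟨hlt', hk⟩, hn⟩
    obtain ⟨m, hm, hlt⟩ := hr.exists_first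
    have hn : alloc s (n + 1) = k + 1 := hn
    have hnm : n < m := by
      rcases lt_trichotomy n m with h | rfl | h
      · exact h
      · omega
      · exact absurd hm (hlt' m h)
    change k + 1 < position s
    rw [position_eq hm hlt, ← exists_alloc_eq_iff]
    exact ⟨n + 1, by omega, hn⟩

theorem disjoint_position_eq (k : ℕ) : Pairwise (Function.onFun Disjoint
    fun m => waiting (k + 1) m ∩ {s | alloc s (m + 1) = 0}) := by
  intro m n hmn
  refine Set.disjoint_left.2 fun s hs hs' => ?_
  rcases hmn.lt_or_gt with h | h
  · exact hs'.1.1 m h hs.2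
  · exact hs.1.1 n h hs'.2

theorem disjoint_lt_position (k : ℕ) : Pairwise (Function.onFun Disjoint
    fun m => waiting (k + 1) m ∩ {s | alloc s (m + 1) = k + 1}) := by
  have aux : ∀ m n, m < n → ∀ s ∈ waiting (k + 1) m ∩ {s | alloc s (m + 1) = k + 1},
      s ∉ waiting (k + 1) n := fun m n h s hs hs' => by
    have h1 : k + 1 < numClusters s (n + 1) :=
      exists_alloc_eq_iff.1 ⟨m + 1, by omega, hs.2⟩
    exact h1.ne' hs'.2
  intro m n hmn
  refine Set.disjoint_left.2 fun s hs hs' => ?_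
  rcases hmn.lt_or_gt with h | h
  · exact aux m n h s hs hs'.1
  · exact aux n m h s hs' hs.1

theorem measurable_position : Measurable position := by
  refine measurable_to_countable' fun k => ?_
  rcases k with _ | k
  · have : position ⁻¹' {0} = {s | FirstReturns s}ᶜ := by
      ext s
      simp only [Set.mem_preimage, Set.mem_singleton_iff, Set.mem_compl_iff, Set.mem_ofPred_eq,
        ← position_pos_iff]
      omega
    rw [this]
    exact measurableSet_firstReturns.compl
  · change MeasurableSet {s | position s = k + 1}
    rw [setOf_position_eq]
    exact MeasurableSet.iUnion fun m => (measurableSet_waiting _ m).inter (measurableSet_alloc _ _)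

end RemoveFirst

/-! ### The law of the position, and the top to random move -/

section PosTail

theorem sum_succ_add_le_one (p : SubProb) (k : ℕ) :
    p.1 0 + ∑ l ∈ Finset.range k, p.1 (l + 1) ≤ 1 := by
  have := sum_coord_le_one p (k + 1)
  rw [Finset.sum_range_succ'] at this
  linarith

theorem posTail_succ (p : SubProb) (k : ℕ) : posTail p (k + 1) =
    posTail p k * (1 - p.1 0 / (1 - ∑ l ∈ Finset.range k, p.1 (l + 1))) :=
  Finset.prod_range_succ _ _

theorem posTail_factor_nonneg (p : SubProb) (k : ℕ) :
    0 ≤ 1 - p.1 0 / (1 - ∑ l ∈ Finset.range k, p.1 (l + 1)) := by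
  have h := sum_succ_add_le_one p k
  have h0 := p.2.1 0
  exact sub_nonneg.2 (div_le_one_of_le₀ (by linarith) (by linarith))

theorem posTail_factor_le (p : SubProb) (hp : 0 < p.1 0) (k : ℕ) :
    1 - p.1 0 / (1 - ∑ l ∈ Finset.range k, p.1 (l + 1)) ≤ 1 - p.1 0 := by
  have h := sum_succ_add_le_one p k
  have h0 : 0 ≤ ∑ l ∈ Finset.range k, p.1 (l + 1) := Finset.sum_nonneg fun l _ => p.2.1 _
  have : p.1 0 ≤ p.1 0 / (1 - ∑ l ∈ Finset.range k, p.1 (l + 1)) :=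
    le_div_self hp.le (by linarith) (by linarith)
  linarith

theorem posTail_nonneg (p : SubProb) (k : ℕ) : 0 ≤ posTail p k :=
  Finset.prod_nonneg fun i _ => posTail_factor_nonneg p i

theorem posTail_succ_le (p : SubProb) (k : ℕ) : posTail p (k + 1) ≤ posTail p k := by
  rw [posTail_succ]
  refine mul_le_of_le_one_right (posTail_nonneg p k) (sub_le_self _ (div_nonneg (p.2.1 0) ?_))
  have h := sum_succ_add_le_one p k
  have h0 := p.2.1 0
  linarith

theorem posTail_zero (p : SubProb) : posTail p 0 = 1 := by simp [posTail]

theorem posTail_le_one (p : SubProb) (k : ℕ) : posTail p k ≤ 1 := by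
  induction k with
  | zero => rw [posTail_zero]
  | succ k ih => exact (posTail_succ_le p k).trans ih

theorem tendsto_posTail (p : SubProb) (hp : 0 < p.1 0) : Tendsto (posTail p) atTop (𝓝 0) := by
  have h1 : 0 ≤ 1 - p.1 0 := sub_nonneg.2 (coord_le_one p 0)
  refine squeeze_zero (posTail_nonneg p) (fun k => ?_)
    (tendsto_pow_atTop_nhds_zero_of_lt_one h1 (by linarith))
  refine (Finset.prod_le_prod (fun i _ => posTail_factor_nonneg p i)
    fun i _ => posTail_factor_le p hp i).trans_eq ?_
  simp

theorem tsum_posTail_sub (p : SubProb) (hp : 0 < p.1 0) :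
    ∑' k, ENNReal.ofReal (posTail p k - posTail p (k + 1)) = 1 := by
  have h0 : ∀ k, 0 ≤ posTail p k - posTail p (k + 1) := fun k =>
    sub_nonneg.2 (posTail_succ_le p k)
  have h : HasSum (fun k => posTail p k - posTail p (k + 1)) 1 := by
    rw [hasSum_iff_tendsto_nat_of_nonneg h0]
    simp only [Finset.sum_range_sub', posTail_zero]
    simpa using (tendsto_posTail p hp).const_sub 1
  rw [← ENNReal.ofReal_tsum_of_nonneg h0 h.summable, h.tsum_eq, ENNReal.ofReal_one]

theorem mixture_apply {w : ℕ → SubProb → ℝ} {hw : ∀ j, Measurable (w j)}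
    {f : ℕ → SubProb → SubProb} {hf : ∀ j, Measurable (f j)} (p : SubProb) {B : Set SubProb}
    (hB : MeasurableSet B) : mixture w hw f hf p B =
      ∑' j, ENNReal.ofReal (w j p) * B.indicator 1 (f j p) := by
  change (Measure.sum fun j => ENNReal.ofReal (w j p) • Measure.dirac (f j p)) B = _
  simp only [Measure.sum_apply _ hB, Measure.smul_apply, smul_eq_mul, Measure.dirac_apply' _ hB]

theorem topToRandom_apply_of_eq {p : SubProb} (hp : p.1 0 = 0) {B : Set SubProb}
    (hB : MeasurableSet B) : topToRandom p B = B.indicator 1 (dropTop p) := by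
  have h : topToRandom p = Measure.dirac (dropTop p) :=
    (Kernel.piecewise_apply (s := {p : SubProb | p.1 0 = 0}) p).trans (if_pos hp)
  rw [h, Measure.dirac_apply' _ hB]

theorem topToRandom_apply_of_pos {p : SubProb} (hp : 0 < p.1 0) {B : Set SubProb}
    (hB : MeasurableSet B) : topToRandom p B =
      ∑' j, ENNReal.ofReal (posTail p j - posTail p (j + 1)) *
        B.indicator 1 (moveTopTo (j + 1) p) := by
  have h := (Kernel.piecewise_apply (κ := Kernel.deterministic dropTop measurable_dropTop)
    (η := mixture (fun j p => posTail p j - posTail p (j + 1))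
      (fun j => (measurable_posTail j).sub (measurable_posTail (j + 1)))
      (fun j => moveTopTo (j + 1)) (fun j => measurable_moveTopTo (j + 1)))
    (s := {p : SubProb | p.1 0 = 0}) (hs := measurable_coord 0 (measurableSet_singleton 0))
    p).trans (if_neg hp.ne')
  exact (congrArg (fun ρ => ρ B) h).trans (mixture_apply p hB)

instance isMarkovKernel_topToRandom : IsMarkovKernel topToRandom := by
  refine ⟨fun p => ⟨?_⟩⟩
  rcases (p.2.1 0).eq_or_lt with hp | hp
  · rw [topToRandom_apply_of_eq hp.symm MeasurableSet.univ]
    simp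
  · rw [topToRandom_apply_of_pos hp MeasurableSet.univ]
    simpa using tsum_posTail_sub p hp

end PosTail

section PositionLaw

theorem measurableSet_lt_position (k : ℕ) : MeasurableSet {s | k < position s} :=
  measurable_position (measurableSet_Ioi (a := k))

theorem measurableSet_position_eq (k : ℕ) : MeasurableSet {s | position s = k} :=
  measurable_position (measurableSet_singleton k)

theorem setLIntegral_lt_position_eq_add {ν : Measure (Setoid ℕ)} (k : ℕ) (f : Setoid ℕ → ENNReal) :
    ∫⁻ s in {s | k < position s}, f s ∂ν = ∫⁻ s in {s | position s = k + 1}, f s ∂ν +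
      ∫⁻ s in {s | k + 1 < position s}, f s ∂ν := by
  rw [← lintegral_union (measurableSet_lt_position (k + 1))]
  · congr 2
    ext s
    simp only [Set.mem_ofPred_eq, Set.mem_union]
    omega
  · refine Set.disjoint_left.2 fun s hs hs' => ?_
    have h1 : position s = k + 1 := hs
    have h2 : k + 1 < position s := hs'
    omega

variable {ν : Measure (Setoid ℕ)} [IsFiniteMeasure ν]

/-- On the event that the first frequency is 0, the prediction rule gives probability 0 to a return
at each given place. Without a return the first frequency is a limit of zeros. -/
theorem SwapInvariant.ae_firstReturns_iff (hν : SwapInvariant ν) :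
    ∀ᵐ s ∂ν, FirstReturns s ↔ 0 < (freqs s).1 0 := by
  have h : ∀ i, ∀ᵐ s ∂ν, ¬ ((freqs s).1 0 = 0 ∧ alloc s (i + 1) = 0) := fun i => by
    have hB : MeasurableSet {p : SubProb | p.1 0 = 0} :=
      measurable_coord 0 (measurableSet_singleton 0)
    have hD : MeasurableSet {s | (freqs s).1 0 = 0} := measurable_freqs hB
    have := hν.measure_inter_alloc_of_lt hD
      ((symmetricFrom_freqs {p : SubProb | p.1 0 = 0}).mono (Nat.zero_le (i + 1)))
      (j := 0) (fun s _ => numClusters_pos s i)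
    rw [setLIntegral_congr_fun hD (g := fun _ => 0) fun s hs => by
      dsimp only
      rw [show (freqs s).1 0 = 0 from hs, ENNReal.ofReal_zero], lintegral_zero] at this
    rw [ae_iff]
    simp only [not_not]
    exact this
  filter_upwards [ae_all_iff.2 h, hν.ae_hasFreqs] with s hs hf
  constructor
  · rintro ⟨i, hi⟩
    exact ((freqs s).2.1 0).lt_of_ne fun h0 => hs i ⟨h0.symm, hi⟩
  · intro h0
    by_contra hr
    exact h0.ne' (hf.freqs_zero_of_not hr)

theorem SwapInvariant.setLIntegral_position_eq (hν : SwapInvariant ν) (k : ℕ)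
    {h : SubProb → ENNReal} (hh : Measurable h) :
    ∫⁻ s in {s | position s = k + 1}, h (freqs s) ∂ν =
      ∑' m, ∫⁻ s in waiting (k + 1) m, ENNReal.ofReal ((freqs s).1 0) * h (freqs s) ∂ν := by
  rw [setOf_position_eq, lintegral_iUnion
    (fun m => (measurableSet_waiting _ m).inter (measurableSet_alloc _ _)) (disjoint_position_eq k)]
  refine tsum_congr fun m => ?_
  rw [hν.setLIntegral_alloc (measurableSet_waiting _ m) (symmetricFrom_waiting _ m)
    (fun s hs => hs.2) 0 hh]
  simp only [allocWeight, Nat.succ_pos, if_true]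

/-- As `h` vanishes where the first frequency does, the condition that the first cluster returns can
be dropped almost everywhere. What remains is the opening of a cluster from a waiting state. -/
theorem SwapInvariant.setLIntegral_lt_position (hν : SwapInvariant ν) (k : ℕ)
    {h : SubProb → ENNReal} (hh : Measurable h) (h0 : ∀ p, p.1 0 = 0 → h p = 0) :
    ∫⁻ s in {s | k + 1 < position s}, h (freqs s) ∂ν =
      ∑' m, ∫⁻ s in waiting (k + 1) m,
        ENNReal.ofReal (1 - ∑ l ∈ Finset.range (k + 1), (freqs s).1 l) * h (freqs s) ∂ν := by
  have hN : ∀ m, MeasurableSet (waiting (k + 1) m ∩ {s | alloc s (m + 1) = k + 1}) := fun m =>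
    (measurableSet_waiting _ m).inter (measurableSet_alloc _ _)
  have hz : ∫⁻ s in {s | k + 1 < position s}, h (freqs s) ∂ν =
      ∫⁻ s in ⋃ m, waiting (k + 1) m ∩ {s | alloc s (m + 1) = k + 1}, h (freqs s) ∂ν := by
    rw [setOf_lt_position, ← lintegral_indicator (MeasurableSet.iUnion hN),
      ← lintegral_indicator (measurableSet_firstReturns.inter (MeasurableSet.iUnion hN))]
    refine lintegral_congr_ae ?_
    filter_upwards [hν.ae_firstReturns_iff] with s hs
    by_cases hr : FirstReturns s
    · rw [← Set.indicator_indicator]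
      exact Set.indicator_of_mem (show s ∈ {s | FirstReturns s} from hr) _
    · have : h (freqs s) = 0 := h0 _
        (le_antisymm (not_lt.1 fun h => hr (hs.2 h)) ((freqs s).2.1 0))
      exact (Set.indicator_apply_eq_zero (f := fun s => h (freqs s)).2 fun _ => this).trans
        (Set.indicator_apply_eq_zero (f := fun s => h (freqs s)).2 fun _ => this).symm
  rw [hz, lintegral_iUnion hN (disjoint_lt_position k)]
  refine tsum_congr fun m => ?_
  rw [hν.setLIntegral_alloc (measurableSet_waiting _ m) (symmetricFrom_waiting _ m)
    (fun s hs => hs.2) (k + 1) hh]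
  simp only [allocWeight, lt_irrefl, if_false, if_true]

/-- From a waiting state with `k + 1` clusters, the state is left by a return (the position is `k +
1`) with weight `P₁`, or by a new cluster (the position is larger) with weight `1 - P₁ - ⋯ -
P_{k+1}`. These weights are the same at all times, and the second one divided by their sum is the
next factor of `posTail`. -/
theorem SwapInvariant.lintegral_posTail (hν : SwapInvariant ν) (k : ℕ)
    {h : SubProb → ENNReal} (hh : Measurable h) (h0 : ∀ p, p.1 0 = 0 → h p = 0) :
    ∫⁻ s in {s | k < position s}, h (freqs s) ∂ν =
      ∫⁻ s, ENNReal.ofReal (posTail (freqs s) k) * h (freqs s) ∂ν := by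
  induction k generalizing h with
  | zero =>
    simp only [posTail_zero, ENNReal.ofReal_one, one_mul]
    rw [← lintegral_indicator (measurableSet_lt_position 0)]
    refine lintegral_congr_ae ?_
    filter_upwards [hν.ae_firstReturns_iff] with s hs
    refine Set.indicator_apply_eq_self.2 fun hp => ?_
    refine h0 _ (le_antisymm (not_lt.1 fun h => hp ?_) ((freqs s).2.1 0))
    exact position_pos_iff.2 (hs.2 h)
  | succ k ih =>
    set F : SubProb → ℝ := fun p => 1 - p.1 0 / (1 - ∑ l ∈ Finset.range k, p.1 (l + 1))
    have hF : Measurable F := measurable_const.sub ((measurable_coord 0).div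
      (measurable_const.sub (Finset.measurable_sum _ fun l _ => measurable_coord (l + 1))))
    set g : SubProb → ENNReal := fun p => ENNReal.ofReal (F p) * h p
    have hg : Measurable g := hF.ennreal_ofReal.mul hh
    have hg0 : ∀ p, p.1 0 = 0 → g p = 0 := fun p hp => by simp only [g, h0 p hp, mul_zero]
    -- Both sides are sums over the same waiting states, so it suffices to compare integrands: the
    -- total weight of leaving, times `F`, is the weight of a new cluster. Where the first frequency
    -- is positive, the denominator is positive too; elsewhere `h` vanishes.
    have hkey : ∫⁻ s in {s | k + 1 < position s}, h (freqs s) ∂ν =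
        ∫⁻ s in {s | k < position s}, g (freqs s) ∂ν := by
      rw [setLIntegral_lt_position_eq_add k, hν.setLIntegral_position_eq k hg,
        hν.setLIntegral_lt_position k hg hg0, hν.setLIntegral_lt_position k hh h0,
        ← ENNReal.tsum_add]
      refine tsum_congr fun m => ?_
      have hm : Measurable fun s => ENNReal.ofReal ((freqs s).1 0) * g (freqs s) :=
        (measurable_ofReal_freqs 0).mul (hg.comp measurable_freqs)
      rw [← lintegral_add_left hm]
      refine lintegral_congr fun s => ?_
      rcases ((freqs s).2.1 0).eq_or_lt with hp | hp
      · rw [h0 _ hp.symm, hg0 _ hp.symm]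
        simp
      · set p := freqs s
        have hle := sum_succ_add_le_one p k
        have hR : 0 ≤ 1 - ∑ l ∈ Finset.range (k + 1), p.1 l :=
          sub_nonneg.2 (sum_coord_le_one p _)
        rw [← add_mul, ← ENNReal.ofReal_add hp.le hR]
        simp only [g]
        rw [← mul_assoc, ← ENNReal.ofReal_mul (by linarith)]
        congr 2
        simp only [F]
        rw [Finset.sum_range_succ']
        have hQ : 1 - ∑ l ∈ Finset.range k, p.1 (l + 1) ≠ 0 := by linarith
        field_simp
        ring
    rw [hkey, ih hg hg0]
    refine lintegral_congr fun s => ?_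
    simp only [g]
    rw [← mul_assoc, ← ENNReal.ofReal_mul (posTail_nonneg _ _), posTail_succ]

/-- Two consecutive tails are subtracted; the bound on `h` makes the subtracted integral finite. -/
theorem SwapInvariant.setLIntegral_position (hν : SwapInvariant ν) (k : ℕ)
    {h : SubProb → ENNReal} (hh : Measurable h) (h0 : ∀ p, p.1 0 = 0 → h p = 0)
    (h1 : ∀ p, h p ≤ 1) :
    ∫⁻ s in {s | position s = k + 1}, h (freqs s) ∂ν =
      ∫⁻ s, ENNReal.ofReal (posTail (freqs s) k - posTail (freqs s) (k + 1)) * h (freqs s) ∂ν := by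
  have hadd := setLIntegral_lt_position_eq_add (ν := ν) k fun s => h (freqs s)
  rw [hν.lintegral_posTail k hh h0, hν.lintegral_posTail (k + 1) hh h0] at hadd
  have hm : Measurable fun s => ENNReal.ofReal (posTail (freqs s) (k + 1)) * h (freqs s) :=
    ((measurable_posTail (k + 1)).comp measurable_freqs).ennreal_ofReal.mul
      (hh.comp measurable_freqs)
  have hfin : ∫⁻ s, ENNReal.ofReal (posTail (freqs s) (k + 1)) * h (freqs s) ∂ν ≠ ⊤ := by
    refine ne_top_of_le_ne_top (measure_ne_top ν Set.univ) ?_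
    rw [← lintegral_one]
    refine lintegral_mono fun s => mul_le_one' ?_ (h1 _)
    rw [← ENNReal.ofReal_one]
    exact ENNReal.ofReal_le_ofReal (posTail_le_one _ _)
  refine (ENNReal.add_left_inj hfin).1 (hadd.symm.trans ?_)
  rw [← lintegral_add_right _ hm]
  refine lintegral_congr fun s => ?_
  rw [← add_mul, ← ENNReal.ofReal_add (sub_nonneg.2 (posTail_succ_le _ _)) (posTail_nonneg _ _),
    sub_add_cancel]

theorem SwapInvariant.ae_freqs_shift_one (hν : SwapInvariant ν) : ∀ᵐ s ∂ν,
    ((freqs s).1 0 = 0 → freqs (shift 1 s) = dropTop (freqs s)) ∧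
    (0 < (freqs s).1 0 → 1 ≤ position s ∧
      freqs (shift 1 s) = moveTopTo (position s) (freqs s)) := by
  filter_upwards [hν.ae_hasFreqs, hν.ae_firstReturns_iff] with s hs hr
  refine ⟨fun h => (hs.shift_one_of_not fun hr' => (hr.1 hr').ne' h).1, fun h => ?_⟩
  exact ⟨position_pos_iff.2 (hr.2 h), (hs.shift_one_of_firstReturns (hr.2 h)).1⟩

theorem SwapInvariant.measure_freqs_shift_one (hν : SwapInvariant ν) {B : Set SubProb}
    (hB : MeasurableSet B) :
    ν {s | freqs (shift 1 s) ∈ B} = ∫⁻ s, topToRandom (freqs s) B ∂ν := by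
  have hU : MeasurableSet {s | (freqs s).1 0 = 0} :=
    measurable_freqs (measurable_coord 0 (measurableSet_singleton 0))
  have hE : MeasurableSet {s | freqs (shift 1 s) ∈ B} :=
    (measurable_freqs.comp (measurable_shift 1)) hB
  rw [← measure_inter_add_sdiff _ hU, ← lintegral_add_compl _ hU]
  congr 1
  · rw [setLIntegral_congr_fun hU (g := fun s => B.indicator 1 (dropTop (freqs s)))
      fun s hs => topToRandom_apply_of_eq hs hB]
    rw [← lintegral_indicator_one (hE.inter hU), ← lintegral_indicator hU]
    refine lintegral_congr_ae ?_
    filter_upwards [hν.ae_freqs_shift_one] with s hs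
    classical
    by_cases h : (freqs s).1 0 = 0
    · simp [Set.indicator_apply, h, hs.1 h]
    · simp [Set.indicator_apply, h]
  -- On the part with positive first frequency, the kernel and the actual move are both split
  -- according to the position `j + 1`.
  · let h : ℕ → SubProb → ENNReal := fun j =>
      ({p : SubProb | p.1 0 ≠ 0} ∩ moveTopTo (j + 1) ⁻¹' B).indicator 1
    have hset : ∀ j, MeasurableSet ({p : SubProb | p.1 0 ≠ 0} ∩ moveTopTo (j + 1) ⁻¹' B) :=
      fun j => (measurable_coord 0 (measurableSet_singleton 0)).compl.inter
        (measurable_moveTopTo (j + 1) hB)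
    have hh : ∀ j, Measurable (h j) := fun j => measurable_one.indicator (hset j)
    have h0 : ∀ j p, p.1 0 = 0 → h j p = 0 := fun j p hp =>
      Set.indicator_of_notMem (fun hp' => hp'.1 hp) _
    have h1 : ∀ j p, h j p ≤ 1 := fun j p => Set.indicator_le_self' (fun _ _ => zero_le_one) p
    have e1 : ∫⁻ s in {s | (freqs s).1 0 = 0}ᶜ, topToRandom (freqs s) B ∂ν =
        ∑' j, ∫⁻ s in {s | position s = j + 1}, h j (freqs s) ∂ν := by
      simp only [fun j => hν.setLIntegral_position j (hh j) (h0 j) (h1 j)]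
      have hm : ∀ j, Measurable fun s =>
          ENNReal.ofReal (posTail (freqs s) j - posTail (freqs s) (j + 1)) * h j (freqs s) :=
        fun j => (((measurable_posTail j).sub (measurable_posTail (j + 1))).comp
          measurable_freqs).ennreal_ofReal.mul ((hh j).comp measurable_freqs)
      rw [← lintegral_tsum fun j => (hm j).aemeasurable, ← lintegral_indicator hU.compl]
      refine lintegral_congr fun s => ?_
      by_cases hs : (freqs s).1 0 = 0
      · rw [Set.indicator_of_notMem
          (show s ∉ {s | (freqs s).1 0 = 0}ᶜ from fun hs' => hs' hs)]
        simp [h0 _ _ hs]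
      · rw [Set.indicator_of_mem (show s ∈ {s | (freqs s).1 0 = 0}ᶜ from hs),
          topToRandom_apply_of_pos (((freqs s).2.1 0).lt_of_ne' hs) hB]
        refine tsum_congr fun j => ?_
        classical
        simp only [h, Set.indicator_apply, Set.mem_inter_iff, Set.mem_preimage,
          Set.mem_ofPred_eq, ne_eq, hs, not_false_eq_true, true_and, Pi.one_apply]
    rw [e1]
    have hdisj : Pairwise (Function.onFun Disjoint fun j => {s | position s = j + 1}) :=
      fun i j hij => Set.disjoint_left.2 fun s hs hs' => hij (by
        have h1 : position s = i + 1 := hs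
        have h2 : position s = j + 1 := hs'
        omega)
    have e2 : ∀ j, ∫⁻ s in {s | position s = j + 1}, h j (freqs s) ∂ν =
        ∫⁻ s in {s | position s = j + 1},
          ({s | freqs (shift 1 s) ∈ B} \ {s | (freqs s).1 0 = 0}).indicator 1 s ∂ν := fun j => by
      refine setLIntegral_congr_fun_ae (measurableSet_position_eq _) ?_
      filter_upwards [hν.ae_freqs_shift_one] with s hs hj
      have hj : position s = j + 1 := hj
      classical
      by_cases hp : (freqs s).1 0 = 0
      · simp [h, hp]
      · have := (hs.2 (((freqs s).2.1 0).lt_of_ne' hp)).2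
        simp [h, Set.indicator_apply, hp, this, hj]
    simp only [e2]
    rw [← lintegral_iUnion (fun j => measurableSet_position_eq _) hdisj,
      ← lintegral_indicator_one (hE.diff hU),
      ← lintegral_indicator (MeasurableSet.iUnion fun j => measurableSet_position_eq _)]
    refine lintegral_congr_ae ?_
    filter_upwards [hν.ae_freqs_shift_one] with s hs
    by_cases hp : (freqs s).1 0 = 0
    · rw [Set.indicator_of_notMem fun h => h.2 hp, Set.indicator_apply_eq_zero.2]
      exact fun _ => Set.indicator_of_notMem (fun h => h.2 hp) _
    · symm
      refine Set.indicator_of_mem ?_ _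
      have := (hs.2 (((freqs s).2.1 0).lt_of_ne' hp)).1
      exact Set.mem_iUnion.2 ⟨position s - 1, by
        change position s = position s - 1 + 1
        omega⟩

end PositionLaw

/-! ### Exchangeability as invariance under exchanges of neighbours -/

section Exchangeability

theorem coe_swap_fin {n i : ℕ} (h : i + 1 < n) (k : Fin n) :
    ((Equiv.swap (⟨i, by omega⟩ : Fin n) ⟨i + 1, h⟩ k : Fin n) : ℕ) =
      Equiv.swap i (i + 1) (k : ℕ) := by
  simp only [Equiv.swap_apply_def, Fin.ext_iff]
  split_ifs <;> rfl

theorem restrict_swapAt {n i : ℕ} (h : i + 1 < n) (s : Setoid ℕ) :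
    restrict n (swapAt i s) =
      (restrict n s).comap (Equiv.swap (⟨i, by omega⟩ : Fin n) ⟨i + 1, h⟩) := by
  ext k l
  change s.r (Equiv.swap i (i + 1) (k : ℕ)) (Equiv.swap i (i + 1) (l : ℕ)) ↔
    s.r (Equiv.swap (⟨i, by omega⟩ : Fin n) ⟨i + 1, h⟩ k : Fin n)
      (Equiv.swap (⟨i, by omega⟩ : Fin n) ⟨i + 1, h⟩ l : Fin n)
  rw [coe_swap_fin, coe_swap_fin]

theorem comap_swap_comap_swap {n : ℕ} (a b : Fin n) (t : Setoid (Fin n)) :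
    (t.comap (Equiv.swap a b)).comap (Equiv.swap a b) = t := by
  ext k l
  change t.r _ _ ↔ t.r _ _
  rw [Equiv.swap_apply_self, Equiv.swap_apply_self]

theorem restrict_swapAt_eq_iff {n i : ℕ} (h : i + 1 < n) (s : Setoid ℕ) (t : Setoid (Fin n)) :
    restrict n (swapAt i s) = t ↔
      restrict n s = t.comap (Equiv.swap (⟨i, by omega⟩ : Fin n) ⟨i + 1, h⟩) := by
  rw [restrict_swapAt h]
  constructor
  · rintro rfl
    rw [comap_swap_comap_swap]
  · intro hs
    rw [hs, comap_swap_comap_swap]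

variable {Ω : Type*} [MeasurableSpace Ω] {μ : Measure Ω} [IsProbabilityMeasure μ]
  {Pt : Ω → Setoid ℕ}

/-- Exchanges of neighbours generate the symmetric group of each initial segment. -/
theorem isExchangeable_iff (hPt : Measurable Pt) :
    IsExchangeable μ Pt ↔ ∀ i, (μ.map Pt).map (swapAt i) = μ.map Pt := by
  have hν : IsProbabilityMeasure (μ.map Pt) := Measure.isProbabilityMeasure_map hPt.aemeasurable
  have hcyl : ∀ (n : ℕ) (t : Setoid (Fin n)),
      (μ.map Pt).real {s | restrict n s = t} = μ.real {ω | restrict n (Pt ω) = t} := fun n t => by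
    rw [map_measureReal_apply hPt (measurableSet_cylinder t)]
    rfl
  constructor
  · intro h i
    have := Measure.isProbabilityMeasure_map (μ := μ.map Pt) (measurable_swapAt i).aemeasurable
    refine ext_of_cylinders (i + 2) fun n hn s₀ => ?_
    have hset : swapAt i ⁻¹' {s | restrict n s = restrict n s₀} = {s | restrict n s =
        (restrict n s₀).comap (Equiv.swap (⟨i, by omega⟩ : Fin n) ⟨i + 1, by omega⟩)} := by
      ext s
      exact restrict_swapAt_eq_iff (by omega) s _
    rw [Measure.map_apply (measurable_swapAt i) (measurableSet_cylinder _), hset,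
      ← measureReal_eq_measureReal_iff, hcyl, hcyl]
    exact h n _ _
  · intro h n
    rcases n with _ | n
    · intro σ s
      congr 2
      ext ω
      have : s.comap σ = s := by ext i; exact i.elim0
      rw [this]
    · intro σ
      have hσ : σ ∈ Submonoid.closure
          (Set.range fun i : Fin n => Equiv.swap i.castSucc i.succ) := by
        rw [Equiv.Perm.mclosure_swap_castSucc_succ]
        trivial
      induction hσ using Submonoid.closure_induction with
      | mem σ hσ =>
        obtain ⟨i, rfl⟩ := hσ
        intro t
        rw [← hcyl, ← hcyl]
        have hset : {s | restrict (n + 1) s = t.comap (Equiv.swap i.castSucc i.succ)} =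
            swapAt i ⁻¹' {s | restrict (n + 1) s = t} := by
          ext s
          exact (restrict_swapAt_eq_iff (by omega) s t).symm
        rw [hset, ← map_measureReal_apply (measurable_swapAt i) (measurableSet_cylinder t), h]
      | one => intro t; rfl
      | mul σ τ _ _ hσ hτ =>
        intro t
        rw [← hσ t, ← hτ (t.comap σ)]
        rfl

/-- The cycle `0 ↦ 1 ↦ ⋯ ↦ n ↦ 0`. -/
def cycleIndex (n i : ℕ) : ℕ := if i < n then i + 1 else if i = n then 0 else i

theorem cycleIndex_succ (n i : ℕ) :
    cycleIndex (n + 1) i = cycleIndex n (Equiv.swap n (n + 1) i) := by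
  simp only [cycleIndex, Equiv.swap_apply_def]
  split_ifs <;> omega

/-- The first element is put at place `n`, after the `n` next ones. -/
def rotate (n : ℕ) (s : Setoid ℕ) : Setoid ℕ := s.comap (cycleIndex n)

theorem rotate_zero (s : Setoid ℕ) : rotate 0 s = s := by
  have : cycleIndex 0 = id := funext fun i => by
    simp only [cycleIndex, id]
    split_ifs <;> omega
  ext i k
  change s.r (cycleIndex 0 i) (cycleIndex 0 k) ↔ s.r i k
  rw [this]
  rfl

theorem rotate_succ (n : ℕ) (s : Setoid ℕ) : rotate (n + 1) s = swapAt n (rotate n s) := by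
  ext i k
  change s.r (cycleIndex (n + 1) i) (cycleIndex (n + 1) k) ↔
    s.r (cycleIndex n (Equiv.swap n (n + 1) i)) (cycleIndex n (Equiv.swap n (n + 1) k))
  rw [cycleIndex_succ, cycleIndex_succ]

theorem restrict_rotate (n : ℕ) (s : Setoid ℕ) :
    restrict n (rotate n s) = restrict n (shift 1 s) := by
  rw [restrict_eq_iff]
  intro i hi k hk
  rw [shift_one_rel]
  change s.r (cycleIndex n i) (cycleIndex n k) ↔ _
  rw [cycleIndex, cycleIndex, if_pos hi, if_pos hk]

theorem measurable_rotate (n : ℕ) : Measurable (rotate n) :=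
  measurable_of_rel fun _ _ => measurableSet_rel _ _

variable {ν : Measure (Setoid ℕ)}

theorem map_rotate (h : ∀ i, ν.map (swapAt i) = ν) (n : ℕ) : ν.map (rotate n) = ν := by
  induction n with
  | zero =>
    rw [show rotate 0 = id from funext rotate_zero, Measure.map_id]
  | succ n ih =>
    rw [show rotate (n + 1) = swapAt n ∘ rotate n from funext (rotate_succ n),
      ← Measure.map_map (measurable_swapAt n) (measurable_rotate n), ih, h]

/-- The rotation is a product of neighbour exchanges, so it preserves the law, and it agrees with
the shift on the first `n` places. -/
theorem map_shift_one_of_exchangeable [IsFiniteMeasure ν] (h : ∀ i, ν.map (swapAt i) = ν) :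
    ν.map (shift 1) = ν := by
  refine ext_of_cylinders 0 fun n _ s₀ => ?_
  rw [Measure.map_apply (measurable_shift 1) (measurableSet_cylinder _)]
  conv_rhs => rw [← map_rotate h n, Measure.map_apply (measurable_rotate n)
    (measurableSet_cylinder _)]
  simp only [Set.preimage_ofPred_eq, restrict_rotate]

theorem map_shift_of_map_shift_one (h : ν.map (shift 1) = ν) (n : ℕ) : ν.map (shift n) = ν := by
  induction n with
  | zero =>
    rw [show shift 0 = id from funext shift_zero, Measure.map_id]
  | succ n ih =>
    rw [show shift (n + 1) = shift 1 ∘ shift n from funext fun s => (shift_shift 1 n s).symm,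
      ← Measure.map_map (measurable_shift 1) (measurable_shift n), ih, h]

/-! ### The law of the partition is determined by the law of the frequencies -/

theorem restrict_succ_eq_iff {n : ℕ} {s t : Setoid ℕ} :
    restrict (n + 1) s = restrict (n + 1) t ↔
      restrict n s = restrict n t ∧ alloc s n = alloc t n := by
  simp only [restrict_eq_iff_alloc, Nat.lt_succ_iff_lt_or_eq, or_imp, forall_and, forall_eq]

/-- By induction on `n`, the law of the frequencies on each cylinder is the same for both measures:
adding one element multiplies it by the density `allocWeight`, which depends only on the frequencies
and the cylinder. -/
theorem SwapInvariant.eq_of_map_freqs_eq {ν' : Measure (Setoid ℕ)} [IsFiniteMeasure ν]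
    [IsFiniteMeasure ν'] (hν : SwapInvariant ν) (hν' : SwapInvariant ν')
    (h : ν.map freqs = ν'.map freqs) : ν = ν' := by
  have key : ∀ n s₀, (ν.restrict {s | restrict n s = restrict n s₀}).map freqs =
      (ν'.restrict {s | restrict n s = restrict n s₀}).map freqs := by
    intro n s₀
    induction n with
    | zero =>
      have : {s | restrict 0 s = restrict 0 s₀} = Set.univ :=
        Set.eq_univ_of_forall fun s => by ext i; exact i.elim0
      rw [this, Measure.restrict_univ, Measure.restrict_univ, h]
    | succ n ih =>
      have hset : {s | restrict (n + 1) s = restrict (n + 1) s₀} =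
          {s | restrict n s = restrict n s₀} ∩ {s | alloc s n = alloc s₀ n} := by
        ext s
        exact restrict_succ_eq_iff
      have hstep : ∀ ρ : Measure (Setoid ℕ), IsFiniteMeasure ρ → SwapInvariant ρ →
          ∀ B, MeasurableSet B →
          (ρ.restrict {s | restrict (n + 1) s = restrict (n + 1) s₀}).map freqs B =
          ∫⁻ p in B, ENNReal.ofReal (allocWeight (numClusters s₀ n) (alloc s₀ n) p)
            ∂((ρ.restrict {s | restrict n s = restrict n s₀}).map freqs) := fun ρ _ hρ B hB => by
        have hB' := measurable_freqs hB
        rw [Measure.map_apply measurable_freqs hB, Measure.restrict_apply hB',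
          Measure.restrict_map measurable_freqs hB,
          lintegral_map (measurable_allocWeight _ _).ennreal_ofReal measurable_freqs,
          Measure.restrict_restrict hB', hset, ← Set.inter_assoc]
        refine hρ.measure_inter_alloc (hB'.inter (measurableSet_cylinder _))
          (((symmetricFrom_freqs B).mono (Nat.zero_le n)).inter
            (symmetricFrom_of_restrict fun s t hst hs => hst.symm.trans hs)) ?_ _
        exact fun s hs => numClusters_congr (restrict_eq_iff_alloc.1 hs.2)
      ext B hB
      rw [hstep ν inferInstance hν B hB, hstep ν' inferInstance hν' B hB, ih]
  refine ext_of_cylinders 0 fun n _ s₀ => ?_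
  have h1 := congrArg (fun ρ => ρ Set.univ) (key n s₀)
  rw [Measure.map_apply measurable_freqs MeasurableSet.univ,
    Measure.map_apply measurable_freqs MeasurableSet.univ] at h1
  simpa using h1

/-! ### Stationarity implies exchangeability -/

/-- On the second event `k` is not a first element, so it may be exchanged with `k + 1`. -/
theorem SwapInvariant.measure_leader_rel_succ (hν : SwapInvariant ν) {m k : ℕ} (h : m < k) :
    ν {s | IsLeader s m ∧ s.r m (k + 1)} = ν {s | IsLeader s m ∧ s.r m k} := by
  refine Eq.trans ?_ (hν k {s | IsLeader s m ∧ s.r m k}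
    ((measurableSet_isLeader m).inter (measurableSet_rel m k)) fun s hs hs' => hs'.1 m h hs.2)
  congr 1
  ext s
  refine and_congr (isLeader_swapAt (Or.inl h)).symm ?_
  change s.r m (k + 1) ↔ s.r _ _
  rw [swap_of_lt h, Equiv.swap_apply_left]

theorem SwapInvariant.measure_leader_rel (hν : SwapInvariant ν) {m k : ℕ} (h : m < k) :
    ν {s | IsLeader s m ∧ s.r m k} = ν {s | IsLeader s m ∧ s.r m (m + 1)} := by
  induction k, h using Nat.le_induction with
  | base => rfl
  | succ k hk ih => rw [hν.measure_leader_rel_succ hk, ih]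

/-- With a common second element `n`, the events for `m < n` are disjoint, since the cluster of `n`
has only one least element. Their measures do not depend on `n`, so the series converges. -/
theorem SwapInvariant.tendsto_measure_leader_rel [IsFiniteMeasure ν] (hν : SwapInvariant ν) :
    Tendsto (fun m => ν {s | IsLeader s m ∧ s.r m (m + 1)}) atTop (𝓝 0) := by
  refine ENNReal.tendsto_atTop_zero_of_tsum_ne_top
    (ne_top_of_le_ne_top (measure_ne_top ν Set.univ) ?_)
  rw [ENNReal.tsum_eq_iSup_nat]
  refine iSup_le fun n => ?_
  rw [Finset.sum_congr rfl fun m hm => (hν.measure_leader_rel (Finset.mem_range.1 hm)).symm,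
    ← measure_biUnion_finset]
  · exact measure_mono (Set.subset_univ _)
  · intro a _ b _ hab
    refine Set.disjoint_left.2 fun s hs hs' => ?_
    rcases hab.lt_or_gt with h | h
    · exact hs'.1 a h (s.trans hs.2 (s.symm hs'.2))
    · exact hs.1 b h (s.trans hs'.2 (s.symm hs.2))
  · exact fun m _ => (measurableSet_isLeader m).inter (measurableSet_rel m n)

/-- Being first elements excludes earlier relatives, and `h1`, `h2` exclude later ones in the
window; both elements are singletons there, so exchanging them has no effect. -/
theorem restrict_shift_swapAt_of_twoLeaders {M N i : ℕ} {s : Setoid ℕ}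
    (h : TwoLeaders (M + i) s)
    (h1 : ∀ l < N, i + 1 < l → ¬ s.r (M + i) (M + l))
    (h2 : ∀ l < N, i + 1 < l → ¬ s.r (M + (i + 1)) (M + l)) :
    restrict N (swapAt i (shift M s)) = restrict N (shift M s) := by
  have e1 : ∀ l < N, l ≠ i → ¬ s.r (M + i) (M + l) := fun l hl hli hr => by
    rcases lt_trichotomy l (i + 1) with h' | rfl | h'
    · exact h.1 (M + l) (by omega) (s.symm hr)
    · exact h.2 (M + i) (by omega) hr
    · exact h1 l hl h' hr
  have e2 : ∀ l < N, l ≠ i + 1 → ¬ s.r (M + (i + 1)) (M + l) := fun l hl hli hr => by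
    rcases Nat.lt_or_ge (i + 1) l with h' | h'
    · exact h2 l hl h' hr
    · exact h.2 (M + l) (by omega) (s.symm hr)
  have e1' : ∀ l < N, l ≠ i → ¬ s.r (M + l) (M + i) := fun l hl hli hr => e1 l hl hli (s.symm hr)
  have e2' : ∀ l < N, l ≠ i + 1 → ¬ s.r (M + l) (M + (i + 1)) :=
    fun l hl hli hr => e2 l hl hli (s.symm hr)
  rw [restrict_eq_iff]
  intro a ha b hb
  change s.r (M + Equiv.swap i (i + 1) a) (M + Equiv.swap i (i + 1) b) ↔ s.r (M + a) (M + b)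
  have hne : ¬ s.r (M + i) (M + (i + 1)) := h.2 (M + i) (by omega)
  have hne' : ¬ s.r (M + (i + 1)) (M + i) := fun hr => hne (s.symm hr)
  simp only [Equiv.swap_apply_def]
  split_ifs with ha1 hb1 hb2 ha2 hb1 hb2 hb1 hb2
  · subst ha1 hb1; exact iff_of_true (s.refl _) (s.refl _)
  · subst ha1 hb2; exact iff_of_false hne' hne
  · subst ha1; exact iff_of_false (e2 b hb hb2) (e1 b hb hb1)
  · subst ha2 hb1; exact iff_of_false hne hne'
  · subst ha2 hb2; exact iff_of_true (s.refl _) (s.refl _)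
  · subst ha2; exact iff_of_false (e1 b hb hb1) (e2 b hb hb2)
  · subst hb1; exact iff_of_false (e2' a ha ha2) (e1' a ha ha1)
  · subst hb2; exact iff_of_false (e1' a ha ha1) (e2' a ha ha2)
  · exact Iff.rfl

/-- By shift invariance the cylinder may be observed after `M` elements. There the exchange is
either allowed by `SwapInvariant`, or it concerns two first elements, which are singletons in the
window up to an error that vanishes as `M` grows. -/
theorem SwapInvariant.exchangeable_of_stationary [IsFiniteMeasure ν] (hν : SwapInvariant ν)
    (hstat : ν.map (shift 1) = ν) (i : ℕ) : ν.map (swapAt i) = ν := by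
  have hpre : ∀ n, i + 2 ≤ n → ∀ s₀, swapAt i ⁻¹' {s | restrict n s = restrict n s₀} =
      {s | restrict n s = restrict n (swapAt i s₀)} := fun n hn s₀ => by
    ext s
    constructor
    · intro hs
      have := restrict_swapAt_congr (i := i) (Or.inr hn)
        (show restrict n (swapAt i s) = restrict n s₀ from hs)
      rwa [swapAt_swapAt] at this
    · intro hs
      have := restrict_swapAt_congr (i := i) (Or.inr hn)
        (show restrict n s = restrict n (swapAt i s₀) from hs)
      rwa [swapAt_swapAt] at this
  have hle : ∀ n, i + 2 ≤ n → ∀ s₀, ν {s | restrict n s = restrict n (swapAt i s₀)} ≤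
      ν {s | restrict n s = restrict n s₀} := by
    intro n hn s₀
    set C := {s | restrict n s = restrict n s₀}
    have hC : MeasurableSet C := measurableSet_cylinder _
    let v : ℕ → ENNReal := fun m => ν {s | IsLeader s m ∧ s.r m (m + 1)}
    have hbound : ∀ M, ν {s | restrict n s = restrict n (swapAt i s₀)} ≤
        ν C + n * (v (M + i) + v (M + (i + 1))) := by
      intro M
      -- The exceptional event: one of the two places is a first element and has a later relative in
      -- the window.
      let Q : Set (Setoid ℕ) := ⋃ l ∈ Finset.range n, {s | i + 1 < l ∧
        (IsLeader s (M + i) ∧ s.r (M + i) (M + l) ∨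
          IsLeader s (M + (i + 1)) ∧ s.r (M + (i + 1)) (M + l))}
      have hQ : ν Q ≤ n * (v (M + i) + v (M + (i + 1))) := by
        refine (measure_biUnion_finset_le _ _).trans ?_
        refine (Finset.sum_le_card_nsmul _ _ (v (M + i) + v (M + (i + 1))) fun l _ => ?_).trans_eq
          (by rw [Finset.card_range, nsmul_eq_mul])
        by_cases hl : i + 1 < l
        · have h1 := hν.measure_leader_rel (show M + i < M + l by omega)
          have h2 := hν.measure_leader_rel (show M + (i + 1) < M + l by omega)
          simp only [v]
          rw [← h1, ← h2]
          exact (measure_mono fun s hs => hs.2).trans (measure_union_le _ _)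
        · simp [hl]
      set F := shift M ⁻¹' C
      have hF : MeasurableSet F := measurable_shift M hC
      have hT := measurableSet_twoLeaders (M + i)
      have hsub : shift M ⁻¹' (swapAt i ⁻¹' C) ⊆
          swapAt (M + i) ⁻¹' (F \ {s | TwoLeaders (M + i) s}) ∪
            (F ∩ {s | TwoLeaders (M + i) s} ∪ Q) := by
        intro s hs
        by_cases hs2 : TwoLeaders (M + i) s
        · right
          by_cases hsQ : s ∈ Q
          · exact Or.inr hsQ
          · refine Or.inl ⟨?_, hs2⟩
            have hnot : ∀ l < n, i + 1 < l → ¬ s.r (M + i) (M + l) ∧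
                ¬ s.r (M + (i + 1)) (M + l) := fun l hl hil => by
              constructor
              · intro hr
                exact hsQ (Set.mem_biUnion (Finset.mem_coe.2 (Finset.mem_range.2 hl))
                  ⟨hil, Or.inl ⟨hs2.1, hr⟩⟩)
              · intro hr
                exact hsQ (Set.mem_biUnion (Finset.mem_coe.2 (Finset.mem_range.2 hl))
                  ⟨hil, Or.inr ⟨hs2.2, hr⟩⟩)
            have := restrict_shift_swapAt_of_twoLeaders hs2 (fun l hl hil => (hnot l hl hil).1)
              (fun l hl hil => (hnot l hl hil).2)
            exact this.symm.trans hs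
        · left
          refine ⟨?_, fun h => hs2 (twoLeaders_swapAt.1 h)⟩
          change shift M (swapAt (M + i) s) ∈ C
          rw [shift_swapAt]
          exact hs
      calc ν {s | restrict n s = restrict n (swapAt i s₀)} = ν (swapAt i ⁻¹' C) := by
            rw [hpre n hn]
        _ = ν (shift M ⁻¹' (swapAt i ⁻¹' C)) := by
            conv_lhs => rw [← map_shift_of_map_shift_one hstat M]
            rw [Measure.map_apply (measurable_shift M) (measurable_swapAt i hC)]
        _ ≤ ν (F \ {s | TwoLeaders (M + i) s}) + (ν (F ∩ {s | TwoLeaders (M + i) s}) + ν Q) := by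
            refine (measure_mono hsub).trans ((measure_union_le _ _).trans ?_)
            rw [hν (M + i) _ (hF.diff hT) fun s hs => hs.2]
            gcongr
            exact measure_union_le _ _
        _ = ν F + ν Q := by
            rw [← add_assoc, measure_sdiff_add_inter _ hT]
        _ ≤ ν C + n * (v (M + i) + v (M + (i + 1))) := by
            refine add_le_add (le_of_eq ?_) hQ
            conv_rhs => rw [← map_shift_of_map_shift_one hstat M]
            rw [Measure.map_apply (measurable_shift M) hC]
    have hv : Tendsto v atTop (𝓝 0) := hν.tendsto_measure_leader_rel
    have hlim : Tendsto (fun M => ν C + n * (v (M + i) + v (M + (i + 1)))) atTop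
        (𝓝 (ν C + n * (0 + 0))) := by
      refine tendsto_const_nhds.add
        (ENNReal.Tendsto.const_mul ?_ (Or.inr (ENNReal.natCast_ne_top n)))
      exact (hv.comp (tendsto_add_atTop_nat i)).add (hv.comp (tendsto_add_atTop_nat (i + 1)))
    rw [add_zero, mul_zero, add_zero] at hlim
    exact ge_of_tendsto' hlim hbound
  refine ext_of_cylinders (i + 2) fun n hn s₀ => ?_
  rw [Measure.map_apply (measurable_swapAt i) (measurableSet_cylinder _), hpre n hn]
  -- The exchange is an involution, so the inequality for `swapAt i s₀` is the reverse one.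
  refine le_antisymm (hle n hn s₀) ?_
  have := hle n hn (swapAt i s₀)
  rwa [swapAt_swapAt] at this

end Exchangeability

/-! ### The random to top move -/

section RandomToTop

variable {s : Setoid ℕ}

theorem moveIndex_eq_zero {x k : ℕ} (hx : 0 < x) : moveIndex x k = 0 ↔ x = k + 1 := by
  simp only [moveIndex]
  split_ifs with h1 h2
  · exact iff_of_false id (by omega)
  · exact iff_of_true rfl h2.symm
  · omega

/-- The least element of the cluster number `j` is `l`. -/
def IsLeaderOf (l j : ℕ) (s : Setoid ℕ) : Prop := IsLeader s l ∧ alloc s l = j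

/-- The position is the number, in the shifted partition, of the cluster that the first element
belongs to. Naming the least element `l` of that cluster reduces membership to a single relation,
which a finite restriction decides. -/
theorem position_eq_iff (j : ℕ) :
    position s = j + 1 ↔ ∃ l, s.r 0 (l + 1) ∧ IsLeaderOf l j (shift 1 s) := by
  have hr : ∀ i, s.r 0 (i + 1) ↔ alloc s (i + 1) = 0 := fun i => by
    rw [← alloc_eq_iff, alloc_zero, eq_comm]
  constructor
  · intro h
    have hpos : 0 < position s := by omega
    have hret := position_pos_iff.1 hpos
    obtain ⟨i, hi⟩ := id hret
    have h1 := alloc_succ_of_firstReturns hret i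
    rw [hi, eq_comm, moveIndex_eq_zero hpos] at h1
    have hl := leader_rel (shift 1 s) i
    refine ⟨leader (shift 1 s) i, ?_, isLeader_leader _ _, ?_⟩
    · rw [shift_one_rel] at hl
      exact s.trans ((hr i).2 hi) (s.symm hl)
    · rw [alloc_eq_of_rel hl]
      omega
  · rintro ⟨l, hl, -, hj⟩
    rw [hr] at hl
    have hret : FirstReturns s := ⟨l, hl⟩
    have h1 := alloc_succ_of_firstReturns hret l
    rw [hl, eq_comm, moveIndex_eq_zero (position_pos_iff.2 hret), hj] at h1
    exact h1

theorem moveToFront_moveTopTo (j : ℕ) (p : SubProb) :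
    moveToFront j (moveTopTo (j + 1) p) = p := by
  refine Subtype.ext (funext fun k => ?_)
  change p.1 (moveIndex (j + 1) (if k = 0 then j else if k ≤ j then k - 1 else k)) = p.1 k
  refine congrArg p.1 ?_
  simp only [moveIndex]
  split_ifs <;> omega

theorem consZero_dropTop {p : SubProb} (hp : p.1 0 = 0) : consZero (dropTop p) = p := by
  refine Subtype.ext (funext fun k => ?_)
  cases k
  · exact hp.symm
  · rfl

theorem randomToTop_apply (p : SubProb) {B : Set SubProb} (hB : MeasurableSet B) :
    randomToTop p B = ENNReal.ofReal (1 - ∑' j, p.1 j) * B.indicator 1 (consZero p) +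
      ∑' j, ENNReal.ofReal (p.1 j) * B.indicator 1 (moveToFront j p) := by
  rw [randomToTop, mixture_apply _ hB, tsum_eq_zero_add' ENNReal.summable]
  rfl

theorem ofReal_sub_add_tsum (p : SubProb) :
    ENNReal.ofReal (1 - ∑' j, p.1 j) + ∑' j, ENNReal.ofReal (p.1 j) = 1 := by
  rw [← ENNReal.ofReal_tsum_of_nonneg p.2.1 p.2.2.1,
    ← ENNReal.ofReal_add (sub_nonneg.2 p.2.2.2) (tsum_nonneg p.2.1), sub_add_cancel,
    ENNReal.ofReal_one]

instance isMarkovKernel_randomToTop : IsMarkovKernel randomToTop := by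
  refine ⟨fun p => ⟨?_⟩⟩
  rw [randomToTop_apply p MeasurableSet.univ]
  simpa using ofReal_sub_add_tsum p

theorem measurableSet_isLeaderOf (l j : ℕ) : MeasurableSet {s | IsLeaderOf l j s} :=
  (measurableSet_isLeader l).inter (measurableSet_alloc l j)

theorem isLeaderOf_congr {l j n : ℕ} (hn : l < n) {s t : Setoid ℕ}
    (h : restrict n s = restrict n t) (hs : IsLeaderOf l j s) : IsLeaderOf l j t := by
  rw [restrict_eq_iff_alloc] at h
  simp only [IsLeaderOf, isLeader_iff_alloc] at hs ⊢
  rw [← h l hn]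
  refine ⟨fun k hk => ?_, hs.2⟩
  rw [← h k (hk.trans hn)]
  exact hs.1 k hk

variable {ν : Measure (Setoid ℕ)} [IsFiniteMeasure ν]

/-- Both sides are finite measures in `C`, so cylinders suffice. Rotation by `n` puts the first
element behind the `n` that determine the cylinder, and the prediction rule gives its probability of
joining cluster `j`. -/
theorem measure_rel_inter_shift_one (hν : SwapInvariant ν) (h : ∀ i, ν.map (swapAt i) = ν)
    (l j : ℕ) {C : Set (Setoid ℕ)} (hC : MeasurableSet C) :
    ν ({s | s.r 0 (l + 1)} ∩ shift 1 ⁻¹' ({s | IsLeaderOf l j s} ∩ C)) =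
      ∫⁻ s in {s | IsLeaderOf l j s} ∩ C, ENNReal.ofReal ((freqs s).1 j) ∂ν := by
  set H : Set (Setoid ℕ) := {s | IsLeaderOf l j s}
  have hH : MeasurableSet H := measurableSet_isLeaderOf l j
  have e1 : ∀ C, MeasurableSet C →
      ((ν.restrict ({s | s.r 0 (l + 1)} ∩ shift 1 ⁻¹' H)).map (shift 1)) C =
        ν ({s | s.r 0 (l + 1)} ∩ shift 1 ⁻¹' (H ∩ C)) := fun C hC => by
    rw [Measure.map_apply (measurable_shift 1) hC,
      Measure.restrict_apply (measurable_shift 1 hC), Set.inter_comm, Set.inter_assoc]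
    rfl
  have e2 : ∀ C, MeasurableSet C →
      ((ν.restrict H).withDensity fun s => ENNReal.ofReal ((freqs s).1 j)) C =
        ∫⁻ s in H ∩ C, ENNReal.ofReal ((freqs s).1 j) ∂ν := fun C hC => by
    rw [withDensity_apply _ hC, Measure.restrict_restrict hC, Set.inter_comm]
  rw [← e1 C hC, ← e2 C hC]
  congr 1
  refine ext_of_cylinders (l + 1) fun n hn s₀ => ?_
  rw [e1 _ (measurableSet_cylinder _), e2 _ (measurableSet_cylinder _)]
  set D := H ∩ {s | restrict n s = restrict n s₀}
  have hD : MeasurableSet D := hH.inter (measurableSet_cylinder _)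
  have hDn : ∀ s t, restrict n s = restrict n t → s ∈ D → t ∈ D := fun s t hst hs =>
    ⟨isLeaderOf_congr (by omega) hst hs.1, hst.symm.trans hs.2⟩
  rw [← hν.measure_inter_alloc_of_lt hD (symmetricFrom_of_restrict hDn)
    (fun s hs => exists_alloc_eq_iff.1 ⟨l, by omega, hs.1.2⟩)]
  have hset : {s : Setoid ℕ | s.r 0 (l + 1)} ∩ shift 1 ⁻¹' D =
      rotate n ⁻¹' (D ∩ {s | alloc s n = j}) := by
    ext s
    have hDs : shift 1 s ∈ D ↔ rotate n s ∈ D :=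
      ⟨hDn _ _ (restrict_rotate n s).symm, hDn _ _ (restrict_rotate n s)⟩
    rw [Set.mem_inter_iff, and_comm]
    change shift 1 s ∈ D ∧ s.r 0 (l + 1) ↔ rotate n s ∈ D ∧ alloc (rotate n s) n = j
    rw [hDs]
    refine and_congr_right fun hs => ?_
    have hj : alloc (rotate n s) l = j := hs.1.2
    rw [← hj, alloc_eq_iff]
    change _ ↔ s.r (cycleIndex n n) (cycleIndex n l)
    rw [cycleIndex, cycleIndex, if_neg (lt_irrefl n), if_pos rfl, if_pos (by omega)]
  rw [hset, ← Measure.map_apply (measurable_rotate n) (hD.inter (measurableSet_alloc n j)),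
    map_rotate h]

theorem measure_position_inter_shift_one (hν : SwapInvariant ν) (h : ∀ i, ν.map (swapAt i) = ν)
    (j : ℕ) {C : Set (Setoid ℕ)} (hC : MeasurableSet C) :
    ν ({s | position s = j + 1} ∩ shift 1 ⁻¹' C) =
      ∫⁻ s in C, ENNReal.ofReal ((freqs s).1 j) ∂ν := by
  have hset : {s | position s = j + 1} ∩ shift 1 ⁻¹' C =
      ⋃ l, {s | s.r 0 (l + 1)} ∩ shift 1 ⁻¹' ({s | IsLeaderOf l j s} ∩ C) := by
    ext s
    simp only [Set.mem_inter_iff, Set.mem_ofPred_eq, position_eq_iff, Set.mem_iUnion,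
      Set.mem_preimage]
    constructor
    · rintro ⟨⟨l, h1, h2⟩, h3⟩
      exact ⟨l, h1, h2, h3⟩
    · rintro ⟨l, h1, h2, h3⟩
      exact ⟨⟨l, h1, h2⟩, h3⟩
  have huniq : ∀ s l l', IsLeaderOf l j s → IsLeaderOf l' j s → l = l' := fun s l l' hl hl' => by
    have : s.r l l' := alloc_eq_iff.1 (hl.2.trans hl'.2.symm)
    rcases lt_trichotomy l l' with h | h | h
    · exact absurd this (hl'.1 l h)
    · exact h
    · exact absurd (s.symm this) (hl.1 l' h)
  have hm : ∀ l, MeasurableSet ({s | IsLeaderOf l j s} ∩ C) := fun l =>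
    (measurableSet_isLeaderOf l j).inter hC
  rw [hset, measure_iUnion]
  · simp only [fun l => measure_rel_inter_shift_one hν h l j hC]
    rw [← lintegral_iUnion hm]
    · rw [← lintegral_indicator (MeasurableSet.iUnion hm), ← lintegral_indicator hC]
      refine lintegral_congr_ae ?_
      filter_upwards [hν.ae_hasFreqs] with s hs
      by_cases hl : ∃ l, IsLeaderOf l j s
      · rw [← Set.iUnion_inter, ← Set.indicator_indicator]
        exact Set.indicator_of_mem (Set.mem_iUnion.2 hl) _
      -- Partitions without a cluster number `j` are missed by the union over `l`, but contribute
      -- nothing to the integral.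
      · have h0 : (freqs s).1 j = 0 := by
          refine tendsto_nhds_unique (hs j) (tendsto_const_nhds.congr fun n => ?_)
          rw [relFreq, Finset.card_eq_zero.2, Nat.cast_zero, zero_div]
          refine Finset.filter_eq_empty_iff.2 fun i _ hi => hl ⟨leader s i, isLeader_leader s i, ?_⟩
          rw [← hi]
          exact alloc_eq_of_rel (leader_rel s i)
        have h1 : ENNReal.ofReal ((freqs s).1 j) = 0 := by rw [h0, ENNReal.ofReal_zero]
        exact (Set.indicator_apply_eq_zero
          (f := fun s => ENNReal.ofReal ((freqs s).1 j)).2 fun _ => h1).trans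
          (Set.indicator_apply_eq_zero
            (f := fun s => ENNReal.ofReal ((freqs s).1 j)).2 fun _ => h1).symm
    · intro l l' hll'
      exact Set.disjoint_left.2 fun s hs hs' => hll' (huniq s l l' hs.1 hs'.1)
  · intro l l' hll'
    exact Set.disjoint_left.2 fun s hs hs' => hll' (huniq _ l l' hs.2.1 hs'.2.1)
  · exact fun l => (measurableSet_rel 0 (l + 1)).inter (measurable_shift 1 (hm l))

/-- The positions partition the space and the shift preserves the measure, so the singleton case has
the probability left over by the clusters. -/
theorem measure_position_zero_inter_shift_one (hν : SwapInvariant ν)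
    (h : ∀ i, ν.map (swapAt i) = ν) {C : Set (Setoid ℕ)} (hC : MeasurableSet C) :
    ν ({s | position s = 0} ∩ shift 1 ⁻¹' C) =
      ∫⁻ s in C, ENNReal.ofReal (1 - ∑' j, (freqs s).1 j) ∂ν := by
  have hpart : ν (shift 1 ⁻¹' C) = ν ({s | position s = 0} ∩ shift 1 ⁻¹' C) +
      ∑' j, ν ({s | position s = j + 1} ∩ shift 1 ⁻¹' C) := by
    rw [← tsum_eq_zero_add' (f := fun j => ν ({s | position s = j} ∩ shift 1 ⁻¹' C))
      ENNReal.summable, ← measure_iUnion]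
    · rw [← Set.iUnion_inter]
      congr 1
      ext s
      simp
    · intro i j hij
      exact Set.disjoint_left.2 fun s hs hs' => hij (hs.1.symm.trans hs'.1)
    · exact fun j => (measurableSet_position_eq j).inter (measurable_shift 1 hC)
  have hC' : ν (shift 1 ⁻¹' C) = ν C := by
    conv_rhs => rw [← map_shift_one_of_exchangeable h]
    rw [Measure.map_apply (measurable_shift 1) hC]
  have hm : Measurable fun s => ENNReal.ofReal (1 - ∑' j, (freqs s).1 j) :=
    ((measurable_const.sub measurable_total).comp measurable_freqs).ennreal_ofReal
  have htot : ν C = ∫⁻ s in C, ENNReal.ofReal (1 - ∑' j, (freqs s).1 j) ∂ν +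
      ∑' j, ν ({s | position s = j + 1} ∩ shift 1 ⁻¹' C) := by
    simp only [fun j => measure_position_inter_shift_one hν h j hC]
    rw [← lintegral_tsum fun j => (measurable_ofReal_freqs j).aemeasurable,
      ← lintegral_add_left hm]
    simp only [ofReal_sub_add_tsum, setLIntegral_one]
  rw [hC', htot] at hpart
  refine ((ENNReal.add_left_inj ?_).1 hpart).symm
  refine ne_top_of_le_ne_top (measure_ne_top ν C) ?_
  rw [htot]
  exact le_add_self

theorem ae_freqs_eq_of_shift_one (hν : SwapInvariant ν) : ∀ᵐ s ∂ν,
    (position s = 0 → freqs s = consZero (freqs (shift 1 s))) ∧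
    ∀ j, position s = j + 1 → freqs s = moveToFront j (freqs (shift 1 s)) := by
  filter_upwards [hν.ae_hasFreqs] with s hs
  constructor
  · intro h0
    have hr : ¬ FirstReturns s := fun hr => (position_pos_iff.2 hr).ne' h0
    rw [(hs.shift_one_of_not hr).1, consZero_dropTop (hs.freqs_zero_of_not hr)]
  · intro j hj
    have hr : FirstReturns s := position_pos_iff.1 (by omega)
    rw [(hs.shift_one_of_firstReturns hr).1, hj, moveToFront_moveTopTo]

/-- The old frequencies are a function of the position and the new ones, and the law of the position
given the whole shifted partition depends only on the new frequencies. The arbitrary `C` is what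
yields the reversed Markov property. -/
theorem measure_freqs_inter_shift_one (hν : SwapInvariant ν) (h : ∀ i, ν.map (swapAt i) = ν)
    {C : Set (Setoid ℕ)} (hC : MeasurableSet C) {B : Set SubProb} (hB : MeasurableSet B) :
    ν (freqs ⁻¹' B ∩ shift 1 ⁻¹' C) = ∫⁻ s in C, randomToTop (freqs s) B ∂ν := by
  let f : ℕ → SubProb → SubProb := fun i => Nat.casesOn i consZero fun j => moveToFront j
  have hf : ∀ i, Measurable (f i) := fun i => by
    cases i
    · exact measurable_consZero
    · exact measurable_moveToFront _
  have hE : MeasurableSet (freqs ⁻¹' B ∩ shift 1 ⁻¹' C) :=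
    (measurable_freqs hB).inter (measurable_shift 1 hC)
  have hfB : ∀ i, MeasurableSet ((fun s => f i (freqs s)) ⁻¹' B) := fun i =>
    ((hf i).comp measurable_freqs) hB
  have hpart : ν (freqs ⁻¹' B ∩ shift 1 ⁻¹' C) =
      ∑' i, ν ({s | position s = i} ∩ shift 1 ⁻¹' (C ∩ (fun s => f i (freqs s)) ⁻¹' B)) := by
    have h1 : ν (freqs ⁻¹' B ∩ shift 1 ⁻¹' C) =
        ∑' i, ν ({s | position s = i} ∩ (freqs ⁻¹' B ∩ shift 1 ⁻¹' C)) := by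
      rw [← measure_iUnion]
      · rw [← Set.iUnion_inter]
        congr 1
        ext s
        simp
      · intro i j hij
        exact Set.disjoint_left.2 fun s hs hs' => hij (hs.1.symm.trans hs'.1)
      · exact fun j => (measurableSet_position_eq j).inter hE
    rw [h1]
    refine tsum_congr fun i => measure_congr ?_
    filter_upwards [ae_freqs_eq_of_shift_one hν] with s hs
    refine propext (and_congr_right fun hi => ?_)
    have hi : position s = i := hi
    have : freqs s = f i (freqs (shift 1 s)) := by
      cases i
      · exact hs.1 hi
      · exact hs.2 _ hi
    change freqs s ∈ B ∧ shift 1 s ∈ C ↔ shift 1 s ∈ C ∧ f i (freqs (shift 1 s)) ∈ B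
    rw [this, and_comm]
  have hind : ∀ (i : ℕ) (w : Setoid ℕ → ENNReal),
      ∫⁻ s in C ∩ (fun s => f i (freqs s)) ⁻¹' B, w s ∂ν =
        ∫⁻ s in C, w s * B.indicator 1 (f i (freqs s)) ∂ν := fun i w => by
    rw [Set.inter_comm, ← Measure.restrict_restrict (hfB i), ← lintegral_indicator (hfB i)]
    refine lintegral_congr fun s => ?_
    classical
    simp only [Set.indicator_apply, Set.mem_preimage, Pi.one_apply, mul_ite, mul_one, mul_zero]
  have hm : Measurable fun s => ENNReal.ofReal (1 - ∑' j, (freqs s).1 j) *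
      B.indicator 1 (f 0 (freqs s)) :=
    ((measurable_const.sub measurable_total).comp measurable_freqs).ennreal_ofReal.mul
      ((measurable_one.indicator hB).comp ((hf 0).comp measurable_freqs))
  have hm' : ∀ j, Measurable fun s => ENNReal.ofReal ((freqs s).1 j) *
      B.indicator 1 (f (j + 1) (freqs s)) := fun j =>
    (measurable_ofReal_freqs j).mul
      ((measurable_one.indicator hB).comp ((hf (j + 1)).comp measurable_freqs))
  rw [hpart, tsum_eq_zero_add' ENNReal.summable,
    measure_position_zero_inter_shift_one hν h (hC.inter (hfB 0)), hind]
  simp only [fun j => measure_position_inter_shift_one hν h j (hC.inter (hfB (j + 1))), hind]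
  rw [← lintegral_tsum fun j => (hm' j).aemeasurable, ← lintegral_add_left hm]
  exact lintegral_congr fun s => (randomToTop_apply (freqs s) hB).symm

end RandomToTop

/-! ### The Markov properties -/

section Markov

theorem ae_eq_condExp_of_setLIntegral {Ω : Type*} {m m₀ : MeasurableSpace Ω} {μ : Measure Ω}
    [IsFiniteMeasure μ] (hm : m ≤ m₀) {E : Set Ω} (hE : MeasurableSet E) {g : Ω → ℝ}
    (hg : Measurable[m] g) (h0 : ∀ ω, 0 ≤ g ω) (h1 : ∀ ω, g ω ≤ 1)
    (h : ∀ A, MeasurableSet[m] A → μ (A ∩ E) = ∫⁻ ω in A, ENNReal.ofReal (g ω) ∂μ) :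
    μ⟦E | m⟧ =ᵐ[μ] g := by
  have hint : Integrable g μ :=
    Integrable.of_bound (hg.mono hm le_rfl).aestronglyMeasurable 1 (ae_of_all _ fun ω => by
      rw [Real.norm_of_nonneg (h0 ω)]
      exact h1 ω)
  refine (ae_eq_condExp_of_forall_setIntegral_eq hm
    ((integrable_const (1 : ℝ)).indicator hE) (fun A _ _ => hint.integrableOn) ?_
    hg.stronglyMeasurable.aestronglyMeasurable).symm
  intro A hA _
  rw [integral_eq_lintegral_of_nonneg_ae (ae_of_all _ h0) hint.aestronglyMeasurable.restrict,
    ← h A hA, integral_indicator hE, Measure.restrict_restrict hE, setIntegral_const, smul_eq_mul,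
    mul_one, Measure.real, Set.inter_comm]

variable {Ω : Type*}

/-- The sets that do not separate `ω` from `ω'` form a σ-algebra. This shows that events of the past
frequencies are unaffected by allowed exchanges. -/
theorem mem_iff_of_measurableSet_past {S : Type*} [MeasurableSpace S] {Y : ℕ → Ω → S} {n : ℕ}
    {A : Set Ω} (hA : MeasurableSet[past Y n] A) {ω ω' : Ω} (h : ∀ k ≤ n, Y k ω = Y k ω') :
    ω ∈ A ↔ ω' ∈ A := by
  let M : MeasurableSpace Ω :=
    { MeasurableSet' := fun A => ω ∈ A ↔ ω' ∈ A
      measurableSet_empty := Iff.rfl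
      measurableSet_compl := fun A hA => not_congr hA
      measurableSet_iUnion := fun f hf => by
        simp only [Set.mem_iUnion]
        exact exists_congr hf }
  have hle : past Y n ≤ M := by
    refine iSup₂_le fun k hk => ?_
    rintro _ ⟨B, -, rfl⟩
    change Y k ω ∈ B ↔ Y k ω' ∈ B
    rw [h k hk]
  exact hle A hA

theorem past_freqProcess (Pt : Ω → Setoid ℕ) (n : ℕ) :
    past (freqProcess Pt) n = (past (freqProcess id) n).comap Pt := by
  simp only [MeasurableSpace.comap_iSup, MeasurableSpace.comap_comp, past]
  rfl

theorem measurable_freqProcess [MeasurableSpace Ω] {Pt : Ω → Setoid ℕ} (hPt : Measurable Pt)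
    (n : ℕ) : Measurable (freqProcess Pt n) :=
  measurable_freqs.comp ((measurable_shift n).comp hPt)

theorem past_le {S : Type*} [MeasurableSpace Ω] [MeasurableSpace S] {Y : ℕ → Ω → S}
    (hY : ∀ n, Measurable (Y n)) (n : ℕ) : past Y n ≤ ‹MeasurableSpace Ω› :=
  iSup₂_le fun k _ => (hY k).comap_le

theorem measurable_past {S : Type*} [MeasurableSpace S] (Y : ℕ → Ω → S) (n : ℕ) :
    Measurable[past Y n] (Y n) :=
  Measurable.mono (comap_measurable (Y n))
    (le_iSup₂_of_le (f := fun k (_ : k ≤ n) => MeasurableSpace.comap (Y k) inferInstance)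
      n le_rfl le_rfl) le_rfl

theorem measurable_future {S : Type*} [MeasurableSpace S] (Y : ℕ → Ω → S) (n : ℕ) :
    Measurable[future Y n] (Y n) :=
  Measurable.mono (comap_measurable (Y n))
    (le_iSup₂_of_le (f := fun k (_ : n ≤ k) => MeasurableSpace.comap (Y k) inferInstance)
      n le_rfl le_rfl) le_rfl

theorem future_freqProcess_le (Pt : Ω → Setoid ℕ) (n : ℕ) :
    future (freqProcess Pt) n ≤
      MeasurableSpace.comap (fun ω => shift n (Pt ω)) inferInstance := by
  refine iSup₂_le fun k hk => ?_
  have : freqProcess Pt k = (fun s => freqs (shift (k - n) s)) ∘ fun ω => shift n (Pt ω) :=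
    funext fun ω => by
      simp only [Function.comp, shift_shift, Nat.add_sub_cancel' hk]
      rfl
  rw [this, ← MeasurableSpace.comap_comp]
  exact MeasurableSpace.comap_mono (measurable_freqs.comp (measurable_shift _)).comap_le

theorem freqProcess_succ (Pt : Ω → Setoid ℕ) (n : ℕ) (ω : Ω) :
    freqProcess Pt (n + 1) ω = freqs (shift 1 (shift n (Pt ω))) := by
  rw [shift_shift]
  rfl

variable [MeasurableSpace Ω] {μ : Measure Ω} {Pt : Ω → Setoid ℕ}

theorem map_freqProcess (hPt : Measurable Pt) (n : ℕ) :
    μ.map (freqProcess Pt n) = ((μ.map Pt).map (shift n)).map freqs := by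
  rw [Measure.map_map (measurable_shift n) hPt,
    Measure.map_map measurable_freqs ((measurable_shift n).comp hPt)]
  rfl

/-- Given an event of the past of the frequencies, the shifted partition has the invariance of a
partially exchangeable partition. -/
theorem swapInvariant_map_shift (hPt : Measurable Pt) (hν : SwapInvariant (μ.map Pt)) {n : ℕ}
    {A : Set Ω} (hA : MeasurableSet[past (freqProcess Pt) n] A) :
    SwapInvariant ((μ.restrict A).map fun ω => shift n (Pt ω)) := by
  rw [past_freqProcess] at hA
  obtain ⟨A', hA', rfl⟩ := hA
  have hA'm : MeasurableSet A' := past_le (measurable_freqProcess measurable_id) n A' hA'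
  have : (μ.restrict (Pt ⁻¹' A')).map (fun ω => shift n (Pt ω)) =
      ((μ.map Pt).restrict A').map (shift n) := by
    rw [Measure.restrict_map hPt hA'm, Measure.map_map (measurable_shift n) hPt]
    rfl
  rw [this]
  refine hν.map_shift n hA'm fun i s hs => mem_iff_of_measurableSet_past hA' fun k hk => ?_
  change freqs (shift k (swapAt (n + i) s)) = freqs (shift k s)
  -- Removing elements keeps first elements first, so two first elements in the partition shifted by
  -- `k ≤ n` would be two first elements in the one shifted by `n`.
  rw [show n + i = k + (n - k + i) by omega, shift_swapAt, freqs_swapAt]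
  intro h
  have h2 := h.shift
  rw [shift_shift, Nat.add_sub_cancel' hk] at h2
  exact hs h2

theorem swapInvariant_map_shift_univ (hPt : Measurable Pt) (hν : SwapInvariant (μ.map Pt))
    (n : ℕ) : SwapInvariant (μ.map fun ω => shift n (Pt ω)) := by
  have := swapInvariant_map_shift hPt hν (n := n) (A := Set.univ) MeasurableSet.univ
  rwa [Measure.restrict_univ] at this

variable [IsProbabilityMeasure μ]

/-- On each event `A` of the past, the restricted law of the shifted partition is again swap
invariant, so the one-step identity holds on `A`. -/
theorem isMarkovChain_freqProcess (hPt : Measurable Pt) (hν : SwapInvariant (μ.map Pt)) :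
    IsMarkovChain μ (freqProcess Pt) topToRandom := by
  have hY := measurable_freqProcess hPt
  refine ⟨inferInstance, hY, fun n B hB => ?_⟩
  have hsh : Measurable fun ω => shift n (Pt ω) := (measurable_shift n).comp hPt
  refine ae_eq_condExp_of_setLIntegral (past_le hY n) (hY (n + 1) hB)
    ((topToRandom.measurable_coe hB).ennreal_toReal.comp (measurable_past _ n))
    (fun ω => measureReal_nonneg) (fun ω => measureReal_le_one) fun A hA => ?_
  have hS : MeasurableSet {s | freqs (shift 1 s) ∈ B} :=
    (measurable_freqs.comp (measurable_shift 1)) hB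
  have h := (swapInvariant_map_shift hPt hν hA).measure_freqs_shift_one hB
  have hm : Measurable fun s => topToRandom (freqs s) B :=
    (topToRandom.measurable_coe hB).comp measurable_freqs
  rw [Measure.map_apply hsh hS, Measure.restrict_apply (hsh hS), lintegral_map hm hsh] at h
  rw [Set.inter_comm]
  refine Eq.trans ?_ (h.trans (lintegral_congr fun ω => ?_))
  · congr 2
    ext ω
    rw [Set.mem_preimage, freqProcess_succ]
    rfl
  · exact (ofReal_measureReal (measure_ne_top _ _)).symm

theorem condExp_position (hPt : Measurable Pt) (hν : SwapInvariant (μ.map Pt)) (n j : ℕ) :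
    ∀ᵐ ω ∂μ, 0 < (freqProcess Pt n ω).1 0 →
      (μ⟦{ω' | j < position (shift n (Pt ω'))} | past (freqProcess Pt) n⟧) ω =
        posTail (freqProcess Pt n ω) j := by
  have hY := measurable_freqProcess hPt
  have hsh : Measurable fun ω => shift n (Pt ω) := (measurable_shift n).comp hPt
  have hV : MeasurableSet {p : SubProb | p.1 0 ≠ 0} :=
    (measurable_coord 0 (measurableSet_singleton 0)).compl
  set U : Set Ω := freqProcess Pt n ⁻¹' {p : SubProb | p.1 0 ≠ 0}
  have hU : MeasurableSet[past (freqProcess Pt) n] U := measurable_past _ n hV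
  have hX : MeasurableSet {ω | j < position (shift n (Pt ω))} := hsh (measurableSet_lt_position j)
  have hUm := past_le hY n U hU
  -- Where the first frequency is 0 the products `posTail` equal 1 but the position is almost surely
  -- 0, so both sides are cut off there. Since `U` belongs to the past, the indicator is then pulled
  -- out of the conditional expectation.
  let g : SubProb → ℝ := {p : SubProb | p.1 0 ≠ 0}.indicator fun p => posTail p j
  have hg : Measurable g := (measurable_posTail j).indicator hV
  have key := ae_eq_condExp_of_setLIntegral (μ := μ) (past_le hY n)
    (E := U ∩ {ω | j < position (shift n (Pt ω))}) (hUm.inter hX)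
    (g := fun ω => g (freqProcess Pt n ω)) (hg.comp (measurable_past _ n))
    (fun ω => Set.indicator_nonneg (fun p _ => posTail_nonneg p j) _)
    (fun ω => Set.indicator_le' (fun p _ => posTail_le_one p j) (fun _ _ => zero_le_one) _)
    fun A hA => by
      have h := (swapInvariant_map_shift hPt hν hA).lintegral_posTail j
        (h := {p : SubProb | p.1 0 ≠ 0}.indicator 1) (measurable_one.indicator hV)
        (fun p hp => Set.indicator_of_notMem
          (show p ∉ {p : SubProb | p.1 0 ≠ 0} from fun h => h hp) _)
      have hm1 : Measurable fun s : Setoid ℕ =>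
          {p : SubProb | p.1 0 ≠ 0}.indicator (1 : SubProb → ENNReal) (freqs s) :=
        (measurable_one.indicator hV).comp measurable_freqs
      have hm2 : Measurable fun s : Setoid ℕ => ENNReal.ofReal (posTail (freqs s) j) *
          {p : SubProb | p.1 0 ≠ 0}.indicator (1 : SubProb → ENNReal) (freqs s) :=
        ((measurable_posTail j).comp measurable_freqs).ennreal_ofReal.mul hm1
      rw [Measure.restrict_map hsh (measurableSet_lt_position j), lintegral_map hm1 hsh,
        lintegral_map hm2 hsh,
        Measure.restrict_restrict (hsh (measurableSet_lt_position j))] at h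
      have e1 : ∫⁻ ω in (fun ω => shift n (Pt ω)) ⁻¹' {s | j < position s} ∩ A,
          {p : SubProb | p.1 0 ≠ 0}.indicator (1 : SubProb → ENNReal) (freqs (shift n (Pt ω))) ∂μ =
          μ (A ∩ (U ∩ {ω | j < position (shift n (Pt ω))})) := by
        change ∫⁻ ω in (fun ω => shift n (Pt ω)) ⁻¹' {s | j < position s} ∩ A,
          U.indicator (1 : Ω → ENNReal) ω ∂μ = _
        rw [lintegral_indicator_one hUm, Measure.restrict_apply hUm]
        congr 1
        ext ω
        simp only [Set.mem_inter_iff, Set.mem_preimage, Set.mem_ofPred_eq]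
        tauto
      rw [← e1, h]
      refine lintegral_congr fun ω => ?_
      classical
      simp only [g, Set.indicator_apply, Pi.one_apply, mul_ite, mul_one, mul_zero,
        apply_ite ENNReal.ofReal, ENNReal.ofReal_zero]
      rfl
  have hind := condExp_indicator (μ := μ) (m := past (freqProcess Pt) n)
    (f := {ω | j < position (shift n (Pt ω))}.indicator fun _ => (1 : ℝ))
    ((integrable_const (1 : ℝ)).indicator hX) hU
  rw [Set.indicator_indicator] at hind
  filter_upwards [key, hind] with ω h1 h2 hpos
  have hωU : ω ∈ U := hpos.ne'
  rw [h1, Set.indicator_of_mem hωU] at h2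
  rw [← h2]
  exact Set.indicator_of_mem (s := {p : SubProb | p.1 0 ≠ 0}) hpos.ne' _

theorem IsExchangeable.map_shift (hPt : Measurable Pt) (h : IsExchangeable μ Pt) (n : ℕ) :
    (μ.map Pt).map (shift n) = μ.map Pt := by
  have hν : IsProbabilityMeasure (μ.map Pt) := Measure.isProbabilityMeasure_map hPt.aemeasurable
  exact map_shift_of_map_shift_one
    (map_shift_one_of_exchangeable ((isExchangeable_iff hPt).1 h)) n

theorem IsExchangeable.map_freqProcess_eq (hPt : Measurable Pt) (h : IsExchangeable μ Pt)
    (n : ℕ) : μ.map (freqProcess Pt n) = μ.map (freqProcess Pt 0) := by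
  rw [map_freqProcess hPt, map_freqProcess hPt, h.map_shift hPt, h.map_shift hPt]

/-- The partition and its shift are both swap invariant, so equality of the laws of their
frequencies gives equality of their laws. -/
theorem isExchangeable_of_map_freqProcess_eq (hPt : Measurable Pt)
    (hν : SwapInvariant (μ.map Pt))
    (h : μ.map (freqProcess Pt 1) = μ.map (freqProcess Pt 0)) : IsExchangeable μ Pt := by
  have hp : IsProbabilityMeasure (μ.map Pt) := Measure.isProbabilityMeasure_map hPt.aemeasurable
  have h1 : SwapInvariant ((μ.map Pt).map (shift 1)) := by
    rw [Measure.map_map (measurable_shift 1) hPt]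
    exact swapInvariant_map_shift_univ hPt hν 1
  rw [map_freqProcess hPt, map_freqProcess hPt,
    show shift 0 = id from funext shift_zero, Measure.map_id] at h
  exact (isExchangeable_iff hPt).2
    (hν.exchangeable_of_stationary (h1.eq_of_map_freqs_eq hν h))

/-- Events of the future frequencies are events of the partition shifted by `n + 1`; by shift
invariance the step from `n + 1` to `n` reduces to the one from 1 to 0. -/
theorem isReversedMarkovChain_freqProcess (hPt : Measurable Pt) (hν : SwapInvariant (μ.map Pt))
    (h : IsExchangeable μ Pt) : IsReversedMarkovChain μ (freqProcess Pt) randomToTop := by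
  have hp : IsProbabilityMeasure (μ.map Pt) := Measure.isProbabilityMeasure_map hPt.aemeasurable
  have hY := measurable_freqProcess hPt
  have hsh : ∀ n, Measurable fun ω => shift n (Pt ω) := fun n => (measurable_shift n).comp hPt
  have hlaw : ∀ n, μ.map (fun ω => shift n (Pt ω)) = μ.map Pt := fun n => by
    rw [← h.map_shift hPt n, Measure.map_map (measurable_shift n) hPt]
    rfl
  have hfut : ∀ n, future (freqProcess Pt) n ≤ ‹MeasurableSpace Ω› := fun n =>
    (future_freqProcess_le Pt n).trans (hsh n).comap_le
  refine ⟨inferInstance, hY, fun n B hB => ?_⟩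
  refine ae_eq_condExp_of_setLIntegral (hfut (n + 1)) (hY n hB)
    ((randomToTop.measurable_coe hB).ennreal_toReal.comp (measurable_future _ (n + 1)))
    (fun ω => measureReal_nonneg) (fun ω => measureReal_le_one) fun A hA => ?_
  obtain ⟨C, hC, rfl⟩ := future_freqProcess_le Pt (n + 1) A hA
  have key := measure_freqs_inter_shift_one hν ((isExchangeable_iff hPt).1 h) hC hB
  have hm : Measurable fun s => randomToTop (freqs s) B :=
    (randomToTop.measurable_coe hB).comp measurable_freqs
  have e1 : μ.map Pt (freqs ⁻¹' B ∩ shift 1 ⁻¹' C) =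
      μ ((fun ω => shift (n + 1) (Pt ω)) ⁻¹' C ∩ freqProcess Pt n ⁻¹' B) := by
    rw [← hlaw n, Measure.map_apply (hsh n)
      ((measurable_freqs hB).inter (measurable_shift 1 hC)), Set.inter_comm]
    congr 1
    ext ω
    simp only [Set.mem_inter_iff, Set.mem_preimage, shift_shift]
    rfl
  have e2 : ∫⁻ s in C, randomToTop (freqs s) B ∂(μ.map Pt) =
      ∫⁻ ω in (fun ω => shift (n + 1) (Pt ω)) ⁻¹' C,
        randomToTop (freqProcess Pt (n + 1) ω) B ∂μ := by
    rw [← hlaw (n + 1), Measure.restrict_map (hsh (n + 1)) hC, lintegral_map hm (hsh (n + 1))]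
    rfl
  rw [← e1, key, e2]
  exact lintegral_congr fun ω => (ofReal_measureReal (measure_ne_top _ _)).symm

end Markov

end PEP

/-! ### The theorem -/

theorem corollary2 {Ω : Type*} [MeasurableSpace Ω] (μ : Measure Ω) [IsProbabilityMeasure μ]
    (Pt : Ω → Setoid ℕ) (hPt : PEP.IsRandomPartition Pt)
    (hPE : PEP.IsPartiallyExchangeable μ Pt) :
    -- the frequencies exist almost surely, and form sub-probability distributions
    (∀ᵐ ω ∂μ, ∀ n j : ℕ, Tendsto (PEP.relFreq (PEP.shift n (Pt ω)) j) atTop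
      (𝓝 ((PEP.freqProcess Pt n ω).1 j))) ∧
    -- they form a Markov chain whose transition is the top to random move
    PEP.IsMarkovChain μ (PEP.freqProcess Pt) PEP.topToRandom ∧
    -- the moves are realized by random positions with the stated conditional distribution
    (∀ n : ℕ, ∃ X : Ω → ℕ, Measurable X ∧
      (∀ᵐ ω ∂μ,
        ((PEP.freqProcess Pt n ω).1 0 = 0 →
          PEP.freqProcess Pt (n + 1) ω = PEP.dropTop (PEP.freqProcess Pt n ω)) ∧
        (0 < (PEP.freqProcess Pt n ω).1 0 →
          1 ≤ X ω ∧
          PEP.freqProcess Pt (n + 1) ω = PEP.moveTopTo (X ω) (PEP.freqProcess Pt n ω))) ∧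
      ∀ j : ℕ, ∀ᵐ ω ∂μ, 0 < (PEP.freqProcess Pt n ω).1 0 →
        (μ⟦{ω' | j < X ω'} | PEP.past (PEP.freqProcess Pt) n⟧) ω =
          PEP.posTail (PEP.freqProcess Pt n ω) j) ∧
    -- exchangeability is equivalent to stationarity of the chain
    (PEP.IsExchangeable μ Pt ↔
      μ.map (PEP.freqProcess Pt 1) = μ.map (PEP.freqProcess Pt 0)) ∧
    (PEP.IsExchangeable μ Pt ↔
      ∀ n : ℕ, 1 ≤ n → μ.map (PEP.freqProcess Pt n) = μ.map (PEP.freqProcess Pt 0)) ∧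
    -- in the exchangeable case the reversed chain moves random to top
    (PEP.IsExchangeable μ Pt →
      PEP.IsReversedMarkovChain μ (PEP.freqProcess Pt) PEP.randomToTop) := by
  have hm : Measurable Pt := PEP.measurable_of_rel hPt
  have hν : PEP.SwapInvariant (μ.map Pt) := hPE.swapInvariant hm
  have hprob : IsProbabilityMeasure (μ.map Pt) :=
    Measure.isProbabilityMeasure_map hm.aemeasurable
  refine ⟨?_, PEP.isMarkovChain_freqProcess hm hν, fun n => ?_,
    ⟨fun h => h.map_freqProcess_eq hm 1, PEP.isExchangeable_of_map_freqProcess_eq hm hν⟩,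
    ⟨fun h n _ => h.map_freqProcess_eq hm n,
      fun h => PEP.isExchangeable_of_map_freqProcess_eq hm hν (h 1 le_rfl)⟩,
    PEP.isReversedMarkovChain_freqProcess hm hν⟩
  · filter_upwards [ae_of_ae_map hm.aemeasurable hν.ae_hasFreqs] with ω hω n j
    exact hω.shift n j
  · have hsh : Measurable fun ω => PEP.shift n (Pt ω) := (PEP.measurable_shift n).comp hm
    refine ⟨fun ω => PEP.position (PEP.shift n (Pt ω)), PEP.measurable_position.comp hsh, ?_,
      PEP.condExp_position hm hν n⟩
    have := Measure.isProbabilityMeasure_map (μ := μ) hsh.aemeasurable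
    filter_upwards [ae_of_ae_map hsh.aemeasurable
      (PEP.swapInvariant_map_shift_univ hm hν n).ae_freqs_shift_one] with ω hω
    rw [PEP.freqProcess_succ]
    exact hω
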